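/- Let $M$ be a smooth $4$-manifold and let $\mathcal D$ be an Engel structure on $M$, i.e. a smooth distribution of rank $2$ such that $\mathcal E=[\mathcal D,\mathcal D]$ has constant rank $3$ and $[\mathcal E,\mathcal E]=TM$. Let $\mathcal W\subset\mathcal D$ be its Cauchy characteristic line field, i.e. the annihilator of the tensorial pairing $\mathcal E\otimes\mathcal E\to TM/\mathcal E$ induced by the Lie bracket. For $a<b$, a nonsingular $\mathcal D$-curve (resp. $\mathcal W$-curve) is a smooth curve $\gamma:[a,b]\to M$ whose velocity is nowhere zero and is everywhere tangent to $\mathcal D$ (resp. $\mathcal W$). A nonsingular $\mathcal D$-curve $\gamma:[a,b]\to M$ is called linearly strongly flexible (LSF) if for some $\varepsilon>0$ there is a smooth map $\Gamma:(-\varepsilon,\varepsilon)\times[a,b]\to M$ with $\Gamma(0,\cdot)=\gamma$ such that (i) $\Gamma(s,\cdot)$ is a nonsingular $\mathcal D$-curve for every $s\in(-\varepsilon,\varepsilon)$; (ii) $\Gamma(s,t)=\gamma(t)$ for all $(s,t)$ in some neighborhood of $(-\varepsilon,\varepsilon)\times\{a,b\}$ in $(-\varepsilon,\varepsilon)\times[a,b]$;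 (iii) $\frac{\partial\Gamma}{\partial s}(0,t)\notin\mathcal E_{\Gamma(0,t)}$ for some $t\in(a,b)$. It is called infinitesimally weakly rigid (IWR) if it is not LSF. Then for every nonsingular $\mathcal D$-curve $\gamma:[a,b]\to M$: 1) if $\gamma$ is not a $\mathcal W$-curve, then $\gamma$ is LSF; 2) $\gamma$ is IWR if and only if it is a $\mathcal W$-curve; in particular every nonsingular $\mathcal W$-curve is IWR, with no restriction on its length. -/

import Mathlib

open scoped Manifold ContDiff Topology

noncomputable section

namespace Engel

/-- The model space of the manifolds considered here. -/
abbrev E4 : Type := EuclideanSpace ℝ (Fin 4)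

/-- A field of linear subspaces of the tangent spaces of a 4-manifold without boundary; smoothness
and constancy of the rank are imposed separately. -/
abbrev Distribution (M : Type*) [TopologicalSpace M] [ChartedSpace E4 M] : Type _ :=
  ∀ x : M, Submodule ℝ (TangentSpace (𝓡 4) x)

variable {M : Type*} [TopologicalSpace M] [ChartedSpace E4 M] [IsManifold (𝓡 4) ∞ M]

/-- `X` is a smooth vector field on the open set `U` (its values outside `U` play no role). -/
structure IsSmoothVectorFieldOn (U : Set M) (X : ∀ x : M, TangentSpace (𝓡 4) x) : Prop where
  isOpen : IsOpen U
  smooth : ContMDiffOn (𝓡 4) (𝓡 4).tangent ∞ (fun y => (⟨y, X y⟩ : TangentBundle (𝓡 4) M)) U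

/-- `X` is a smooth section over the open set `U` of the distribution `A`. -/
structure IsSection (A : Distribution M) (U : Set M) (X : ∀ x : M, TangentSpace (𝓡 4) x) : Prop
    extends IsSmoothVectorFieldOn U X where
  mem : ∀ y ∈ U, X y ∈ A y

/-- `A` is a smooth distribution of constant rank `k`: near every point it has a smooth frame
consisting of `k` vector fields. -/
def IsSmoothOfRank (k : ℕ) (A : Distribution M) : Prop :=
  ∀ x : M, ∃ U : Set M, x ∈ U ∧ ∃ X : Fin k → ∀ y : M, TangentSpace (𝓡 4) y,
    (∀ i, IsSmoothVectorFieldOn U (X i)) ∧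
    ∀ y ∈ U, LinearIndependent ℝ (fun i => X i y) ∧
      Submodule.span ℝ (Set.range fun i => X i y) = A y

/-- The derived distribution `[A, A]`: at `x` it is spanned by the values at `x` of the Lie
brackets of smooth local sections of `A` near `x`. -/
def derived (A : Distribution M) : Distribution M := fun x =>
  Submodule.span ℝ {v | ∃ (U : Set M) (X Y : ∀ y : M, TangentSpace (𝓡 4) y),
    x ∈ U ∧ IsSection A U X ∧ IsSection A U Y ∧ VectorField.mlieBracket (𝓡 4) X Y x = v}

/-- An Engel structure on the 4-manifold `M`: a smooth distribution `D` of rank two such that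
`E = [D, D]` has constant rank three and `[E, E] = TM`. -/
structure IsEngelStructure (D : Distribution M) : Prop where
  smooth : IsSmoothOfRank 2 D
  rank_derived : ∀ x : M, Module.finrank ℝ (derived D x) = 3
  derived_derived : ∀ x : M, derived (derived D) x = ⊤

/-- The even contact structure `E = [D, D]` of an Engel structure `D`. -/
def evenContact (D : Distribution M) : Distribution M := derived D

/-- The annihilator of the bracket pairing `A ⊗ A → TM / A`: at `x` it consists of the values
`X x` of local sections `X` of `A` such that `[X, Y] x ∈ A x` for all local sections `Y` of `A`.
As the pairing is tensorial, the choice of the section `X` extending a given vector is irrelevant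
when `A` is smooth of constant rank. -/
def annihilator (A : Distribution M) : Distribution M := fun x =>
  { carrier := {v | ∃ (U : Set M) (X : ∀ y : M, TangentSpace (𝓡 4) y),
      x ∈ U ∧ IsSection A U X ∧ X x = v ∧
      ∀ (V : Set M) (Y : ∀ y : M, TangentSpace (𝓡 4) y), x ∈ V → IsSection A V Y →
        VectorField.mlieBracket (𝓡 4) X Y x ∈ A x}
    zero_mem' := by
      refine ⟨Set.univ, 0, Set.mem_univ _, ⟨⟨isOpen_univ, ?_⟩, fun y _ => (A y).zero_mem⟩, rfl, ?_⟩
      · exact (Bundle.contMDiff_zeroSection ℝ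
          (TangentSpace (𝓡 4) : M → Type _)).contMDiffOn
      · intro V Y _ _
        rw [VectorField.mlieBracket_zero_left]
        exact (A x).zero_mem
    add_mem' := by
      rintro v w ⟨U, X, hxU, hX, rfl, hX'⟩ ⟨U', X', hxU', hX1, rfl, hX1'⟩
      refine ⟨U ∩ U', X + X', ⟨hxU, hxU'⟩, ⟨⟨hX.isOpen.inter hX1.isOpen, ?_⟩, ?_⟩, rfl, ?_⟩
      · exact (hX.smooth.mono Set.inter_subset_left).add_section
          (hX1.smooth.mono Set.inter_subset_right)
      · exact fun y hy => (A y).add_mem (hX.mem y hy.1) (hX1.mem y hy.2)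
      · intro V Y hxV hY
        rw [VectorField.mlieBracket_add_left
          ((hX.smooth.contMDiffAt (hX.isOpen.mem_nhds hxU)).mdifferentiableAt (by simp))
          ((hX1.smooth.contMDiffAt (hX1.isOpen.mem_nhds hxU')).mdifferentiableAt (by simp))]
        exact (A x).add_mem (hX' V Y hxV hY) (hX1' V Y hxV hY)
    smul_mem' := by
      rintro c v ⟨U, X, hxU, hX, rfl, hX'⟩
      refine ⟨U, c • X, hxU, ⟨⟨hX.isOpen, ?_⟩, ?_⟩, rfl, ?_⟩
      · exact hX.smooth.const_smul_section
      · exact fun y hy => (A y).smul_mem c (hX.mem y hy)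
      · intro V Y hxV hY
        rw [VectorField.mlieBracket_const_smul_left
          ((hX.smooth.contMDiffAt (hX.isOpen.mem_nhds hxU)).mdifferentiableAt (by simp))]
        exact (A x).smul_mem c (hX' V Y hxV hY) }

/-- The Cauchy characteristic `W` of an Engel structure `D`: the annihilator of the bracket
pairing `E ⊗ E → TM / E` of its even contact structure `E`. -/
def cauchyCharacteristic (D : Distribution M) : Distribution M := annihilator (evenContact D)

/-- The velocity at time `t ∈ [a, b]` of a curve `γ : [a, b] → M` (one-sided at the end points;
the values of `γ` outside `[a, b]` play no role). -/
def velocity (a b : ℝ) (γ : ℝ → M) (t : ℝ) : TangentSpace (𝓡 4) (γ t) :=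
  mfderivWithin 𝓘(ℝ, ℝ) (𝓡 4) γ (Set.Icc a b) t (1 : ℝ)

/-- `γ : [a, b] → M` is a nonsingular `A`-curve: it is smooth, its velocity vanishes nowhere and
it is everywhere tangent to `A`. -/
structure IsNonsingularCurve (A : Distribution M) (a b : ℝ) (γ : ℝ → M) : Prop where
  smooth : ContMDiffOn 𝓘(ℝ, ℝ) (𝓡 4) ∞ γ (Set.Icc a b)
  velocity_ne_zero : ∀ t ∈ Set.Icc a b, velocity a b γ t ≠ 0
  tangent : ∀ t ∈ Set.Icc a b, velocity a b γ t ∈ A (γ t)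

/-- The nonsingular `D`-curve `γ : [a, b] → M` is linearly strongly flexible: there is a smooth
deformation `Γ : (-ε, ε) × [a, b] → M` of `γ` through nonsingular `D`-curves, constant in a
neighborhood of `(-ε, ε) × {a, b}`, whose variation field at `s = 0` leaves `E` somewhere. -/
def IsLSF (D : Distribution M) (a b : ℝ) (γ : ℝ → M) : Prop :=
  IsNonsingularCurve D a b γ ∧
  ∃ ε : ℝ, 0 < ε ∧ ∃ Γ : ℝ → ℝ → M,
    ContMDiffOn 𝓘(ℝ, ℝ × ℝ) (𝓡 4) ∞ (fun p : ℝ × ℝ => Γ p.1 p.2)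
      (Set.Ioo (-ε) ε ×ˢ Set.Icc a b) ∧
    (∀ t ∈ Set.Icc a b, Γ 0 t = γ t) ∧
    (∀ s ∈ Set.Ioo (-ε) ε, IsNonsingularCurve D a b (Γ s)) ∧
    (∃ N : Set (ℝ × ℝ), IsOpen N ∧ Set.Ioo (-ε) ε ×ˢ ({a, b} : Set ℝ) ⊆ N ∧
      ∀ s ∈ Set.Ioo (-ε) ε, ∀ t ∈ Set.Icc a b, (s, t) ∈ N → Γ s t = γ t) ∧
    ∃ t ∈ Set.Ioo a b,
      mfderiv 𝓘(ℝ, ℝ) (𝓡 4) (fun s : ℝ => Γ s t) 0 (1 : ℝ) ∉ evenContact D (Γ 0 t)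

/-- The nonsingular `D`-curve `γ : [a, b] → M` is infinitesimally weakly rigid: it is not linearly
strongly flexible. -/
def IsIWR (D : Distribution M) (a b : ℝ) (γ : ℝ → M) : Prop :=
  IsNonsingularCurve D a b γ ∧ ¬ IsLSF D a b γ

/-- `γ : [a, b] → M` is a nonsingular `W`-curve (Cauchy characteristic curve) of `D`. -/
def IsCauchyCharacteristicCurve (D : Distribution M) (a b : ℝ) (γ : ℝ → M) : Prop :=
  IsNonsingularCurve (cauchyCharacteristic D) a b γ

end Engel

end

/-! Everything rests on the Engel normal form: near each point there are coordinates `(x, y, z, w)`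
in which `E` is `dy = z dx`, `D` is `dy = z dx, dz = w dx`, and the Cauchy characteristic `W` is
spanned by `∂_w` (`IsEngelStructure.exists_engelChart`).

Flexibility. A vector of `D` with `dx = 0` also has `dy = dz = 0`, so it lies in `W`. A `D`-curve
that is not a `W`-curve therefore has `x' ≠ 0` at some time, which may be taken in the open
interval. Adding `s (φ(x), φ'(x), φ''(x))` to `(y, z, w)` and leaving `x` alone preserves both
equations of `D`. Choosing `φ` equal to `1` at the value of `x` there and supported away from the
values of `x` at the ends of a short interval gives a deformation localized in time. Its variation
field has `dy - z dx = φ(x) = 1` at the chosen time, hence leaves `E`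
(`IsEngelChart.velocity_deform`, `isLSF_of_not_isCauchyCharacteristicCurve`).

Rigidity. For a deformation of a `W`-curve through `D`-curves, put `λ(t) = ∂_s y - z ∂_s x` at `s =
0`. Since `∂_t x = ∂_t z = 0` along the `W`-curve, differentiating `∂_t y = z ∂_t x` in `s` gives
`λ' = 0` (`hasFDerivAt_contact_variation`). The value `λ` depends on the chart, but its vanishing
means exactly that the variation lies in `E`, so the set of such times is open and closed in `(a,
b)` (`eventually_variation_mem_iff`). It contains the times near `a`, where the deformation is
constant; by connectedness it is everything, whatever the length of the curve.

The normal form. If `X₁, X₂` is a frame of `D` and `α` a form with kernel `E`, the radical of `dα`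
on `E` lies in `D`, and rotating the frame makes its second field `Y` span `W`
(`DerivedFrame.engelFrame`). Straightening `Y` shows that the direction of `α` depends on three
variables only. A first integral of a direction field in two of them, the third being a parameter,
brings `α` to a multiple of `dy - z dx` (`EngelFrame.exists_contact_coordinates`). The slope `w =
dz(X) / dx(X)` is the fourth coordinate, and the non-integrability conditions say precisely that `Y
w ≠ 0`. Straightening needs smooth dependence of a flow on its initial point, obtained from the
inverse function theorem in a Banach space of curves. -/

noncomputable section

namespace Engel

open Set Filter VectorField
open scoped Manifold ContDiff Topology

/-! ### Smoothness of superposition operators `y ↦ V ∘ y` on spaces of continuous maps. -/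

section Nemytskii

variable {K : Type*} [TopologicalSpace K]

/-- Post-composition with a continuous map, as a map between spaces of continuous functions. -/
def postcomp {E F : Type*} [TopologicalSpace E] [TopologicalSpace F] {V : E → F}
    (hV : Continuous V) (y : C(K, E)) : C(K, F) := ⟨fun k => V (y k), hV.comp y.continuous⟩

lemma continuous_postcomp {E F : Type*} [TopologicalSpace E] [TopologicalSpace F] {V : E → F}
    (hV : Continuous V) : Continuous (postcomp (K := K) hV) :=
  ContinuousMap.continuous_postcomp (⟨V, hV⟩ : C(E, F))

variable [CompactSpace K]

/-- Pointwise application of a continuous family of continuous linear maps. -/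
def pointwiseApply {E F : Type*} [NormedAddCommGroup E] [NormedSpace ℝ E]
    [NormedAddCommGroup F] [NormedSpace ℝ F] :
    C(K, E →L[ℝ] F) →L[ℝ] C(K, E) →L[ℝ] C(K, F) :=
  LinearMap.mkContinuous₂
    (LinearMap.mk₂ ℝ (fun (A : C(K, E →L[ℝ] F)) (h : C(K, E)) =>
        (⟨fun k => A k (h k), A.continuous.clm_apply h.continuous⟩ : C(K, F)))
      (fun _ _ _ => by ext; simp) (fun _ _ _ => by ext; simp)
      (fun _ _ _ => by ext; simp) (fun _ _ _ => by ext; simp)) 1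
    (fun A h => by
      rw [one_mul, ContinuousMap.norm_le _ (by positivity)]
      intro k
      exact ((A k).le_opNorm _).trans
        (mul_le_mul (A.norm_coe_le_norm k) (h.norm_coe_le_norm k) (norm_nonneg (h k))
          (norm_nonneg A)))

@[simp] lemma pointwiseApply_apply {E F : Type*} [NormedAddCommGroup E] [NormedSpace ℝ E]
    [NormedAddCommGroup F] [NormedSpace ℝ F] (A : C(K, E →L[ℝ] F)) (h : C(K, E)) (k : K) :
    pointwiseApply A h k = A k (h k) := rfl

/-- The pointwise mean value inequality is uniform over the compact space because `y ↦ fderiv ℝ V ∘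
y` is continuous for the sup norm. -/
lemma hasFDerivAt_postcomp {E F : Type*} [NormedAddCommGroup E] [NormedSpace ℝ E]
    [NormedAddCommGroup F] [NormedSpace ℝ F] {V : E → F} (hV : ContDiff ℝ 1 V) (y : C(K, E)) :
    HasFDerivAt (postcomp (K := K) hV.continuous)
      (pointwiseApply (postcomp (hV.continuous_fderiv one_ne_zero) y)) y := by
  rw [hasFDerivAt_iff_isLittleO_nhds_zero, Asymptotics.isLittleO_iff]
  intro ε hε
  have hc := (continuous_postcomp (K := K) (hV.continuous_fderiv one_ne_zero)).continuousAt (x := y)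
  obtain ⟨δ, hδ, hδ'⟩ := (Metric.continuousAt_iff (α := C(K, E)) (β := C(K, E →L[ℝ] F))).1 hc ε hε
  have key : ∀ (k : K) (z : E), z ∈ Metric.ball (y k) δ →
      ‖fderiv ℝ V z - fderiv ℝ V (y k)‖ ≤ ε := by
    intro k z hz
    -- Translating all of `y` by the constant `z - y k` gives a map within `δ` of `y` that takes the
    -- value `z` at `k`, so the sup norm estimate can be read at `z`.
    have h1 : dist (y + ContinuousMap.const K (z - y k)) y < δ := by
      rw [dist_eq_norm, add_sub_cancel_left]
      refine lt_of_le_of_lt ((ContinuousMap.norm_le _ (norm_nonneg _)).2 fun _ => le_rfl) ?_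
      rwa [mem_ball_iff_norm] at hz
    have h2 := (ContinuousMap.dist_apply_le_dist k).trans (hδ' h1).le
    simpa [postcomp, dist_eq_norm] using h2
  filter_upwards [Metric.ball_mem_nhds (0 : C(K, E)) hδ] with h hh
  rw [ContinuousMap.norm_le _ (by positivity)]
  intro k
  rw [mem_ball_zero_iff] at hh
  have hk : ‖h k‖ < δ := (h.norm_coe_le_norm k).trans_lt hh
  have := (convex_ball (y k) δ).norm_image_sub_le_of_norm_hasFDerivWithin_le'
    (f := V) (f' := fderiv ℝ V) (φ := fderiv ℝ V (y k)) (C := ε)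
    (x := y k) (y := y k + h k)
    (fun z _ => (hV.differentiable one_ne_zero z).hasFDerivAt.hasFDerivWithinAt)
    (key k) (Metric.mem_ball_self hδ) (by simpa [mem_ball_iff_norm] using hk)
  refine le_trans (le_of_eq_of_le ?_ this) ?_
  · simp [postcomp]
  · rw [add_sub_cancel_left]
    exact mul_le_mul_of_nonneg_left (h.norm_coe_le_norm k) hε.le

-- The derivative of a superposition operator is again built from one, with `fderiv ℝ V` in place of
-- `V`; hence the induction on the order. The target must vary in the induction, from `F` to `E
-- →L[ℝ] F`, which is why both spaces share a universe.
universe u in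
lemma contDiff_postcomp_nat {E : Type u} [NormedAddCommGroup E] [NormedSpace ℝ E] (n : ℕ) :
    ∀ {F : Type u} [NormedAddCommGroup F] [NormedSpace ℝ F] {V : E → F} (hc : Continuous V),
    ContDiff ℝ n V → ContDiff ℝ n (postcomp (K := K) hc) := by
  induction n with
  | zero =>
    intro F _ _ V hc hV
    exact contDiff_zero.2 (continuous_postcomp _)
  | succ n ih =>
    intro F _ _ V hc hV
    have h1 : ContDiff ℝ 1 V := hV.of_le (by exact_mod_cast Nat.le_add_left 1 n)
    have h2 : ContDiff ℝ n (fderiv ℝ V) := hV.fderiv_right (by norm_cast)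
    rw [Nat.cast_add, Nat.cast_one, contDiff_succ_iff_hasFDerivAt]
    exact ⟨_, pointwiseApply.contDiff.comp (ih _ h2), hasFDerivAt_postcomp h1⟩

lemma contDiff_postcomp {E F : Type} [NormedAddCommGroup E] [NormedSpace ℝ E]
    [NormedAddCommGroup F] [NormedSpace ℝ F] {V : E → F} (hV : ContDiff ℝ ∞ V) :
    ContDiff ℝ ∞ (postcomp (K := K) hV.continuous) :=
  contDiff_infty.2 fun n => contDiff_postcomp_nat n _ (hV.of_le (by exact_mod_cast le_top))

end Nemytskii

/-! ### Smoothness on a neighborhood, and the inverse function theorem in that form. -/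

section Smooth

variable {E F G : Type*} [NormedAddCommGroup E] [NormedSpace ℝ E] [NormedAddCommGroup F]
  [NormedSpace ℝ F] [NormedAddCommGroup G] [NormedSpace ℝ G]

/-- `f` is smooth in a neighborhood of `p`. -/
def SmoothNear (f : E → F) (p : E) : Prop := ∀ᶠ q in 𝓝 p, ContDiffAt ℝ ∞ f q

namespace SmoothNear

variable {f g : E → F} {p : E}

lemma at_self (h : SmoothNear f p) : ContDiffAt ℝ ∞ f p := h.self_of_nhds

lemma differentiableAt (h : SmoothNear f p) : DifferentiableAt ℝ f p :=
  h.at_self.differentiableAt (by simp)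

lemma continuousAt (h : SmoothNear f p) : ContinuousAt f p := h.at_self.continuousAt

/-- This stability is the point of the notion: `ContDiffAt ℝ ∞ f p` only provides one neighborhood
for each finite order, possibly shrinking with the order. -/
lemma eventually (h : SmoothNear f p) : ∀ᶠ q in 𝓝 p, SmoothNear f q :=
  eventually_eventually_nhds.2 h

lemma comp {g : F → G} (hg : SmoothNear g (f p)) (hf : SmoothNear f p) :
    SmoothNear (fun q => g (f q)) p := by
  filter_upwards [hf.continuousAt.eventually hg, hf] with q hq hq'
  exact ContDiffAt.comp q hq hq'

lemma fderiv (h : SmoothNear f p) : SmoothNear (fderiv ℝ f) p := by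
  filter_upwards [h] with q hq
  exact hq.fderiv_right (by simp)

lemma clm_apply {A : E → F →L[ℝ] G} (hA : SmoothNear A p) (hf : SmoothNear f p) :
    SmoothNear (fun q => A q (f q)) p := by
  filter_upwards [hA, hf] with q hq hq'
  exact hq.clm_apply hq'

lemma add (hf : SmoothNear f p) (hg : SmoothNear g p) : SmoothNear (fun q => f q + g q) p := by
  filter_upwards [hf, hg] with q hq hq' using hq.add hq'

lemma sub (hf : SmoothNear f p) (hg : SmoothNear g p) : SmoothNear (fun q => f q - g q) p := by
  filter_upwards [hf, hg] with q hq hq' using hq.sub hq'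

lemma smul {a : E → ℝ} (ha : SmoothNear a p) (hf : SmoothNear f p) :
    SmoothNear (fun q => a q • f q) p := by
  filter_upwards [ha, hf] with q hq hq' using hq.smul hq'

lemma mul {a b : E → ℝ} (ha : SmoothNear a p) (hb : SmoothNear b p) :
    SmoothNear (fun q => a q * b q) p := by
  filter_upwards [ha, hb] with q hq hq' using hq.mul hq'

lemma div {a b : E → ℝ} (ha : SmoothNear a p) (hb : SmoothNear b p) (h0 : b p ≠ 0) :
    SmoothNear (fun q => a q / b q) p := by
  filter_upwards [ha, hb, hb.continuousAt.eventually_ne h0] with q hq hq' h using hq.div hq' h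

lemma prodMk {g : E → G} (hf : SmoothNear f p) (hg : SmoothNear g p) :
    SmoothNear (fun q => (f q, g q)) p := by
  filter_upwards [hf, hg] with q hq hq' using hq.prodMk hq'

lemma lieBracket {X Y : E → E} (hX : SmoothNear X p) (hY : SmoothNear Y p) :
    SmoothNear (VectorField.lieBracket ℝ X Y) p := by
  filter_upwards [hX, hY] with q hq hq' using hq.lieBracket_vectorField hq' (by simp)

end SmoothNear

lemma _root_.ContDiff.smoothNear {f : E → F} (h : ContDiff ℝ ∞ f) (p : E) : SmoothNear f p :=
  Eventually.of_forall fun _ => h.contDiffAt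

lemma smoothNear_const (c : F) (p : E) : SmoothNear (fun _ => c) p := contDiff_const.smoothNear p

lemma _root_.ContinuousLinearMap.smoothNear (f : E →L[ℝ] F) (p : E) : SmoothNear f p :=
  f.contDiff.smoothNear p

lemma _root_.ContDiffOn.smoothNear {f : E → F} {s : Set E} (h : ContDiffOn ℝ ∞ f s)
    (hs : IsOpen s) {p : E} (hp : p ∈ s) : SmoothNear f p := by
  filter_upwards [hs.mem_nhds hp] with q hq using h.contDiffAt (hs.mem_nhds hq)

/-- The inverse function theorem, with smoothness on the whole domains. -/
theorem SmoothNear.exists_openPartialHomeomorph [CompleteSpace E] {f : E → F} {p : E}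
    (hf : SmoothNear f p) (f' : E ≃L[ℝ] F) (hf' : HasFDerivAt f (f' : E →L[ℝ] F) p)
    {s : Set E} (hs : s ∈ 𝓝 p) :
    ∃ e : OpenPartialHomeomorph E F, (∀ q, e q = f q) ∧ p ∈ e.source ∧ e.source ⊆ s ∧
      ContDiffOn ℝ ∞ e e.source ∧ ContDiffOn ℝ ∞ e.symm e.target := by
  have hinv : ∀ᶠ q in 𝓝 p, ∃ A : E ≃L[ℝ] F, (A : E →L[ℝ] F) = _root_.fderiv ℝ f q := by
    have h1 := hf.fderiv.continuousAt
    have h2 : range ((↑) : (E ≃L[ℝ] F) → E →L[ℝ] F) ∈ 𝓝 (_root_.fderiv ℝ f p) := by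
      rw [hf'.fderiv]; exact ContinuousLinearEquiv.nhds f'
    exact h1.eventually h2
  -- The homeomorphism is restricted to an open set on which `f` is smooth and its derivative stays
  -- invertible, so that the inverse is smooth on the entire target.
  obtain ⟨U, hU, hUo, hpU⟩ := eventually_nhds_iff.1 (hf.and (hinv.and hs))
  let e0 := hf.at_self.toOpenPartialHomeomorph f hf' (by simp)
  refine ⟨e0.restrOpen U hUo, fun q => rfl, ⟨?_, hpU⟩, ?_, ?_, ?_⟩
  · exact hf.at_self.mem_toOpenPartialHomeomorph_source hf' (by simp)
  · rintro q ⟨-, hq⟩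
    exact (hU q hq).2.2
  · rintro q ⟨-, hq⟩
    exact (hU q hq).1.contDiffWithinAt
  · intro y hy
    have hm := (e0.restrOpen U hUo).map_target hy
    obtain ⟨h1, ⟨A, hA⟩, -⟩ := hU _ hm.2
    refine ((e0.restrOpen U hUo).contDiffAt_symm (f₀' := A) hy ?_ h1).contDiffWithinAt
    rw [hA]
    exact (h1.differentiableAt (by simp)).hasFDerivAt

end Smooth

/-! ### Smooth dependence of flows on initial conditions, and straightening of vector fields. -/

/-- The primitive vanishing at `0`, as an operator on continuous curves on `[0, 1]`. -/
def primitive {E : Type*} [NormedAddCommGroup E] [NormedSpace ℝ E] :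
    C(Icc (0 : ℝ) 1, E) →L[ℝ] C(Icc (0 : ℝ) 1, E) :=
  LinearMap.mkContinuous
    { toFun := fun y => ⟨fun τ => ∫ σ in (0 : ℝ)..τ, IccExtend zero_le_one y σ,
        (intervalIntegral.continuous_primitive
          (fun _ _ => (y.continuous.Icc_extend' (h := zero_le_one)).intervalIntegrable _ _)
          0).comp continuous_subtype_val⟩
      map_add' := fun y z => by
        ext τ
        exact intervalIntegral.integral_add
          ((y.continuous.Icc_extend' (h := zero_le_one)).intervalIntegrable _ _)
          ((z.continuous.Icc_extend' (h := zero_le_one)).intervalIntegrable _ _)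
      map_smul' := fun c y => by
        ext τ
        exact intervalIntegral.integral_smul c _ } 1
    (fun y => by
      rw [one_mul, ContinuousMap.norm_le _ (norm_nonneg y)]
      intro τ
      have := intervalIntegral.norm_integral_le_of_norm_le_const (a := (0 : ℝ)) (b := τ)
        (f := IccExtend zero_le_one y) (C := ‖y‖) (fun σ _ => y.norm_coe_le_norm _)
      refine this.trans ?_
      rw [sub_zero, abs_of_nonneg τ.2.1]
      exact mul_le_of_le_one_right (norm_nonneg y) τ.2.2)

lemma primitive_apply {E : Type*} [NormedAddCommGroup E] [NormedSpace ℝ E]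
    (y : C(Icc (0 : ℝ) 1, E)) (τ : Icc (0 : ℝ) 1) :
    primitive y τ = ∫ σ in (0 : ℝ)..τ, IccExtend zero_le_one y σ := rfl

section Flow

variable {E : Type} [NormedAddCommGroup E] [NormedSpace ℝ E]

/-- Constant curves on `[0, 1]`, as a continuous linear map. -/
def constCurve : E →L[ℝ] C(Icc (0 : ℝ) 1, E) :=
  LinearMap.mkContinuous
    { toFun := fun x => ContinuousMap.const _ x
      map_add' := fun _ _ => rfl
      map_smul' := fun _ _ => rfl } 1
    (fun x => by
      rw [one_mul, ContinuousMap.norm_le _ (norm_nonneg x)]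
      exact fun _ => le_rfl)

@[simp] lemma constCurve_apply (x : E) (τ : Icc (0 : ℝ) 1) : constCurve x τ = x := rfl

/-- The equation `y = x + t ∫ V ∘ y` for curves on `[0, 1]`, with the parameters `t` and `x`. -/
def flowEquation {V : E → E} (hV : Continuous V) (z : (ℝ × E) × C(Icc (0 : ℝ) 1, E)) :
    (ℝ × E) × C(Icc (0 : ℝ) 1, E) :=
  (z.1, z.2 - constCurve z.1.2 - z.1.1 • primitive (postcomp hV z.2))

lemma contDiff_flowEquation {V : E → E} (hV : ContDiff ℝ ∞ V) :
    ContDiff ℝ ∞ (flowEquation hV.continuous) :=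
  contDiff_fst.prodMk ((contDiff_snd.sub
    (constCurve.contDiff.comp contDiff_fst.snd)).sub
      (contDiff_fst.fst.smul (primitive.contDiff.comp ((contDiff_postcomp hV).comp contDiff_snd))))

/-- At `t = 0` the integral term drops out of the partial derivative in the curve, which is thus the
identity. The full derivative is block triangular with identity diagonal blocks. -/
lemma exists_hasFDerivAt_flowEquation {V : E → E} (hV : ContDiff ℝ ∞ V) (p : E) :
    ∃ A : ((ℝ × E) × C(Icc (0 : ℝ) 1, E)) ≃L[ℝ] ((ℝ × E) × C(Icc (0 : ℝ) 1, E)),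
      HasFDerivAt (flowEquation hV.continuous)
        (A : ((ℝ × E) × C(Icc (0 : ℝ) 1, E)) →L[ℝ] ((ℝ × E) × C(Icc (0 : ℝ) 1, E)))
        ((0, p), constCurve p) := by
  set z0 : (ℝ × E) × C(Icc (0 : ℝ) 1, E) := ((0, p), constCurve p) with hz0
  let g : (ℝ × E) × C(Icc (0 : ℝ) 1, E) → C(Icc (0 : ℝ) 1, E) :=
    fun z => primitive (postcomp hV.continuous z.2)
  have hg : DifferentiableAt ℝ g z0 :=
    ((primitive.contDiff.comp ((contDiff_postcomp hV).comp contDiff_snd)).differentiable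
      (by simp)).differentiableAt
  let L₁ : (ℝ × E) × C(Icc (0 : ℝ) 1, E) →L[ℝ] ℝ :=
    (ContinuousLinearMap.fst ℝ ℝ E).comp (ContinuousLinearMap.fst ℝ (ℝ × E) _)
  let L₂ : (ℝ × E) × C(Icc (0 : ℝ) 1, E) →L[ℝ] C(Icc (0 : ℝ) 1, E) :=
    constCurve.comp ((ContinuousLinearMap.snd ℝ ℝ E).comp (ContinuousLinearMap.fst ℝ (ℝ × E) _))
  have h11 : HasFDerivAt (fun z : (ℝ × E) × C(Icc (0 : ℝ) 1, E) => z.1.1) L₁ z0 := L₁.hasFDerivAt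
  have h12 : HasFDerivAt (fun z : (ℝ × E) × C(Icc (0 : ℝ) 1, E) => constCurve z.1.2) L₂ z0 :=
    L₂.hasFDerivAt
  have h := hasFDerivAt_fst.prodMk
    ((hasFDerivAt_snd.sub h12).sub (h11.smul hg.hasFDerivAt))
  refine ⟨ContinuousLinearEquiv.skewProd (ContinuousLinearEquiv.refl ℝ _)
    (ContinuousLinearEquiv.refl ℝ _)
    (-(constCurve.comp (ContinuousLinearMap.snd ℝ ℝ E)) -
      (ContinuousLinearMap.fst ℝ ℝ E).smulRight (g z0)), ?_⟩
  refine h.congr_fderiv ?_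
  refine ContinuousLinearMap.ext fun z => ?_
  refine Prod.ext rfl ?_
  simp [ContinuousLinearEquiv.skewProd_apply, hz0, L₁, L₂]
  abel

variable [CompleteSpace E]

/-- The local flow of a bounded smooth vector field is smooth. -/
theorem exists_smooth_flow_of_bounded {V : E → E} (hV : ContDiff ℝ ∞ V) {C : ℝ}
    (hC : ∀ x, ‖V x‖ ≤ C) (p : E) :
    ∃ Φ : ℝ × E → E, SmoothNear Φ (0, p) ∧ ∀ᶠ z in 𝓝 ((0 : ℝ), p),
      Φ (0, z.2) = z.2 ∧ HasDerivAt (fun t => Φ (t, z.2)) (V (Φ z)) z.1 := by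
  obtain ⟨A, hA⟩ := exists_hasFDerivAt_flowEquation hV p
  -- Inverse function theorem in the Banach space of curves: solutions of the flow equation depend
  -- smoothly on time and initial point.
  obtain ⟨e, he, hpe, -, -, hes⟩ :=
    ((contDiff_flowEquation hV).smoothNear _).exists_openPartialHomeomorph A hA univ_mem
  obtain ⟨r, hr, ε, hε, hα⟩ :=
    (hV.contDiffAt.of_le (by simp) :
      ContDiffAt ℝ 1 V p).exists_forall_mem_closedBall_exists_eq_forall_mem_Ioo_hasDerivAt 0
  simp only [zero_sub, zero_add] at hα
  choose! α hα0 hα using hα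
  have hC0 : 0 ≤ C := (norm_nonneg _).trans (hC p)
  have hz0 : e ((0, p), constCurve p) = ((0, p), 0) := by
    rw [he]
    simp [flowEquation]
  -- Time has been rescaled to `[0, 1]`, so the flow at time `t` is the value at `τ = 1` of the
  -- solution with parameter `t`.
  let Φ : ℝ × E → E := fun z => (e.symm (z, 0)).2 ⟨1, by simp⟩
  have hmem : ((0, p), 0) ∈ e.target := hz0 ▸ e.map_source hpe
  have hΦ : SmoothNear Φ (0, p) := by
    have h1 : SmoothNear e.symm (((0 : ℝ), p), (0 : C(Icc (0 : ℝ) 1, E))) :=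
      hes.smoothNear e.open_target hmem
    have h2 : SmoothNear (fun z : ℝ × E => (z, (0 : C(Icc (0 : ℝ) 1, E)))) (0, p) :=
      (contDiff_id.prodMk contDiff_const).smoothNear _
    exact (((ContinuousMap.evalCLM ℝ _).comp
      (ContinuousLinearMap.snd ℝ (ℝ × E) C(Icc (0 : ℝ) 1, E))).smoothNear _).comp
        (SmoothNear.comp (g := e.symm) (f := fun z : ℝ × E => (z, (0 : C(Icc (0 : ℝ) 1, E)))) h1 h2)
  -- the curve `τ ↦ α x (t τ)` solves the equation and is close to the constant curve
  have key : ∀ᶠ z in 𝓝 ((0 : ℝ), p), Φ z = α z.2 z.1 := by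
    obtain ⟨δ, hδ, hδ'⟩ := Metric.isOpen_iff.1 e.open_source _ hpe
    have hev : ∀ᶠ z in 𝓝 ((0 : ℝ), p), |z.1| < ε ∧ z.2 ∈ Metric.closedBall p r ∧
        ‖z.2 - p‖ + C * |z.1| < δ ∧ |z.1| < δ := by
      have c1 : Tendsto (fun z : ℝ × E => |z.1|) (𝓝 (0, p)) (𝓝 0) := by
        have : Continuous (fun z : ℝ × E => |z.1|) := by fun_prop
        simpa using this.tendsto (0, p)
      have c2 : Tendsto (fun z : ℝ × E => ‖z.2 - p‖ + C * |z.1|) (𝓝 (0, p)) (𝓝 0) := by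
        have : Continuous (fun z : ℝ × E => ‖z.2 - p‖ + C * |z.1|) := by fun_prop
        simpa using this.tendsto (0, p)
      have c3 : ∀ᶠ z in 𝓝 ((0 : ℝ), p), z.2 ∈ Metric.closedBall p r :=
        continuous_snd.continuousAt.eventually (Metric.closedBall_mem_nhds p hr)
      filter_upwards [c1.eventually_lt_const hε, c2.eventually_lt_const hδ, c3,
        c1.eventually_lt_const hδ] with z h1 h2 h3 h4 using ⟨h1, h3, h2, h4⟩
    filter_upwards [hev] with ⟨t, x⟩ ⟨ht, hx, hz, htδ⟩
    dsimp only at ht hx hz htδ ⊢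
    have htτ : ∀ τ ∈ Icc (0 : ℝ) 1, t * τ ∈ Ioo (-ε) ε := fun τ hτ => by
      rw [mem_Ioo, ← abs_lt, abs_mul, abs_of_nonneg hτ.1]
      exact (mul_le_of_le_one_right (abs_nonneg t) hτ.2).trans_lt ht
    have hd : ∀ τ ∈ Icc (0 : ℝ) 1,
        HasDerivAt (fun τ => α x (t * τ)) (t • V (α x (t * τ))) τ := fun τ hτ => by
      have h1 : HasDerivAt (fun τ : ℝ => t * τ) t τ := by
        simpa using (hasDerivAt_id τ).const_mul t
      exact (hα x hx _ (htτ τ hτ)).scomp τ h1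
    let y : C(Icc (0 : ℝ) 1, E) := ⟨fun τ => α x (t * τ),
      continuous_iff_continuousAt.2 fun τ => ContinuousAt.comp (f := Subtype.val)
        (g := fun τ => α x (t * τ)) (hd τ τ.2).continuousAt continuous_subtype_val.continuousAt⟩
    have hyτ : ∀ τ, y τ = α x (t * τ) := fun _ => rfl
    have hsrc : (((t, x), y) : (ℝ × E) × C(Icc (0 : ℝ) 1, E)) ∈ e.source := by
      apply hδ'
      rw [mem_ball_iff_norm, Prod.norm_def, Prod.norm_def]
      refine max_lt (max_lt ?_ ?_) ?_
      · simpa using htδ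
      · exact lt_of_le_of_lt (le_add_of_nonneg_right (by positivity)) hz
      -- The bound `C` on the field controls how far the integral curve moves from its initial
      -- point, which keeps the rescaled curve near the constant curve at `p`.
      · refine lt_of_le_of_lt ((ContinuousMap.norm_le _ (by positivity)).2 fun τ => ?_) hz
        have h1 : ‖y τ - x‖ ≤ C * |t| := by
          have := Convex.norm_image_sub_le_of_norm_hasDerivWithin_le
            (f := fun τ => α x (t * τ)) (f' := fun τ => t • V (α x (t * τ))) (s := Icc (0 : ℝ) 1)
            (C := C * |t|) (x := 0) (y := (τ : ℝ)) (fun τ hτ => (hd τ hτ).hasDerivWithinAt)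
            (fun τ _ => by
              rw [norm_smul, mul_comm, Real.norm_eq_abs]
              exact mul_le_mul_of_nonneg_right (hC _) (abs_nonneg t))
            (convex_Icc 0 1) (by simp) τ.2
          simp only [mul_zero, hα0 x hx, sub_zero] at this
          refine this.trans (mul_le_of_le_one_right (by positivity) ?_)
          rw [Real.norm_eq_abs, abs_of_nonneg τ.2.1]
          exact τ.2.2
        calc ‖y τ - p‖ = ‖(x - p) + (y τ - x)‖ := by congr 1; abel
          _ ≤ ‖x - p‖ + ‖y τ - x‖ := norm_add_le _ _
          _ ≤ ‖x - p‖ + C * |t| := by gcongr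
    have hsol : e ((t, x), y) = ((t, x), 0) := by
      rw [he]
      refine Prod.ext rfl ?_
      ext τ
      have h2 : ∫ σ in (0 : ℝ)..τ, t • V (α x (t * σ)) = y τ - x := by
        rw [intervalIntegral.integral_eq_sub_of_hasDerivAt (f := fun σ => α x (t * σ))]
        · simp [hyτ, hα0 x hx]
        · intro σ hσ
          rw [uIcc_of_le τ.2.1] at hσ
          exact hd σ ⟨hσ.1, hσ.2.trans τ.2.2⟩
        · apply ContinuousOn.intervalIntegrable
          intro σ hσ
          rw [uIcc_of_le τ.2.1] at hσ
          exact ((hV.continuous.continuousAt.comp (f := fun τ => α x (t * τ))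
            (hd σ ⟨hσ.1, hσ.2.trans τ.2.2⟩).continuousAt).const_smul t).continuousWithinAt
      have h3 : primitive (postcomp hV.continuous y) τ = ∫ σ in (0 : ℝ)..τ, V (α x (t * σ)) := by
        rw [primitive_apply]
        apply intervalIntegral.integral_congr
        intro σ hσ
        rw [uIcc_of_le τ.2.1] at hσ
        dsimp only
        rw [IccExtend_of_mem _ _ ⟨hσ.1, hσ.2.trans τ.2.2⟩]
        rfl
      rw [intervalIntegral.integral_smul, ← h3] at h2
      simp [flowEquation, h2]
    -- Uniqueness: inside the source of `e` the equation has one solution, so the integral curve `α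
    -- x` found by Picard–Lindelöf agrees with `Φ`.
    have := e.left_inv hsrc
    rw [hsol] at this
    change (e.symm ((t, x), 0)).2 ⟨1, by simp⟩ = _
    rw [this]
    simp [y]
  refine ⟨Φ, hΦ, ?_⟩
  have hev : ∀ᶠ z in 𝓝 ((0 : ℝ), p), z.1 ∈ Ioo (-ε) ε ∧ z.2 ∈ Metric.closedBall p r :=
    (continuous_fst.continuousAt.eventually (Ioo_mem_nhds (neg_lt_zero.2 hε) hε)).and
      (continuous_snd.continuousAt.eventually (Metric.closedBall_mem_nhds p hr))
  have key0 : ∀ᶠ z in 𝓝 ((0 : ℝ), p), Φ (0, z.2) = α z.2 0 := by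
    have hc : Tendsto (fun z : ℝ × E => ((0 : ℝ), z.2)) (𝓝 (0, p)) (𝓝 (0, p)) := by
      have : Continuous (fun z : ℝ × E => ((0 : ℝ), z.2)) := by fun_prop
      exact this.tendsto (0, p)
    exact hc.eventually key
  filter_upwards [hev, key.eventually_nhds, key0] with ⟨t, x⟩ ⟨ht, hx⟩ hk hk0
  dsimp only at ht hx hk0 ⊢
  refine ⟨hk0.trans (hα0 x hx), ?_⟩
  rw [hk.self_of_nhds]
  refine (hα x hx t ht).congr_of_eventuallyEq ?_
  have hc : ContinuousAt (fun s : ℝ => (s, x)) t := by fun_prop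
  exact hc.eventually hk

/-- The local flow of a smooth vector field on a finite-dimensional space is smooth. -/
theorem exists_smooth_flow [FiniteDimensional ℝ E] {V : E → E} {p : E} (hV : SmoothNear V p) :
    ∃ Φ : ℝ × E → E, SmoothNear Φ (0, p) ∧ ∀ᶠ z in 𝓝 ((0 : ℝ), p),
      Φ (0, z.2) = z.2 ∧ HasDerivAt (fun t => Φ (t, z.2)) (V (Φ z)) z.1 := by
  obtain ⟨δ, hδ, hδ'⟩ := Metric.eventually_nhds_iff_ball.1 hV
  -- The cut-off field is bounded and equals `V` near `p`; by continuity `Φ` takes values there for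
  -- parameters near `(0, p)`.
  let χ : ContDiffBump p := ⟨δ / 4, δ / 2, by positivity, by linarith⟩
  let V' : E → E := fun x => χ x • V x
  have hV' : ContDiff ℝ ∞ V' := by
    rw [contDiff_iff_contDiffAt]
    intro x
    by_cases hx : x ∈ Metric.ball p δ
    · exact χ.contDiff.contDiffAt.smul (hδ' x hx)
    · have : V' =ᶠ[𝓝 x] fun _ => 0 := by
        have hx' : x ∈ (tsupport χ)ᶜ := by
          rw [χ.tsupport_eq, mem_compl_iff, Metric.mem_closedBall, not_le]
          rw [Metric.mem_ball, not_lt] at hx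
          change δ / 2 < _
          linarith
        filter_upwards [(isClosed_tsupport χ).isOpen_compl.mem_nhds hx'] with y hy
        simp [V', image_eq_zero_of_notMem_tsupport hy]
      exact contDiffAt_const.congr_of_eventuallyEq this
  obtain ⟨C, hC⟩ : ∃ C, ∀ x, ‖V' x‖ ≤ C := by
    have hcs : HasCompactSupport V' := χ.hasCompactSupport.smul_right
    exact hV'.continuous.bounded_above_of_compact_support hcs
  obtain ⟨Φ, hΦ, h⟩ := exists_smooth_flow_of_bounded hV' hC p
  refine ⟨Φ, hΦ, ?_⟩
  have hΦ0 : Φ (0, p) = p := h.self_of_nhds.1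
  have hVV : ∀ᶠ x in 𝓝 p, V' x = V x := by
    filter_upwards [χ.eventuallyEq_one] with x hx
    simp [V', hx]
  have := hΦ.continuousAt.tendsto
  rw [hΦ0] at this
  filter_upwards [h, this.eventually hVV] with z hz hz'
  rw [← hz']
  exact hz

/-- A nonvanishing smooth vector field is locally constant in suitable coordinates. -/
theorem exists_straightening [FiniteDimensional ℝ E] {V : E → E} {p : E} (hV : SmoothNear V p)
    (h0 : V p ≠ 0) :
    ∃ ψ : OpenPartialHomeomorph E E, p ∈ ψ.source ∧ ψ p = p ∧
      ContDiffOn ℝ ∞ ψ ψ.source ∧ ContDiffOn ℝ ∞ ψ.symm ψ.target ∧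
      HasFDerivAt ψ (ContinuousLinearMap.id ℝ E) p ∧
      ∀ q ∈ ψ.source, fderiv ℝ ψ q (V q) = V p := by
  obtain ⟨Φ, hΦ, h⟩ := exists_smooth_flow hV
  obtain ⟨ℓ, hℓ⟩ : ∃ ℓ : E →L[ℝ] ℝ, ℓ (V p) = 1 := SeparatingDual.exists_eq_one h0
  have hΦ0 : Φ (0, p) = p := h.self_of_nhds.1
  -- Points are written as a time `ℓ (x - p)` and a point of the hyperplane `p + ker ℓ`, transverse
  -- to the field. Flowing from the hyperplane for that time gives `Θ`, which carries the constant
  -- field `V p` to `V`; the straightening is its inverse.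
  let κ : E → ℝ × E := fun x => (ℓ (x - p), x - ℓ (x - p) • V p)
  have hκ : ContDiff ℝ ∞ κ := by fun_prop
  have hκp : κ p = (0, p) := by simp [κ]
  let Θ : E → E := fun x => Φ (κ x)
  have hΘ : SmoothNear Θ p := SmoothNear.comp (f := κ) (hκp ▸ hΦ) (hκ.smoothNear p)
  have hline : ∀ x (r : ℝ), κ (x + r • V p) = ((κ x).1 + r, (κ x).2) := by
    intro x r
    have : ℓ (x + r • V p - p) = ℓ (x - p) + r := by
      rw [add_sub_right_comm, map_add, map_smul, hℓ, smul_eq_mul, mul_one]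
    simp only [κ, this, add_smul]
    congr 1
    abel
  have hκt : Tendsto κ (𝓝 p) (𝓝 (0, p)) := by
    have := hκ.continuous.tendsto p
    rwa [hκp] at this
  have hDV : ∀ᶠ x in 𝓝 p, fderiv ℝ Θ x (V p) = V (Θ x) := by
    filter_upwards [hκt.eventually h, hΘ.eventually] with x hx hx'
    have h1 : HasDerivAt (fun r : ℝ => Θ (x + r • V p)) (fderiv ℝ Θ x (V p)) 0 := by
      have hl : HasDerivAt (fun r : ℝ => x + r • V p) (V p) 0 := by
        simpa using ((hasDerivAt_id (0 : ℝ)).smul_const (V p)).const_add x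
      have hD : HasFDerivAt Θ (fderiv ℝ Θ x) (x + (0 : ℝ) • V p) := by
        simpa using hx'.differentiableAt.hasFDerivAt
      exact hD.comp_hasDerivAt (0 : ℝ) hl
    have h2 : HasDerivAt (fun r : ℝ => Θ (x + r • V p)) (V (Θ x)) 0 := by
      simp only [Θ, hline]
      have hs : HasDerivAt (fun r : ℝ => (κ x).1 + r) 1 0 := (hasDerivAt_id (0 : ℝ)).const_add _
      have ht : HasDerivAt (fun t => Φ (t, (κ x).2)) (V (Φ (κ x))) ((κ x).1 + 0) := by
        simpa using hx.2
      simpa [Function.comp_def] using ht.scomp (0 : ℝ) hs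
    exact h1.unique h2
  -- The derivative fixes `V p` by the flow equation, and fixes `ker ℓ` because the flow at time `0`
  -- is the identity.
  have hD : HasFDerivAt Θ (ContinuousLinearMap.id ℝ E) p := by
    have hΘp : Θ p = p := by simp only [Θ, hκp, hΦ0]
    have h1 : fderiv ℝ Θ p (V p) = V p := by rw [hDV.self_of_nhds, hΘp]
    have h2 : ∀ v, ℓ v = 0 → fderiv ℝ Θ p v = v := by
      intro v hv
      have hl : HasDerivAt (fun r : ℝ => p + r • v) v 0 := by
        simpa using ((hasDerivAt_id (0 : ℝ)).smul_const v).const_add p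
      have hD : HasFDerivAt Θ (fderiv ℝ Θ p) (p + (0 : ℝ) • v) := by
        simpa using hΘ.differentiableAt.hasFDerivAt
      have h3 := hD.comp_hasDerivAt (0 : ℝ) hl
      refine h3.unique (hl.congr_of_eventuallyEq ?_)
      have hc : Tendsto (fun r : ℝ => ((0 : ℝ), p + r • v)) (𝓝 0) (𝓝 (0, p)) := by
        have : Continuous (fun r : ℝ => ((0 : ℝ), p + r • v)) := by fun_prop
        simpa using this.tendsto 0
      filter_upwards [hc.eventually h] with r hr
      simpa [Θ, κ, hv] using hr.1
    have : fderiv ℝ Θ p = ContinuousLinearMap.id ℝ E := by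
      ext v
      have h3 := h2 (v - ℓ v • V p) (by simp [hℓ])
      rw [map_sub, map_smul, h1] at h3
      simpa using h3
    rw [← this]
    exact hΘ.differentiableAt.hasFDerivAt
  have hΘp : Θ p = p := by simp only [Θ, hκp, hΦ0]
  obtain ⟨e, he, hpe, hes, hsm, hsm'⟩ := hΘ.exists_openPartialHomeomorph
    (ContinuousLinearEquiv.refl ℝ E) hD hDV
  have hep : e p = p := by rw [he, hΘp]
  have hfe : (e : E → E) = Θ := funext he
  have hinv : ∀ q ∈ e.source, (fderiv ℝ e.symm (e q)).comp (fderiv ℝ e q) =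
      ContinuousLinearMap.id ℝ E := by
    intro q hq
    have h1 : HasFDerivAt e (fderiv ℝ e q) q :=
      ((hsm.contDiffAt (e.open_source.mem_nhds hq)).differentiableAt (by simp)).hasFDerivAt
    have h2 : HasFDerivAt e.symm (fderiv ℝ e.symm (e q)) (e q) :=
      ((hsm'.contDiffAt (e.open_target.mem_nhds (e.map_source hq))).differentiableAt
        (by simp)).hasFDerivAt
    refine (h2.comp q h1).unique ((hasFDerivAt_id q).congr_of_eventuallyEq ?_)
    filter_upwards [e.open_source.mem_nhds hq] with x hx using e.left_inv hx
  refine ⟨e.symm, by simpa [hep] using e.map_source hpe, ?_, hsm', hsm, ?_, ?_⟩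
  · conv_lhs => rw [← hep, e.left_inv hpe]
  · have h1 := hinv p hpe
    rw [hep, hfe, hD.fderiv] at h1
    rw [← show fderiv ℝ e.symm p = ContinuousLinearMap.id ℝ E from h1]
    have : p ∈ e.target := by simpa [hep] using e.map_source hpe
    exact ((hsm'.contDiffAt (e.open_target.mem_nhds this)).differentiableAt (by simp)).hasFDerivAt
  · intro q hq
    have hq' : e.symm q ∈ e.source := e.map_target hq
    have h1 := congrArg (fun A : E →L[ℝ] E => A (V p)) (hinv _ hq')
    simp only [ContinuousLinearMap.comp_apply, e.right_inv hq] at h1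
    have h2 : fderiv ℝ e (e.symm q) (V p) = V q := by
      rw [hfe, show fderiv ℝ Θ (e.symm q) (V p) = V (Θ (e.symm q)) from hes hq', ← he,
        e.right_inv hq]
    rw [h2] at h1
    exact h1

end Flow

/-! ### Forms defining a distribution, and their pairing with Lie brackets. -/

section Forms

variable {E F : Type*} [NormedAddCommGroup E] [NormedSpace ℝ E] [NormedAddCommGroup F]
  [NormedSpace ℝ F]

/-- A smooth frame of a distribution has, locally, a smooth family of linear maps whose kernels
are the fibers of the distribution. -/
lemma exists_defining_form [FiniteDimensional ℝ E] {k : ℕ} {X : Fin k → E → E} {p : E}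
    (hX : ∀ i, SmoothNear (X i) p) (hli : LinearIndependent ℝ fun i => X i p) :
    ∃ P : E → E →L[ℝ] E, SmoothNear P p ∧
      ∀ᶠ q in 𝓝 p, ∀ v, P q v = 0 ↔ v ∈ Submodule.span ℝ (range fun i => X i q) := by
  let A : E → (Fin k → ℝ) →L[ℝ] E := fun q =>
    ∑ i, (ContinuousLinearMap.proj (R := ℝ) (φ := fun _ : Fin k => ℝ) i).smulRight (X i q)
  have hAapp : ∀ q c, A q c = ∑ i, c i • X i q := fun q c => by simp [A]
  have hA : SmoothNear A p := by
    filter_upwards [eventually_all.2 hX] with q hq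
    exact ContDiffAt.sum fun i _ =>
      (ContinuousLinearMap.smulRightL ℝ (Fin k → ℝ) E
        (ContinuousLinearMap.proj i)).contDiff.contDiffAt.comp q (hq i)
  -- A left inverse of the frame map at `p` is an approximate left inverse nearby: `B ∘ A q` remains
  -- invertible.
  obtain ⟨B, hB⟩ : ∃ B : E →L[ℝ] (Fin k → ℝ), B ∘L A p = ContinuousLinearMap.id ℝ _ := by
    have hinj : LinearMap.ker (A p : (Fin k → ℝ) →ₗ[ℝ] E) = ⊥ := by
      rw [LinearMap.ker_eq_bot']
      intro c hc
      have := Fintype.linearIndependent_iff.1 hli c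
        (by rw [← hAapp]; exact hc)
      exact funext this
    obtain ⟨B, hB⟩ := LinearMap.exists_leftInverse_of_injective _ hinj
    refine ⟨LinearMap.toContinuousLinearMap B, ?_⟩
    ext1 c
    exact congrArg (fun f => f c) hB
  let R : E → (Fin k → ℝ) →L[ℝ] (Fin k → ℝ) := fun q => B ∘L A q
  have hR : SmoothNear R p :=
    ((ContinuousLinearMap.compL ℝ (Fin k → ℝ) E (Fin k → ℝ) B).smoothNear _).comp hA
  have hRp : R p = 1 := hB
  have hunit : ∀ᶠ q in 𝓝 p, IsUnit (R q) := by
    have : {x : (Fin k → ℝ) →L[ℝ] (Fin k → ℝ) | IsUnit x} ∈ 𝓝 (R p) :=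
      Units.isOpen.mem_nhds (by rw [hRp]; exact isUnit_one)
    exact hR.continuousAt.eventually this
  let S : E → (Fin k → ℝ) →L[ℝ] (Fin k → ℝ) := fun q => Ring.inverse (R q)
  have hS : SmoothNear S p := by
    filter_upwards [hR, hunit] with q hq hu
    obtain ⟨u, hu⟩ := hu
    have h1 := contDiffAt_ringInverse (n := ∞) ℝ u
    rw [hu] at h1
    exact h1.comp q hq
  -- `A (B A)⁻¹ B` is the projection onto the range of `A q` along `ker B`, so its complement
  -- vanishes exactly on the span of the frame.
  refine ⟨fun q => ContinuousLinearMap.id ℝ E - (A q) ∘L (S q ∘L B), ?_, ?_⟩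
  · filter_upwards [hA, hS] with q hq hq'
    exact contDiffAt_const.sub (hq.clm_comp (hq'.clm_comp contDiffAt_const))
  · filter_upwards [hunit] with q hu v
    have hrange : ∀ v, v ∈ Submodule.span ℝ (range fun i => X i q) ↔ ∃ c, A q c = v := by
      intro v
      rw [Submodule.mem_span_range_iff_exists_fun]
      simp only [hAapp]
    rw [hrange]
    constructor
    · intro h
      refine ⟨S q (B v), ?_⟩
      simp only [sub_apply, ContinuousLinearMap.comp_apply,
        ContinuousLinearMap.id_apply, sub_eq_zero] at h
      exact h.symm
    · rintro ⟨c, rfl⟩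
      have h1 : S q (B (A q c)) = c := by
        have := congrArg (fun f : (Fin k → ℝ) →L[ℝ] (Fin k → ℝ) => f c)
          (Ring.inverse_mul_cancel _ hu)
        exact this
      simp [h1]

/-- Minus the exterior derivative of a one-form. -/
def pairing (P : E → E →L[ℝ] F) (q : E) : E →L[ℝ] E →L[ℝ] F :=
  (fderiv ℝ P q).flip - fderiv ℝ P q

lemma pairing_apply (P : E → E →L[ℝ] F) (q v w : E) :
    pairing P q v w = fderiv ℝ P q w v - fderiv ℝ P q v w := rfl

@[simp] lemma pairing_self (P : E → E →L[ℝ] F) (q v : E) : pairing P q v v = 0 := by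
  simp [pairing_apply]

lemma pairing_swap (P : E → E →L[ℝ] F) (q v w : E) : pairing P q v w = -pairing P q w v := by
  simp [pairing_apply]

/-- The Lie bracket of two sections of the kernel of a form is tensorial modulo that kernel. -/
lemma apply_lieBracket {P : E → E →L[ℝ] F} {q : E} (hP : DifferentiableAt ℝ P q) {S T : E → E}
    (hS : DifferentiableAt ℝ S q) (hT : DifferentiableAt ℝ T q)
    (hPS : ∀ᶠ x in 𝓝 q, P x (S x) = 0) (hPT : ∀ᶠ x in 𝓝 q, P x (T x) = 0) :
    P q (lieBracket ℝ S T q) = pairing P q (S q) (T q) := by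
  -- Differentiating `P(S) = 0` trades derivatives of the section for derivatives of the form; this
  -- is what makes the bracket tensorial.
  have h : ∀ {S : E → E}, DifferentiableAt ℝ S q → (∀ᶠ x in 𝓝 q, P x (S x) = 0) → ∀ v,
      P q (fderiv ℝ S q v) = -fderiv ℝ P q v (S q) := by
    intro S hS hPS v
    have h1 := (hP.hasFDerivAt.clm_apply hS.hasFDerivAt).unique
      ((hasFDerivAt_const (0 : F) q).congr_of_eventuallyEq hPS)
    have h2 := congrArg (fun A : E →L[ℝ] F => A v) h1
    simp only [add_apply, ContinuousLinearMap.comp_apply,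
      ContinuousLinearMap.flip_apply, zero_apply] at h2
    exact eq_neg_of_add_eq_zero_left h2
  rw [lieBracket, map_sub, h hT hPT, h hS hPS, pairing_apply]
  abel

/-- A one-form near a point at which its kernel has codimension one. -/
lemma exists_scalar_form [FiniteDimensional ℝ E] {k : ℕ} {X : Fin k → E → E} {p : E}
    (hX : ∀ i, SmoothNear (X i) p) (hli : LinearIndependent ℝ fun i => X i p)
    (hk : Module.finrank ℝ E = k + 1) :
    ∃ α : E → E →L[ℝ] ℝ, SmoothNear α p ∧
      ∀ᶠ q in 𝓝 p, ∀ v, α q v = 0 ↔ v ∈ Submodule.span ℝ (range fun i => X i q) := by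
  obtain ⟨P, hP, hker⟩ := exists_defining_form hX hli
  obtain ⟨u, hu⟩ : ∃ u, u ∉ Submodule.span ℝ (range fun i => X i p) := by
    by_contra! h
    have h1 : Submodule.span ℝ (range fun i => X i p) = ⊤ := Submodule.eq_top_iff'.2 h
    have h2 := finrank_span_eq_card hli
    rw [h1, finrank_top, hk, Fintype.card_fin] at h2
    omega
  have hPu : P p u ≠ 0 := fun h => hu ((hker.self_of_nhds u).1 h)
  obtain ⟨ℓ, hℓ⟩ : ∃ ℓ : E →L[ℝ] ℝ, ℓ (P p u) = 1 := SeparatingDual.exists_eq_one hPu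
  have hα : SmoothNear (fun q => ℓ ∘L P q) p :=
    ((ContinuousLinearMap.compL ℝ E E ℝ ℓ).smoothNear _).comp hP
  refine ⟨fun q => ℓ ∘L P q, hα, ?_⟩
  have hne : ∀ᶠ q in 𝓝 p, ℓ (P q u) ≠ 0 := by
    have : SmoothNear (fun q => (ℓ ∘L P q) u) p := hα.clm_apply (smoothNear_const u p)
    exact this.continuousAt.eventually_ne (by simp [hℓ])
  -- linear independence persists nearby
  have hli' : ∀ᶠ q in 𝓝 p, LinearIndependent ℝ fun i => X i q := by
    have hc : ContinuousAt (fun q i => X i q) p :=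
      continuousAt_pi.2 fun i => (hX i).continuousAt
    exact hc.eventually hli.eventually
  filter_upwards [hker, hne, hli'] with q hq hne hli v
  have hle : Submodule.span ℝ (range fun i => X i q) ≤
      LinearMap.ker ((ℓ ∘L P q : E →L[ℝ] ℝ) : E →ₗ[ℝ] ℝ) := by
    intro w hw
    have := (hq w).2 hw
    simp [this]
  have hne' : ((ℓ ∘L P q : E →L[ℝ] ℝ) : E →ₗ[ℝ] ℝ) ≠ 0 := fun h =>
    hne (congrArg (fun f : E →ₗ[ℝ] ℝ => f u) h)
  have hdim := Module.Dual.finrank_ker_add_one_of_ne_zero hne'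
  -- The kernel of a nonzero functional has dimension `k`, as does the span it contains.
  have heq := Submodule.eq_of_le_of_finrank_eq hle (by
    rw [finrank_span_eq_card hli, Fintype.card_fin]
    omega)
  rw [heq]
  rfl

end Forms

/-! ### First integrals, and the Engel normal form for an adapted frame. -/

/-- A function which is invariant under a constant vector field is, locally, unchanged by
translations along it. -/
lemma eventually_eq_of_fderiv_eq_zero {E : Type*} [NormedAddCommGroup E] [NormedSpace ℝ E]
    {f : E → ℝ} {p v : E} (hf : SmoothNear f p) (h : ∀ᶠ q in 𝓝 p, fderiv ℝ f q v = 0) :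
    ∃ δ > 0, ∀ q ∈ Metric.ball p δ, ∀ r : ℝ, q + r • v ∈ Metric.ball p δ → f (q + r • v) = f q := by
  obtain ⟨δ, hδ, hb⟩ := Metric.eventually_nhds_iff_ball.1 (hf.and h)
  refine ⟨δ, hδ, fun q hq r hr => ?_⟩
  have hseg : ∀ s ∈ Icc (0 : ℝ) 1, q + (s * r) • v ∈ Metric.ball p δ := by
    intro s hs
    have := (convex_ball p δ) hq hr (sub_nonneg.2 hs.2) hs.1 (by ring)
    convert this using 1
    module
  have hd : ∀ s ∈ Icc (0 : ℝ) 1,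
      HasDerivWithinAt (fun s : ℝ => f (q + (s * r) • v)) 0 (Icc 0 1) s := by
    intro s hs
    have h1 : HasDerivAt (fun s : ℝ => q + (s * r) • v) (r • v) s := by
      simpa using (((hasDerivAt_id s).mul_const r).smul_const v).const_add q
    have h2 := ((hb _ (hseg s hs)).1.differentiableAt (by simp)).hasFDerivAt.comp_hasDerivAt s h1
    rw [map_smul, (hb _ (hseg s hs)).2, smul_zero] at h2
    exact h2.hasDerivWithinAt
  have := Convex.norm_image_sub_le_of_norm_hasDerivWithin_le (C := 0) hd (by simp)
    (convex_Icc (0 : ℝ) 1) (x := 0) (y := 1) (by simp) (by simp)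
  simpa [sub_eq_zero] using this

/-- A first integral of the planar direction field `∂_b - h ∂_a`, depending on a parameter, and
normalized at the given point. -/
lemma exists_first_integral {h : ℝ × ℝ × ℝ → ℝ} {r₀ : ℝ × ℝ × ℝ} (hh : SmoothNear h r₀)
    (h0 : h r₀ = 0) :
    ∃ y : ℝ × ℝ × ℝ → ℝ, SmoothNear y r₀ ∧
      (∀ᶠ r in 𝓝 r₀, fderiv ℝ y r (0, 1, 0) = h r * fderiv ℝ y r (1, 0, 0)) ∧
      fderiv ℝ y r₀ (1, 0, 0) = 1 := by
  -- `F` is `∂_b - h ∂_a`, equal to `∂_b` at `r₀`. Straightening sends it to the constant field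
  -- `∂_b`, so the first component of the straightening map is a first integral; the normalization
  -- holds since the derivative at `r₀` is the identity.
  let F : ℝ × ℝ × ℝ → ℝ × ℝ × ℝ := fun r => (-h r, 1, 0)
  have hF : SmoothNear F r₀ := by
    filter_upwards [hh] with r hr
    exact hr.neg.prodMk contDiffAt_const
  have hF0 : F r₀ = (0, 1, 0) := by simp [F, h0]
  obtain ⟨ψ, hp, -, hs, -, hD, hψ⟩ := exists_straightening hF (by simp [hF0])
  have hy : ∀ r ∈ ψ.source, ∀ v, fderiv ℝ (fun r => (ψ r).1) r v = (fderiv ℝ ψ r v).1 := by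
    intro r hr v
    have h1 := ((hs.contDiffAt (ψ.open_source.mem_nhds hr)).differentiableAt (by simp)).hasFDerivAt
    rw [h1.fst.fderiv]
    rfl
  refine ⟨fun r => (ψ r).1, ?_, ?_, ?_⟩
  · filter_upwards [hs.smoothNear ψ.open_source hp] with r hr using hr.fst
  · filter_upwards [ψ.open_source.mem_nhds hp] with r hr
    have h1 := congrArg Prod.fst (hψ r hr)
    have h2 : F r = (0, 1, 0) + (-h r) • ((1, 0, 0) : ℝ × ℝ × ℝ) := by simp [F]
    rw [h2, map_add, map_smul, hF0] at h1
    rw [hy r hr, hy r hr]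
    simp only [Prod.fst_add, Prod.smul_fst, smul_eq_mul] at h1
    linarith
  · rw [hy r₀ hp, hD.fderiv]
    rfl

/-- `fderiv` of a function along a Lie bracket, for smooth data. -/
lemma SmoothNear.fderiv_lieBracket {E : Type*} [NormedAddCommGroup E] [NormedSpace ℝ E]
    {f : E → ℝ} {q : E} (hf : SmoothNear f q) {V W : E → E} (hV : SmoothNear V q)
    (hW : SmoothNear W q) :
    _root_.fderiv ℝ f q (VectorField.lieBracket ℝ V W q) =
      _root_.fderiv ℝ (fun x => _root_.fderiv ℝ f x (W x)) q (V q) -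
        _root_.fderiv ℝ (fun x => _root_.fderiv ℝ f x (V x)) q (W q) :=
  fderiv_apply_lieBracket hf.at_self (by simpa using ENat.LEInfty.out) hW.differentiableAt
    hV.differentiableAt

lemma fderiv_mul_apply {E : Type*} [NormedAddCommGroup E] [NormedSpace ℝ E] {f g : E → ℝ} {q : E}
    (hf : DifferentiableAt ℝ f q) (hg : DifferentiableAt ℝ g q) (v : E) :
    fderiv ℝ (fun x => f x * g x) q v = f q * fderiv ℝ g q v + g q * fderiv ℝ f q v := by
  rw [fderiv_fun_mul hf hg]
  simp

/-- Engel data near a point of a vector space. -/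
structure EngelFrame {E : Type} [NormedAddCommGroup E] [NormedSpace ℝ E]
    (X Y : E → E) (α : E → E →L[ℝ] ℝ) (p : E) : Prop where
  smooth_X : SmoothNear X p
  smooth_Y : SmoothNear Y p
  smooth_form : SmoothNear α p
  linearIndependent : LinearIndependent ℝ ![X p, Y p, lieBracket ℝ X Y p]
  ker_form : ∀ᶠ q in 𝓝 p, ∀ v, α q v = 0 ↔
    v ∈ Submodule.span ℝ {X q, Y q, lieBracket ℝ X Y q}
  characteristic : ∀ᶠ q in 𝓝 p, α q (lieBracket ℝ Y (lieBracket ℝ X Y) q) = 0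
  transverse : α p (lieBracket ℝ X (lieBracket ℝ X Y) p) ≠ 0

section

variable {E : Type} [NormedAddCommGroup E] [NormedSpace ℝ E] {X Y : E → E} {α : E → E →L[ℝ] ℝ}
  {p : E}

lemma EngelFrame.eventually_form_eq_zero (h : EngelFrame X Y α p) :
    ∀ᶠ q in 𝓝 p, α q (X q) = 0 ∧ α q (Y q) = 0 ∧ α q (lieBracket ℝ X Y q) = 0 := by
  filter_upwards [h.ker_form] with q hq
  exact ⟨(hq _).2 (Submodule.subset_span (by simp)), (hq _).2 (Submodule.subset_span (by simp)),
    (hq _).2 (Submodule.subset_span (by simp))⟩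

/-- Applying `α` to a relation isolates the coefficient of `[X, [X, Y]]`, the only one of the four
vectors outside `ker α`. `Y` comes last because the first three dual coordinates will parametrize
the quotient by its flow. -/
lemma EngelFrame.linearIndependent_four (h : EngelFrame X Y α p) :
    LinearIndependent ℝ ![lieBracket ℝ X (lieBracket ℝ X Y) p, lieBracket ℝ X Y p, X p, Y p] := by
  rw [Fintype.linearIndependent_iff]
  intro g hg
  simp only [Fin.sum_univ_four, Matrix.cons_val] at hg
  obtain ⟨hX, hY, hZ⟩ := h.eventually_form_eq_zero.self_of_nhds
  have h0 : g 0 = 0 := by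
    have h1 := congrArg (α p) hg
    simp only [map_add, map_smul, hX, hY, hZ, map_zero, smul_eq_mul, mul_zero, add_zero] at h1
    exact (mul_eq_zero.1 h1).resolve_right h.transverse
  have h1 := Fintype.linearIndependent_iff.1 h.linearIndependent ![g 2, g 3, g 1] (by
    simp only [Fin.sum_univ_three, Matrix.cons_val]
    rw [h0, zero_smul, zero_add] at hg
    rw [← hg]
    abel)
  intro i
  fin_cases i
  · exact h0
  · exact h1 2
  · exact h1 0
  · exact h1 1

lemma exists_dual_basis {n : ℕ} (hdim : Module.finrank ℝ E = n) {v : Fin n → E}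
    (hv : LinearIndependent ℝ v) [FiniteDimensional ℝ E] :
    ∃ ℓ : Fin n → E →L[ℝ] ℝ, (∀ i j, ℓ i (v j) = if j = i then 1 else 0) ∧
      ∀ w, w = ∑ i, ℓ i w • v i := by
  let bs := basisOfLinearIndependentOfCardEqFinrank' v hv (by simp [hdim])
  have hbs : ∀ i, bs i = v i := fun i => by simp [bs]
  refine ⟨fun i => LinearMap.toContinuousLinearMap (bs.coord i), fun i j => ?_, fun w => ?_⟩
  · rw [← hbs]
    simp [Finsupp.single_apply]
  · conv_lhs => rw [← bs.sum_repr w]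
    simp [hbs]

/-- Functions `x`, `y`, `z`, constant along `Y`, such that `α` is proportional to `dy - z dx`. -/
lemma EngelFrame.exists_contact_coordinates (h : EngelFrame X Y α p)
    (hdim : Module.finrank ℝ E = 4) :
    ∃ x y z : E → ℝ, SmoothNear x p ∧ SmoothNear y p ∧ SmoothNear z p ∧
      (∀ᶠ q in 𝓝 p, fderiv ℝ x q (Y q) = 0 ∧ fderiv ℝ y q (Y q) = 0 ∧ fderiv ℝ z q (Y q) = 0) ∧
      (∀ᶠ q in 𝓝 p, ∀ v, α q v = 0 ↔ fderiv ℝ y q v = z q * fderiv ℝ x q v) ∧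
      fderiv ℝ x p (X p) ≠ 0 := by
  have : FiniteDimensional ℝ E := FiniteDimensional.of_finrank_pos (by omega)
  have : CompleteSpace E := FiniteDimensional.complete ℝ E
  have hli := h.linearIndependent_four
  have hform := h.eventually_form_eq_zero
  have hchar := h.characteristic
  have htrans := h.transverse
  have sX := h.smooth_X
  have sY := h.smooth_Y
  have sZ : SmoothNear (lieBracket ℝ X Y) p := sX.lieBracket sY
  have sα := h.smooth_form
  have hbr : ∀ q, lieBracket ℝ Y X q = -lieBracket ℝ X Y q := fun q => lieBracket_swap
  generalize lieBracket ℝ X Y = Z at *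
  set U : E := lieBracket ℝ X Z p with hU
  have hY0 : Y p ≠ 0 := hli.ne_zero 3
  obtain ⟨ℓ, hℓ, hsum⟩ := exists_dual_basis hdim hli
  simp only [Fin.sum_univ_four, Matrix.cons_val] at hsum
  have hℓU : ∀ i, ℓ i U = if 0 = i then 1 else 0 := fun i => hℓ i 0
  have hℓZ : ∀ i, ℓ i (Z p) = if 1 = i then 1 else 0 := fun i => hℓ i 1
  have hℓX : ∀ i, ℓ i (X p) = if 2 = i then 1 else 0 := fun i => hℓ i 2
  have hℓY : ∀ i, ℓ i (Y p) = if 3 = i then 1 else 0 := fun i => hℓ i 3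
  clear hℓ
  -- straighten `Y`
  obtain ⟨ψ, hpψ, hψp, hψs, hψs', hψD, hψY⟩ := exists_straightening sY hY0
  have hψY' : ∀ᶠ q in 𝓝 p, fderiv ℝ ψ q (Y q) = Y p := by
    filter_upwards [ψ.open_source.mem_nhds hpψ] with q hq using hψY q hq
  have sψ : SmoothNear ψ p := hψs.smoothNear ψ.open_source hpψ
  have hpt : p ∈ ψ.target := by
    have := ψ.map_source hpψ
    rwa [hψp] at this
  have sχ : SmoothNear ψ.symm p := hψs'.smoothNear ψ.open_target hpt
  have hχp : ψ.symm p = p := by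
    have := ψ.left_inv hpψ
    rwa [hψp] at this
  have hχψ : ∀ᶠ q in 𝓝 p, (fderiv ℝ ψ.symm (ψ q)).comp (fderiv ℝ ψ q) =
      ContinuousLinearMap.id ℝ E := by
    filter_upwards [ψ.open_source.mem_nhds hpψ] with q hq
    have h1 : HasFDerivAt ψ (fderiv ℝ ψ q) q :=
      ((hψs.contDiffAt (ψ.open_source.mem_nhds hq)).differentiableAt (by simp)).hasFDerivAt
    have h2 : HasFDerivAt ψ.symm (fderiv ℝ ψ.symm (ψ q)) (ψ q) :=
      ((hψs'.contDiffAt (ψ.open_target.mem_nhds (ψ.map_source hq))).differentiableAt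
        (by simp)).hasFDerivAt
    refine (h2.comp q h1).unique ((hasFDerivAt_id q).congr_of_eventuallyEq ?_)
    filter_upwards [ψ.open_source.mem_nhds hq] with x hx using ψ.left_inv hx
  -- the coordinate functions and their differentials
  let u : Fin 4 → E → ℝ := fun i q => ℓ i (ψ q)
  have su : ∀ i, SmoothNear (u i) p := fun i => ((ℓ i).smoothNear _).comp sψ
  have du : ∀ᶠ q in 𝓝 p, ∀ i v, fderiv ℝ (u i) q v = ℓ i (fderiv ℝ ψ q v) := by
    filter_upwards [sψ.eventually] with q hq i v
    have := (ℓ i).hasFDerivAt.comp q hq.differentiableAt.hasFDerivAt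
    rw [show u i = ℓ i ∘ ψ from rfl, this.fderiv]
    rfl
  have duY : ∀ᶠ q in 𝓝 p, ∀ i, fderiv ℝ (u i) q (Y q) = ℓ i (Y p) := by
    filter_upwards [du, hψY'] with q hq hq' i
    rw [hq, hq']
  have dup : ∀ i v, fderiv ℝ (u i) p v = ℓ i v := by
    intro i v
    rw [du.self_of_nhds, hψD.fderiv]
    rfl
  -- components of `α`
  let comp : E → E → ℝ := fun w q => α q (fderiv ℝ ψ.symm (ψ q) w)
  have scomp : ∀ w, SmoothNear (comp w) p := by
    intro w
    have h1 : SmoothNear (fun q => fderiv ℝ ψ.symm (ψ q)) p :=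
      SmoothNear.comp (g := fderiv ℝ ψ.symm) (f := ψ) (by rw [hψp]; exact sχ.fderiv) sψ
    exact sα.clm_apply (h1.clm_apply (smoothNear_const w p))
  have hcompp : ∀ w, comp w p = α p w := by
    intro w
    have := hχψ.self_of_nhds
    rw [hψD.fderiv, ContinuousLinearMap.comp_id] at this
    simp [comp, this]
  -- There is no `d(u 3)` term: in the straightened coordinates the corresponding direction is `Y`,
  -- which `α` kills.
  have hαdec : ∀ᶠ q in 𝓝 p, ∀ v, α q v = comp U q * fderiv ℝ (u 0) q v +
      comp (Z p) q * fderiv ℝ (u 1) q v + comp (X p) q * fderiv ℝ (u 2) q v := by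
    filter_upwards [hχψ, du, hform, hψY'] with q hq hdu hf hYq v
    have hv : v = fderiv ℝ ψ.symm (ψ q) (fderiv ℝ ψ q v) :=
      (congrArg (fun A : E →L[ℝ] E => A v) hq).symm
    have hYv : fderiv ℝ ψ.symm (ψ q) (Y p) = Y q := by
      have := congrArg (fun A : E →L[ℝ] E => A (Y q)) hq
      simpa [hYq] using this
    conv_lhs => rw [hv, hsum (fderiv ℝ ψ q v)]
    simp only [map_add, map_smul, hYv, hf.2.1, hdu, smul_eq_mul, comp]
    ring
  let b : E → ℝ := fun q => comp (Z p) q / comp U q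
  let c : E → ℝ := fun q => comp (X p) q / comp U q
  have hU0 : comp U p ≠ 0 := by rw [hcompp]; exact htrans
  have sb : SmoothNear b p := (scomp _).div (scomp _) hU0
  have sc : SmoothNear c p := (scomp _).div (scomp _) hU0
  have hα1 : ∀ᶠ q in 𝓝 p, ∀ v, α q v = 0 ↔
      fderiv ℝ (u 0) q v + b q * fderiv ℝ (u 1) q v + c q * fderiv ℝ (u 2) q v = 0 := by
    filter_upwards [hαdec, (scomp U).continuousAt.eventually_ne hU0] with q hq hne v
    rw [hq]
    have : comp U q * fderiv ℝ (u 0) q v + comp (Z p) q * fderiv ℝ (u 1) q v +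
        comp (X p) q * fderiv ℝ (u 2) q v = comp U q * (fderiv ℝ (u 0) q v +
          b q * fderiv ℝ (u 1) q v + c q * fderiv ℝ (u 2) q v) := by
      simp only [b, c]
      field_simp
    rw [this, mul_eq_zero, or_iff_right hne]
  -- `b` and `c` are constant along `Y`
  have hYbc : ∀ S : E → E, SmoothNear S p → (∀ᶠ q in 𝓝 p, α q (S q) = 0) →
      (∀ᶠ q in 𝓝 p, α q (lieBracket ℝ Y S q) = 0) → ∀ᶠ q in 𝓝 p,
      fderiv ℝ b q (Y q) * fderiv ℝ (u 1) q (S q) +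
        fderiv ℝ c q (Y q) * fderiv ℝ (u 2) q (S q) = 0 := by
    intro S sS hS hYS
    have hS' : ∀ᶠ q in 𝓝 p, fderiv ℝ (u 0) q (S q) + b q * fderiv ℝ (u 1) q (S q) +
        c q * fderiv ℝ (u 2) q (S q) = 0 := by
      filter_upwards [hα1, hS] with q hq hq' using (hq _).1 hq'
    filter_upwards [hα1, hYS, hS'.eventually_nhds, duY.eventually_nhds, sS.eventually,
      sY.eventually, sb.eventually, sc.eventually, eventually_all.2 fun i => (su i).eventually]
      with q hq hYSq hSq hYq sSq sYq sbq scq suq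
    have hbrak : ∀ i, fderiv ℝ (u i) q (lieBracket ℝ Y S q) =
        fderiv ℝ (fun x => fderiv ℝ (u i) x (S x)) q (Y q) := by
      intro i
      rw [(suq i).fderiv_lieBracket sYq sSq]
      have h1 : (fun x => fderiv ℝ (u i) x (Y x)) =ᶠ[𝓝 q] fun _ => ℓ i (Y p) := by
        filter_upwards [hYq] with x hx using hx i
      rw [h1.fderiv_eq]
      simp
    have h1 := (hq _).1 hYSq
    simp only [hbrak] at h1
    have sd : ∀ i, DifferentiableAt ℝ (fun x => fderiv ℝ (u i) x (S x)) q := fun i =>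
      ((suq i).fderiv.clm_apply sSq).differentiableAt
    have h2 := ((((sd 0).hasFDerivAt.add (sbq.differentiableAt.hasFDerivAt.mul
      (sd 1).hasFDerivAt)).add (scq.differentiableAt.hasFDerivAt.mul (sd 2).hasFDerivAt)).unique
        ((hasFDerivAt_const (0 : ℝ) q).congr_of_eventuallyEq hSq))
    have h3 := congrArg (fun A : E →L[ℝ] ℝ => A (Y q)) h2
    simp only [add_apply, smul_apply, smul_eq_mul, zero_apply] at h3
    linear_combination h3 - h1
  -- Taking `S = Z` and `S = X` in `hYbc` gives a homogeneous linear system for `(Y b, Y c)`, whose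
  -- determinant is `1` at `p`.
  have hYb : ∀ᶠ q in 𝓝 p, fderiv ℝ b q (Y q) = 0 ∧ fderiv ℝ c q (Y q) = 0 := by
    have h1 := hYbc Z sZ (hform.mono fun q hq => hq.2.2) hchar
    have h2 := hYbc X sX (hform.mono fun q hq => hq.1) (hform.mono fun q hq => by
      rw [hbr, map_neg, hq.2.2, neg_zero])
    have sdet : SmoothNear (fun q => fderiv ℝ (u 1) q (Z q) * fderiv ℝ (u 2) q (X q) -
        fderiv ℝ (u 2) q (Z q) * fderiv ℝ (u 1) q (X q)) p :=
      (((su 1).fderiv.clm_apply sZ).mul ((su 2).fderiv.clm_apply sX)).sub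
        (((su 2).fderiv.clm_apply sZ).mul ((su 1).fderiv.clm_apply sX))
    have hdet := sdet.continuousAt.eventually_ne (y := 0) (by simp [dup, hℓZ, hℓX])
    filter_upwards [h1, h2, hdet] with q e1 e2 hne
    constructor
    · refine (mul_eq_zero.1 ?_).resolve_left hne
      linear_combination fderiv ℝ (u 2) q (X q) * e1 - fderiv ℝ (u 2) q (Z q) * e2
    · refine (mul_eq_zero.1 ?_).resolve_left hne
      linear_combination fderiv ℝ (u 1) q (Z q) * e2 - fderiv ℝ (u 1) q (X q) * e1
  -- hence they are functions of the three first coordinates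
  let ρ : E → ℝ × ℝ × ℝ := fun q => (u 0 q, u 1 q, u 2 q)
  have sρ : SmoothNear ρ p := (su 0).prodMk ((su 1).prodMk (su 2))
  let σ : ℝ × ℝ × ℝ → E := fun r => r.1 • U + r.2.1 • Z p + r.2.2 • X p + ℓ 3 p • Y p
  have cσ : ContDiff ℝ ∞ σ := by fun_prop
  have hσψ : ∀ q, ψ q = σ (ρ q) + (ℓ 3 (ψ q) - ℓ 3 p) • Y p := by
    intro q
    conv_lhs => rw [hsum (ψ q)]
    simp only [σ, ρ, u]
    module
  have hσp : σ (ρ p) = p := by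
    have := hσψ p
    rw [hψp, sub_self, zero_smul, add_zero] at this
    exact this.symm
  have sχσ : SmoothNear (fun r => ψ.symm (σ r)) (ρ p) :=
    SmoothNear.comp (g := ψ.symm) (f := σ) (by rw [hσp]; exact sχ) (cσ.smoothNear _)
  -- In the straightened coordinates `f` is constant in the direction `Y p`, so it may be evaluated
  -- on the slice `σ` where the fourth coordinate is frozen at its value at `p`.
  have hfactor : ∀ f : E → ℝ, SmoothNear f p → (∀ᶠ q in 𝓝 p, fderiv ℝ f q (Y q) = 0) →
      ∀ᶠ q in 𝓝 p, f q = f (ψ.symm (σ (ρ q))) := by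
    intro f sf hf
    have sβ : SmoothNear (fun ξ => f (ψ.symm ξ)) p :=
      SmoothNear.comp (g := f) (f := ψ.symm) (by rw [hχp]; exact sf) sχ
    have hχt : Tendsto ψ.symm (𝓝 p) (𝓝 p) := by
      have := sχ.continuousAt.tendsto
      rwa [hχp] at this
    have hβ : ∀ᶠ ξ in 𝓝 p, fderiv ℝ (fun ξ => f (ψ.symm ξ)) ξ (Y p) = 0 := by
      filter_upwards [hχt.eventually hχψ, hχt.eventually hf, hχt.eventually hψY',
        hχt.eventually sf.eventually, sχ.eventually, ψ.open_target.mem_nhds hpt]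
        with ξ h1 h2 h3 h4 h5 h6
      have h7 := h4.differentiableAt.hasFDerivAt.comp ξ h5.differentiableAt.hasFDerivAt
      rw [show (fun ξ => f (ψ.symm ξ)) = f ∘ ψ.symm from rfl, h7.fderiv]
      have h8 := congrArg (fun A : E →L[ℝ] E => A (Y (ψ.symm ξ))) h1
      simp only [ContinuousLinearMap.comp_apply, h3, ψ.right_inv h6] at h8
      rw [ContinuousLinearMap.comp_apply, h8]
      exact h2
    obtain ⟨δ, hδ, hball⟩ := eventually_eq_of_fderiv_eq_zero sβ hβ
    have t1 : ∀ᶠ q in 𝓝 p, ψ q ∈ Metric.ball p δ := by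
      have := sψ.continuousAt.tendsto
      rw [hψp] at this
      exact this.eventually (Metric.ball_mem_nhds p hδ)
    have t2 : ∀ᶠ q in 𝓝 p, σ (ρ q) ∈ Metric.ball p δ := by
      have := (cσ.continuous.continuousAt.comp sρ.continuousAt).tendsto
      simp only [Function.comp_apply, hσp] at this
      exact this.eventually (Metric.ball_mem_nhds p hδ)
    filter_upwards [t1, t2, ψ.open_source.mem_nhds hpψ] with q h1 h2 h3
    have := hball _ h2 (ℓ 3 (ψ q) - ℓ 3 p) (by rw [← hσψ]; exact h1)
    rw [← hσψ] at this
    simpa [ψ.left_inv h3] using this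
  have hfb := hfactor b sb (hYb.mono fun q hq => hq.1)
  have hfc := hfactor c sc (hYb.mono fun q hq => hq.2)
  have shb : SmoothNear (fun r => b (ψ.symm (σ r))) (ρ p) :=
    SmoothNear.comp (g := b) (f := fun r => ψ.symm (σ r)) (by rw [hσp, hχp]; exact sb) sχσ
  have shc : SmoothNear (fun r => c (ψ.symm (σ r))) (ρ p) :=
    SmoothNear.comp (g := c) (f := fun r => ψ.symm (σ r)) (by rw [hσp, hχp]; exact sc) sχσ
  -- `α` kills `Z` at `p`; this supplies the normalization that the first integral requires.
  have hb0 : b (ψ.symm (σ (ρ p))) = 0 := by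
    rw [hσp, hχp]
    simp [b, hcompp, hform.self_of_nhds.2.2]
  obtain ⟨y, sy, hyb, hya⟩ := exists_first_integral shb hb0
  -- Write `y₀, y₁, y₂` for the partial derivatives of `y`. As `y₁ = b y₀`, one has `dy = y₀ (du₀ +
  -- b du₁ + c du₂) + (y₂ - c y₀) du₂`; with `x = u₂` this forces `z = y₂ - c y₀`.
  let z : ℝ × ℝ × ℝ → ℝ := fun r =>
    fderiv ℝ y r (0, 0, 1) - fderiv ℝ y r (1, 0, 0) * c (ψ.symm (σ r))
  have sya : SmoothNear (fun r => fderiv ℝ y r (1, 0, 0)) (ρ p) :=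
    sy.fderiv.clm_apply (smoothNear_const _ _)
  have sz : SmoothNear z (ρ p) :=
    (sy.fderiv.clm_apply (smoothNear_const _ _)).sub (sya.mul shc)
  have hdρ : ∀ f : ℝ × ℝ × ℝ → ℝ, SmoothNear f (ρ p) → ∀ᶠ q in 𝓝 p, ∀ v,
      fderiv ℝ (fun q => f (ρ q)) q v =
        fderiv ℝ f (ρ q) (fderiv ℝ (u 0) q v, fderiv ℝ (u 1) q v, fderiv ℝ (u 2) q v) := by
    intro f sf
    filter_upwards [sρ.continuousAt.eventually sf.eventually,
      eventually_all.2 fun i => (su i).eventually] with q hq huq v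
    have h1 : HasFDerivAt ρ ((fderiv ℝ (u 0) q).prod ((fderiv ℝ (u 1) q).prod
        (fderiv ℝ (u 2) q))) q :=
      (huq 0).differentiableAt.hasFDerivAt.prodMk
        ((huq 1).differentiableAt.hasFDerivAt.prodMk (huq 2).differentiableAt.hasFDerivAt)
    have h2 := hq.differentiableAt.hasFDerivAt.comp q h1
    rw [show (fun q => f (ρ q)) = f ∘ ρ from rfl, h2.fderiv]
    rfl
  have hdY : ∀ f : ℝ × ℝ × ℝ → ℝ, SmoothNear f (ρ p) → ∀ᶠ q in 𝓝 p,
      fderiv ℝ (fun q => f (ρ q)) q (Y q) = 0 := by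
    intro f sf
    filter_upwards [hdρ f sf, duY] with q hq hq'
    rw [hq, hq', hq', hq', hℓY, hℓY, hℓY]
    exact map_zero (fderiv ℝ f (ρ q))
  refine ⟨u 2, fun q => y (ρ q), fun q => z (ρ q), su 2, sy.comp sρ, sz.comp sρ, ?_, ?_, ?_⟩
  · filter_upwards [duY, hdY y sy, hdY z sz] with q h1 h2 h3
    exact ⟨by rw [h1]; simp [hℓY], h2, h3⟩
  · have hne : ∀ᶠ q in 𝓝 p, fderiv ℝ y (ρ q) (1, 0, 0) ≠ 0 :=
      sρ.continuousAt.eventually (sya.continuousAt.eventually_ne (by rw [hya]; exact one_ne_zero))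
    filter_upwards [hα1, hdρ y sy, hne, sρ.continuousAt.eventually hyb, hfb, hfc]
      with q hq hdy hne hyb hfb hfc v
    rw [hq, hdy]
    have hdec : ((fderiv ℝ (u 0) q v, fderiv ℝ (u 1) q v, fderiv ℝ (u 2) q v) : ℝ × ℝ × ℝ) =
        fderiv ℝ (u 0) q v • (1, 0, 0) + fderiv ℝ (u 1) q v • (0, 1, 0) +
          fderiv ℝ (u 2) q v • (0, 0, 1) := by simp
    rw [hdec, map_add, map_add, map_smul, map_smul, map_smul, hyb, ← hfb]
    simp only [z, ← hfc, smul_eq_mul]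
    constructor
    · intro h
      linear_combination fderiv ℝ y (ρ q) (1, 0, 0) * h
    · intro h
      refine (mul_eq_zero.1 ?_).resolve_left hne
      linear_combination h
  · rw [dup]
    simp [hℓX]

/-- Engel coordinates: a chart `(x, y, z, w)` in which the Engel structure is
`dy - z dx = dz - w dx = 0`. -/
theorem EngelFrame.exists_engel_coordinates {X Y : E4 → E4} {α : E4 → E4 →L[ℝ] ℝ} {p : E4}
    (h : EngelFrame X Y α p) {s : Set E4} (hs : s ∈ 𝓝 p) :
    ∃ e : OpenPartialHomeomorph E4 E4, p ∈ e.source ∧ e.source ⊆ s ∧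
      ContDiffOn ℝ ∞ e e.source ∧ ContDiffOn ℝ ∞ e.symm e.target ∧
      ∀ q ∈ e.source, ∀ v : E4,
        (α q v = 0 ↔ fderiv ℝ e q v 1 = e q 2 * fderiv ℝ e q v 0) ∧
        (v ∈ Submodule.span ℝ {X q, Y q} ↔ fderiv ℝ e q v 1 = e q 2 * fderiv ℝ e q v 0 ∧
          fderiv ℝ e q v 2 = e q 3 * fderiv ℝ e q v 0) ∧
        (v ∈ Submodule.span ℝ {Y q} ↔ fderiv ℝ e q v 0 = 0 ∧ fderiv ℝ e q v 1 = 0 ∧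
          fderiv ℝ e q v 2 = 0) := by
  obtain ⟨x, y, z, sx, sy, sz, hY, hα, hxX⟩ := h.exists_contact_coordinates (by simp [E4])
  have hform := h.eventually_form_eq_zero
  have hker := h.ker_form
  have htrans := h.transverse
  have sX := h.smooth_X
  have sY := h.smooth_Y
  have sZ : SmoothNear (lieBracket ℝ X Y) p := sX.lieBracket sY
  obtain ⟨Z, hZ⟩ : ∃ Z, Z = lieBracket ℝ X Y := ⟨_, rfl⟩
  simp only [← hZ] at hform hker htrans sZ
  -- derivatives along brackets
  have hdZ : ∀ f : E4 → ℝ, SmoothNear f p → (∀ᶠ q in 𝓝 p, fderiv ℝ f q (Y q) = 0) →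
      ∀ᶠ q in 𝓝 p, fderiv ℝ f q (Z q) = -fderiv ℝ (fun q => fderiv ℝ f q (X q)) q (Y q) := by
    intro f sf hf
    filter_upwards [sf.eventually, sX.eventually, sY.eventually, hf.eventually_nhds]
      with q h1 h2 h3 h4
    rw [hZ, h1.fderiv_lieBracket h2 h3]
    have : (fun x => fderiv ℝ f x (Y x)) =ᶠ[𝓝 q] fun _ => 0 := h4
    rw [this.fderiv_eq]
    simp
  have hxZ := hdZ x sx (hY.mono fun q hq => hq.1)
  have hzZ := hdZ z sz (hY.mono fun q hq => hq.2.2)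
  have sxX : SmoothNear (fun q => fderiv ℝ x q (X q)) p := sx.fderiv.clm_apply sX
  have szX : SmoothNear (fun q => fderiv ℝ z q (X q)) p := sz.fderiv.clm_apply sX
  have hxX' := sxX.continuousAt.eventually_ne hxX
  -- Since `x` and `z` are constant along `Y`, the relation `dz = w dx` holds on all of `span {X,
  -- Y}` as soon as it holds on `X`.
  let w : E4 → ℝ := fun q => fderiv ℝ z q (X q) / fderiv ℝ x q (X q)
  have sw : SmoothNear w p := szX.div sxX hxX
  have hwX : ∀ᶠ q in 𝓝 p, fderiv ℝ z q (X q) = w q * fderiv ℝ x q (X q) := by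
    filter_upwards [hxX'] with q hq
    simp only [w]
    field_simp
  -- This quantity has two uses: when it is nonzero, `dz = w dx` cuts out `span {X, Y}` inside `ker
  -- α`, and `w` has nonzero derivative along `Y`.
  have hZw : ∀ᶠ q in 𝓝 p, fderiv ℝ z q (Z q) - w q * fderiv ℝ x q (Z q) =
      -(fderiv ℝ w q (Y q) * fderiv ℝ x q (X q)) := by
    filter_upwards [hxZ, hzZ, hwX.eventually_nhds, sw.eventually, sxX.eventually]
      with q h1 h2 h3 h4 h5
    have h6 : (fun q => fderiv ℝ z q (X q)) =ᶠ[𝓝 q] fun q => w q * fderiv ℝ x q (X q) := h3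
    rw [h1, h2, h6.fderiv_eq, fderiv_mul_apply h4.differentiableAt h5.differentiableAt]
    ring
  -- nondegeneracy
  have hne : fderiv ℝ z p (Z p) - w p * fderiv ℝ x p (Z p) ≠ 0 := by
    intro h0
    apply htrans
    rw [hα.self_of_nhds, sy.fderiv_lieBracket sX sZ, sx.fderiv_lieBracket sX sZ]
    -- Differentiating `dy(S) = z dx(S)` for `S = Z` and `S = X` gives `(dy - z dx)([X, Z]) = -dx(X)
    -- (dz(Z) - w dx(Z))` at `p`. If the last factor vanished, `[X, Z]` would lie in `ker α`.
    have hyS : ∀ S : E4 → E4, SmoothNear S p → (∀ᶠ q in 𝓝 p, α q (S q) = 0) → ∀ v,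
        fderiv ℝ (fun q => fderiv ℝ y q (S q)) p v =
          z p * fderiv ℝ (fun q => fderiv ℝ x q (S q)) p v +
            fderiv ℝ x p (S p) * fderiv ℝ z p v := by
      intro S sS hS v
      have h1 : (fun q => fderiv ℝ y q (S q)) =ᶠ[𝓝 p] fun q => z q * fderiv ℝ x q (S q) := by
        filter_upwards [hα, hS] with q h1 h2 using (h1 _).1 h2
      rw [h1.fderiv_eq, fderiv_mul_apply sz.differentiableAt
        (sx.fderiv.clm_apply sS).differentiableAt]
    rw [hyS Z sZ (hform.mono fun q hq => hq.2.2), hyS X sX (hform.mono fun q hq => hq.1),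
      hwX.self_of_nhds]
    linear_combination -fderiv ℝ x p (X p) * h0
  have hne' : ∀ᶠ q in 𝓝 p, fderiv ℝ z q (Z q) - w q * fderiv ℝ x q (Z q) ≠ 0 := by
    have : SmoothNear (fun q => fderiv ℝ z q (Z q) - w q * fderiv ℝ x q (Z q)) p :=
      (sz.fderiv.clm_apply sZ).sub (sw.mul (sx.fderiv.clm_apply sZ))
    exact this.continuousAt.eventually_ne hne
  have hmem : ∀ᶠ q in 𝓝 p, ∀ v, (α q v = 0 → fderiv ℝ z q v = w q * fderiv ℝ x q v →
      ∃ a b : ℝ, v = a • X q + b • Y q) := by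
    filter_upwards [hker, hne', hwX, hY] with q hk hne hwX hY v hv hv'
    obtain ⟨a, b, c, rfl⟩ := Submodule.mem_span_triple.1 ((hk v).1 hv)
    have hc : c = 0 := by
      refine (mul_eq_zero.1 ?_).resolve_right hne
      simp only [map_add, map_smul, smul_eq_mul, hY.1, hY.2.2, hwX] at hv'
      linear_combination hv'
    exact ⟨a, b, by simp [hc]⟩
  -- the chart
  let Ξ : E4 → E4 := fun q => x q • EuclideanSpace.single 0 1 + y q • EuclideanSpace.single 1 1 +
    z q • EuclideanSpace.single 2 1 + w q • EuclideanSpace.single 3 1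
  have sΞ : SmoothNear Ξ p := (((sx.smul (smoothNear_const _ _)).add
    (sy.smul (smoothNear_const _ _))).add (sz.smul (smoothNear_const _ _))).add
      (sw.smul (smoothNear_const _ _))
  have hdΞ : ∀ᶠ q in 𝓝 p, ∀ v, fderiv ℝ Ξ q v =
      fderiv ℝ x q v • EuclideanSpace.single 0 1 + fderiv ℝ y q v • EuclideanSpace.single 1 1 +
      fderiv ℝ z q v • EuclideanSpace.single 2 1 +
      fderiv ℝ w q v • EuclideanSpace.single 3 1 := by
    filter_upwards [sx.eventually, sy.eventually, sz.eventually, sw.eventually] with q h1 h2 h3 h4 v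
    have := ((((h1.differentiableAt.hasFDerivAt.smul_const
      (EuclideanSpace.single (0 : Fin 4) (1 : ℝ))).add (h2.differentiableAt.hasFDerivAt.smul_const
      (EuclideanSpace.single (1 : Fin 4) (1 : ℝ)))).add (h3.differentiableAt.hasFDerivAt.smul_const
      (EuclideanSpace.single (2 : Fin 4) (1 : ℝ)))).add (h4.differentiableAt.hasFDerivAt.smul_const
      (EuclideanSpace.single (3 : Fin 4) (1 : ℝ)))).fderiv
    exact congrArg (fun A : E4 →L[ℝ] E4 => A v) this
  have hΞ2 : ∀ q, Ξ q 2 = z q := fun q => by simp [Ξ]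
  have hΞ3 : ∀ q, Ξ q 3 = w q := fun q => by simp [Ξ]
  have hcoord : ∀ᶠ q in 𝓝 p, ∀ v, fderiv ℝ Ξ q v 0 = fderiv ℝ x q v ∧
      fderiv ℝ Ξ q v 1 = fderiv ℝ y q v ∧ fderiv ℝ Ξ q v 2 = fderiv ℝ z q v ∧
      fderiv ℝ Ξ q v 3 = fderiv ℝ w q v := by
    filter_upwards [hdΞ] with q hq v
    rw [hq]
    simp
  -- A vector killed by `dx`, `dy`, `dz` is `a X + b Y`; then `dx(X) ≠ 0` gives `a = 0`, and `dw(Y)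
  -- ≠ 0`, from `hZw`, gives `b = 0`.
  have hinj : LinearMap.ker (fderiv ℝ Ξ p : E4 →ₗ[ℝ] E4) = ⊥ := by
    rw [LinearMap.ker_eq_bot']
    intro v hv
    have hv' : fderiv ℝ Ξ p v = 0 := hv
    obtain ⟨h0, h1, h2, h3⟩ := hcoord.self_of_nhds v
    simp only [hv', PiLp.zero_apply] at h0 h1 h2 h3
    obtain ⟨a, b, rfl⟩ := hmem.self_of_nhds v
      ((hα.self_of_nhds v).2 (by rw [← h1, ← h0, mul_zero])) (by rw [← h2, ← h0, mul_zero])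
    have ha : a = 0 := by
      rw [map_add, map_smul, map_smul, hY.self_of_nhds.1, smul_zero, add_zero, smul_eq_mul] at h0
      exact (mul_eq_zero.1 h0.symm).resolve_right hxX
    have hb : b = 0 := by
      rw [ha, zero_smul, zero_add, map_smul, smul_eq_mul] at h3
      refine (mul_eq_zero.1 h3.symm).resolve_right fun h4 => hne ?_
      rw [hZw.self_of_nhds, h4]
      simp
    simp [ha, hb]
  let A : E4 ≃L[ℝ] E4 := (LinearEquiv.ofInjectiveEndo _
    (LinearMap.ker_eq_bot.1 hinj)).toContinuousLinearEquiv
  have hA : HasFDerivAt Ξ (A : E4 →L[ℝ] E4) p := by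
    have : (A : E4 →L[ℝ] E4) = fderiv ℝ Ξ p := by
      ext v : 1
      rfl
    rw [this]
    exact sΞ.differentiableAt.hasFDerivAt
  have hall := hcoord.and (hα.and (hmem.and (hwX.and (hY.and (hxX'.and (hform.and hs))))))
  obtain ⟨e, he, hpe, hes, hsm, hsm'⟩ := sΞ.exists_openPartialHomeomorph A hA hall
  have heΞ : (e : E4 → E4) = Ξ := funext he
  refine ⟨e, hpe, fun q hq => (hes hq).2.2.2.2.2.2.2, hsm, hsm', fun q hq v => ?_⟩
  obtain ⟨hc, hα, hmem, hwX, hY, hxX, hform, -⟩ := hes hq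
  rw [heΞ, hΞ2, hΞ3, (hc v).1, (hc v).2.1, (hc v).2.2.1]
  have hD : v ∈ Submodule.span ℝ {X q, Y q} ↔ fderiv ℝ y q v = z q * fderiv ℝ x q v ∧
      fderiv ℝ z q v = w q * fderiv ℝ x q v := by
    constructor
    · intro hv
      obtain ⟨a, b, rfl⟩ := Submodule.mem_span_pair.1 hv
      refine ⟨(hα _).1 ?_, ?_⟩
      · simp [hform.1, hform.2.1]
      · simp only [map_add, map_smul, hY.1, hY.2.2, hwX, smul_eq_mul]
        ring
    · rintro ⟨h1, h2⟩
      obtain ⟨a, b, rfl⟩ := hmem v ((hα v).2 h1) h2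
      exact Submodule.mem_span_pair.2 ⟨a, b, rfl⟩
  refine ⟨hα v, hD, ?_⟩
  constructor
  · intro hv
    obtain ⟨b, rfl⟩ := Submodule.mem_span_singleton.1 hv
    simp [hY.1, hY.2.1, hY.2.2]
  · rintro ⟨h0, h1, h2⟩
    obtain ⟨a, b, rfl⟩ := hmem v ((hα v).2 (by rw [h1, h0, mul_zero])) (by rw [h2, h0, mul_zero])
    have ha : a = 0 := by
      rw [map_add, map_smul, map_smul, hY.1, smul_zero, add_zero, smul_eq_mul] at h0
      exact (mul_eq_zero.1 h0).resolve_right hxX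
    rw [ha, zero_smul, zero_add]
    exact Submodule.mem_span_singleton.2 ⟨b, rfl⟩

end

/-! ### Brackets of sections of a rank two distribution, modulo the distribution. -/

section

variable {E : Type} [NormedAddCommGroup E] [NormedSpace ℝ E] [FiniteDimensional ℝ E]

lemma exists_defining_form_pair {X₁ X₂ : E → E} {q : E} (s₁ : SmoothNear X₁ q)
    (s₂ : SmoothNear X₂ q) (hli : LinearIndependent ℝ ![X₁ q, X₂ q]) :
    ∃ P : E → E →L[ℝ] E, SmoothNear P q ∧
      (∀ᶠ x in 𝓝 q, ∀ v, P x v = 0 ↔ v ∈ Submodule.span ℝ {X₁ x, X₂ x}) := by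
  have hX : ∀ i, SmoothNear ((![X₁, X₂] : Fin 2 → E → E) i) q := by
    intro i
    fin_cases i
    exacts [s₁, s₂]
  have hfun : ∀ x, (fun i => (![X₁, X₂] : Fin 2 → E → E) i x) = ![X₁ x, X₂ x] := by
    intro x
    ext i : 1
    fin_cases i <;> rfl
  obtain ⟨P, hP, hker⟩ := exists_defining_form hX (by rw [hfun]; exact hli)
  refine ⟨P, hP, ?_⟩
  filter_upwards [hker] with x hx v
  rw [hx, hfun, Matrix.range_cons, Matrix.range_cons, Matrix.range_empty, union_empty]
  rfl

/-- Brackets of sections of a smooth distribution of rank two are determined, modulo the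
distribution, by the bracket of the elements of a frame. -/
lemma lieBracket_sub_mem_span {X₁ X₂ S T : E → E} {q : E} (s₁ : SmoothNear X₁ q)
    (s₂ : SmoothNear X₂ q) (hli : LinearIndependent ℝ ![X₁ q, X₂ q])
    (dS : DifferentiableAt ℝ S q) (dT : DifferentiableAt ℝ T q)
    (hS : ∀ᶠ x in 𝓝 q, S x ∈ Submodule.span ℝ {X₁ x, X₂ x})
    (hT : ∀ᶠ x in 𝓝 q, T x ∈ Submodule.span ℝ {X₁ x, X₂ x})
    {a b c d : ℝ} (hSq : S q = a • X₁ q + b • X₂ q) (hTq : T q = c • X₁ q + d • X₂ q) :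
    lieBracket ℝ S T q - (a * d - b * c) • lieBracket ℝ X₁ X₂ q ∈
      Submodule.span ℝ {X₁ q, X₂ q} := by
  obtain ⟨P, hP, hker⟩ := exists_defining_form_pair s₁ s₂ hli
  have h1 : ∀ᶠ x in 𝓝 q, P x (X₁ x) = 0 := hker.mono fun x hx =>
    (hx _).2 (Submodule.subset_span (by simp))
  have h2 : ∀ᶠ x in 𝓝 q, P x (X₂ x) = 0 := hker.mono fun x hx =>
    (hx _).2 (Submodule.subset_span (by simp))
  have h3 : ∀ᶠ x in 𝓝 q, P x (S x) = 0 := by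
    filter_upwards [hker, hS] with x hx h using (hx _).2 h
  have h4 : ∀ᶠ x in 𝓝 q, P x (T x) = 0 := by
    filter_upwards [hker, hT] with x hx h using (hx _).2 h
  rw [← hker.self_of_nhds, map_sub, map_smul, apply_lieBracket hP.differentiableAt dS dT h3 h4,
    apply_lieBracket hP.differentiableAt s₁.differentiableAt s₂.differentiableAt h1 h2, hSq, hTq]
  simp only [map_add, map_smul, add_apply, smul_apply, pairing_self,
    pairing_swap P q (X₂ q) (X₁ q)]
  module

lemma lieBracket_mem_span {X₁ X₂ S T : E → E} {q : E} (s₁ : SmoothNear X₁ q)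
    (s₂ : SmoothNear X₂ q) (hli : LinearIndependent ℝ ![X₁ q, X₂ q])
    (dS : DifferentiableAt ℝ S q) (dT : DifferentiableAt ℝ T q)
    (hS : ∀ᶠ x in 𝓝 q, S x ∈ Submodule.span ℝ {X₁ x, X₂ x})
    (hT : ∀ᶠ x in 𝓝 q, T x ∈ Submodule.span ℝ {X₁ x, X₂ x}) :
    lieBracket ℝ S T q ∈ Submodule.span ℝ {X₁ q, X₂ q, lieBracket ℝ X₁ X₂ q} := by
  obtain ⟨a, b, hab⟩ := Submodule.mem_span_pair.1 hS.self_of_nhds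
  obtain ⟨c, d, hcd⟩ := Submodule.mem_span_pair.1 hT.self_of_nhds
  obtain ⟨r, s, hrs⟩ := Submodule.mem_span_pair.1
    (lieBracket_sub_mem_span s₁ s₂ hli dS dT hS hT hab.symm hcd.symm)
  exact Submodule.mem_span_triple.2 ⟨r, s, a * d - b * c, by rw [hrs]; abel⟩

end

/-! ### The Cauchy characteristic in a frame, and the change to an adapted frame. -/

section

variable {E : Type} [NormedAddCommGroup E] [NormedSpace ℝ E]
  {X₁ X₂ : E → E} {α : E → E →L[ℝ] ℝ} {p : E}

/-- A frame of a distribution of rank two together with a form defining its derived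
distribution, which is assumed to be of rank three and not integrable. -/
structure DerivedFrame (X₁ X₂ : E → E) (α : E → E →L[ℝ] ℝ) (p : E) : Prop where
  smooth₁ : SmoothNear X₁ p
  smooth₂ : SmoothNear X₂ p
  smooth_form : SmoothNear α p
  linearIndependent : LinearIndependent ℝ ![X₁ p, X₂ p, lieBracket ℝ X₁ X₂ p]
  ker_form : ∀ᶠ q in 𝓝 p, ∀ v, α q v = 0 ↔
    v ∈ Submodule.span ℝ {X₁ q, X₂ q, lieBracket ℝ X₁ X₂ q}
  pairing_ne_zero : ∃ v w, α p v = 0 ∧ α p w = 0 ∧ pairing α p v w ≠ 0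

/-- The pairings of the elements of the frame with their bracket. -/
def framePairing (X₁ X₂ : E → E) (α : E → E →L[ℝ] ℝ) (X : E → E) (q : E) : ℝ :=
  pairing α q (X q) (lieBracket ℝ X₁ X₂ q)

/-- A complement of the Cauchy characteristic in the span of a frame. -/
def complementField (X₁ X₂ : E → E) (α : E → E →L[ℝ] ℝ) (q : E) : E :=
  framePairing X₁ X₂ α X₁ q • X₁ q + framePairing X₁ X₂ α X₂ q • X₂ q

/-- A field spanning the Cauchy characteristic. -/
def characteristicField (X₁ X₂ : E → E) (α : E → E →L[ℝ] ℝ) (q : E) : E :=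
  framePairing X₁ X₂ α X₂ q • X₁ q - framePairing X₁ X₂ α X₁ q • X₂ q

namespace DerivedFrame

lemma smooth_framePairing (h : DerivedFrame X₁ X₂ α p) {X : E → E} (hX : SmoothNear X p) :
    SmoothNear (framePairing X₁ X₂ α X) p := by
  have h1 : SmoothNear (fun q => fderiv ℝ α q (lieBracket ℝ X₁ X₂ q) (X q) -
      fderiv ℝ α q (X q) (lieBracket ℝ X₁ X₂ q)) p := by
    have s3 := h.smooth₁.lieBracket h.smooth₂
    exact ((h.smooth_form.fderiv.clm_apply s3).clm_apply hX).sub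
      ((h.smooth_form.fderiv.clm_apply hX).clm_apply s3)
  exact h1

lemma smooth_complementField (h : DerivedFrame X₁ X₂ α p) :
    SmoothNear (complementField X₁ X₂ α) p :=
  ((h.smooth_framePairing h.smooth₁).smul h.smooth₁).add
    ((h.smooth_framePairing h.smooth₂).smul h.smooth₂)

lemma smooth_characteristicField (h : DerivedFrame X₁ X₂ α p) :
    SmoothNear (characteristicField X₁ X₂ α) p :=
  ((h.smooth_framePairing h.smooth₂).smul h.smooth₁).sub
    ((h.smooth_framePairing h.smooth₁).smul h.smooth₂)

lemma eventually_form_eq_zero (h : DerivedFrame X₁ X₂ α p) :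
    ∀ᶠ q in 𝓝 p, α q (X₁ q) = 0 ∧ α q (X₂ q) = 0 ∧ α q (lieBracket ℝ X₁ X₂ q) = 0 := by
  filter_upwards [h.ker_form] with q hq
  exact ⟨(hq _).2 (Submodule.subset_span (by simp)), (hq _).2 (Submodule.subset_span (by simp)),
    (hq _).2 (Submodule.subset_span (by simp))⟩

/-- The pairing of `X₁` and `X₂` is `α` of their bracket, which belongs to the kernel by
construction. -/
lemma eventually_pairing_eq_zero (h : DerivedFrame X₁ X₂ α p) :
    ∀ᶠ q in 𝓝 p, pairing α q (X₁ q) (X₂ q) = 0 := by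
  filter_upwards [h.eventually_form_eq_zero.eventually_nhds, h.smooth₁.eventually,
    h.smooth₂.eventually, h.smooth_form.eventually] with q h1 h2 h3 h4
  rw [← apply_lieBracket h4.differentiableAt h2.differentiableAt h3.differentiableAt
    (h1.mono fun x hx => hx.1) (h1.mono fun x hx => hx.2.1)]
  exact h1.self_of_nhds.2.2

/-- If both pairings with `[X₁, X₂]` vanished at `p`, so would the whole pairing on `ker α`,
contradicting non-integrability. The sum of squares serves as the common denominator in later
changes of frame. -/
lemma eventually_norm_ne_zero (h : DerivedFrame X₁ X₂ α p) :
    ∀ᶠ q in 𝓝 p, framePairing X₁ X₂ α X₁ q * framePairing X₁ X₂ α X₁ q +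
      framePairing X₁ X₂ α X₂ q * framePairing X₁ X₂ α X₂ q ≠ 0 := by
  have sa := h.smooth_framePairing h.smooth₁
  have sb := h.smooth_framePairing h.smooth₂
  refine ((sa.mul sa).add (sb.mul sb)).continuousAt.eventually_ne fun h0 => ?_
  have ha : framePairing X₁ X₂ α X₁ p = 0 := by nlinarith [sq_nonneg (framePairing X₁ X₂ α X₂ p)]
  have hb : framePairing X₁ X₂ α X₂ p = 0 := by nlinarith [sq_nonneg (framePairing X₁ X₂ α X₁ p)]
  have h12 := h.eventually_pairing_eq_zero.self_of_nhds
  obtain ⟨v, w, hv, hw, hvw⟩ := h.pairing_ne_zero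
  obtain ⟨v1, v2, v3, rfl⟩ := Submodule.mem_span_triple.1 ((h.ker_form.self_of_nhds v).1 hv)
  obtain ⟨w1, w2, w3, rfl⟩ := Submodule.mem_span_triple.1 ((h.ker_form.self_of_nhds w).1 hw)
  apply hvw
  unfold framePairing at ha hb
  simp only [map_add, map_smul, add_apply, smul_apply, pairing_self,
    pairing_swap α p (X₂ p) (X₁ p), pairing_swap α p (lieBracket ℝ X₁ X₂ p) (X₁ p),
    pairing_swap α p (lieBracket ℝ X₁ X₂ p) (X₂ p), ha, hb, h12]
  simp

lemma linearIndependent_pair (h : DerivedFrame X₁ X₂ α p) :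
    LinearIndependent ℝ ![X₁ p, X₂ p] := by
  have := h.linearIndependent.comp (Fin.castSucc : Fin 2 → Fin 3) (Fin.castSucc_injective 2)
  convert this using 1
  ext i : 1
  fin_cases i <;> rfl

lemma eventually_linearIndependent_pair (h : DerivedFrame X₁ X₂ α p) :
    ∀ᶠ q in 𝓝 p, LinearIndependent ℝ ![X₁ q, X₂ q] := by
  have hc : ContinuousAt (fun q => ![X₁ q, X₂ q]) p := by
    refine continuousAt_pi.2 fun i => ?_
    fin_cases i
    exacts [h.smooth₁.continuousAt, h.smooth₂.continuousAt]
  exact hc.eventually h.linearIndependent_pair.eventually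

/-- With `a, b` the frame pairings, the change of frame has rows `(a, b)` and `(b, -a)` and
determinant `-(a² + b²) ≠ 0`. -/
lemma span_pair_eq (h : DerivedFrame X₁ X₂ α p) :
    ∀ᶠ q in 𝓝 p, Submodule.span ℝ {complementField X₁ X₂ α q, characteristicField X₁ X₂ α q} =
      Submodule.span ℝ {X₁ q, X₂ q} := by
  filter_upwards [h.eventually_norm_ne_zero] with q hq
  unfold complementField characteristicField
  generalize framePairing X₁ X₂ α X₁ q = a at *
  generalize framePairing X₁ X₂ α X₂ q = b at *
  obtain ⟨c, hc⟩ : ∃ c, c * (a * a + b * b) = 1 := ⟨_, inv_mul_cancel₀ hq⟩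
  apply le_antisymm <;> rw [Submodule.span_le] <;> rintro v (rfl | rfl)
  · exact Submodule.mem_span_pair.2 ⟨_, _, rfl⟩
  · exact Submodule.mem_span_pair.2 ⟨b, -a, by module⟩
  · refine Submodule.mem_span_pair.2 ⟨c * a, c * b, ?_⟩
    trans (c * (a * a + b * b)) • X₁ q
    · module
    · rw [hc, one_smul]
  · refine Submodule.mem_span_pair.2 ⟨c * b, -(c * a), ?_⟩
    trans (c * (a * a + b * b)) • X₂ q
    · module
    · rw [hc, one_smul]

/-- The span of the characteristic field is the radical of the pairing. -/
lemma mem_span_characteristicField_iff (h : DerivedFrame X₁ X₂ α p) :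
    ∀ᶠ q in 𝓝 p, ∀ v, v ∈ Submodule.span ℝ {characteristicField X₁ X₂ α q} ↔
      α q v = 0 ∧ ∀ w, α q w = 0 → pairing α q v w = 0 := by
  filter_upwards [h.ker_form, h.eventually_form_eq_zero, h.eventually_pairing_eq_zero,
    h.eventually_norm_ne_zero] with q hk ⟨h1, h2, h3⟩ h12 hN v
  have ha : pairing α q (X₁ q) (lieBracket ℝ X₁ X₂ q) = framePairing X₁ X₂ α X₁ q := rfl
  have hb : pairing α q (X₂ q) (lieBracket ℝ X₁ X₂ q) = framePairing X₁ X₂ α X₂ q := rfl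
  unfold characteristicField
  generalize framePairing X₁ X₂ α X₁ q = a at *
  generalize framePairing X₁ X₂ α X₂ q = b at *
  constructor
  · intro hv
    obtain ⟨c, rfl⟩ := Submodule.mem_span_singleton.1 hv
    refine ⟨by simp [h1, h2], fun w hw => ?_⟩
    obtain ⟨w1, w2, w3, rfl⟩ := Submodule.mem_span_triple.1 ((hk w).1 hw)
    simp only [map_add, map_sub, map_smul, sub_apply, smul_apply, pairing_self,
      pairing_swap α q (X₂ q) (X₁ q), h12, ha, hb, smul_eq_mul]
    ring
  · rintro ⟨hv, hvw⟩
    obtain ⟨c1, c2, c3, rfl⟩ := Submodule.mem_span_triple.1 ((hk v).1 hv)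
    have e1 := hvw _ h1
    have e2 := hvw _ h2
    have e3 := hvw _ h3
    simp only [map_add, map_smul, add_apply, smul_apply, pairing_self,
      pairing_swap α q (X₂ q) (X₁ q), pairing_swap α q (lieBracket ℝ X₁ X₂ q) (X₁ q),
      pairing_swap α q (lieBracket ℝ X₁ X₂ q) (X₂ q), h12, ha, hb, smul_eq_mul] at e1 e2 e3
    -- Pairing with `X₁` and `X₂` gives `c3 a = c3 b = 0`. Pairing with the bracket gives `c1 a + c2
    -- b = 0`, so `(c1, c2)` is proportional to `(b, -a)`.
    have hc3 : c3 = 0 := by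
      refine (mul_eq_zero.1 ?_).resolve_right hN
      linear_combination -a * e1 - b * e2
    obtain ⟨c, hc⟩ : ∃ c, c * (a * a + b * b) = 1 := ⟨_, inv_mul_cancel₀ hN⟩
    refine Submodule.mem_span_singleton.2 ⟨c * (c1 * b - c2 * a), ?_⟩
    rw [hc3, zero_smul, add_zero, smul_sub, smul_smul, smul_smul, sub_eq_add_neg, ← neg_smul]
    congr 2
    · linear_combination c1 * hc - c * a * e3
    · linear_combination c2 * hc - c * b * e3

variable [FiniteDimensional ℝ E]

/-- Modulo the distribution, a bracket scales by the determinant of the change of frame, here `-(a²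
+ b²)`. -/
lemma lieBracket_fields (h : DerivedFrame X₁ X₂ α p) :
    ∀ᶠ q in 𝓝 p, ∃ r s : ℝ,
      lieBracket ℝ (complementField X₁ X₂ α) (characteristicField X₁ X₂ α) q =
        r • X₁ q + s • X₂ q -
        (framePairing X₁ X₂ α X₁ q * framePairing X₁ X₂ α X₁ q +
          framePairing X₁ X₂ α X₂ q * framePairing X₁ X₂ α X₂ q) • lieBracket ℝ X₁ X₂ q := by
  filter_upwards [h.smooth₁.eventually, h.smooth₂.eventually,
    h.smooth_complementField.eventually, h.smooth_characteristicField.eventually,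
    h.eventually_linearIndependent_pair, h.span_pair_eq.eventually_nhds] with q h1 h2 h3 h4 h5 h6
  have h7 := lieBracket_sub_mem_span h1 h2 h5 h3.differentiableAt h4.differentiableAt
    (h6.mono fun x hx => by rw [← hx]; exact Submodule.subset_span (by simp))
    (h6.mono fun x hx => by rw [← hx]; exact Submodule.subset_span (by simp))
    (a := framePairing X₁ X₂ α X₁ q) (b := framePairing X₁ X₂ α X₂ q)
    (c := framePairing X₁ X₂ α X₂ q) (d := -framePairing X₁ X₂ α X₁ q) rfl
    (by rw [characteristicField, neg_smul, sub_eq_add_neg])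
  obtain ⟨r, s, hrs⟩ := Submodule.mem_span_pair.1 h7
  refine ⟨r, s, ?_⟩
  rw [hrs]
  module

/-- Let `X, Y` be the new frame and `N = a² + b²`. Since `[X, Y]` is `-N [X₁, X₂]` modulo the
distribution, the rank three span is unchanged. Pairing `[X, Y]` with `Y` gives `-N (b a - a b) =
0`, and with `X` gives `-N²`: these are the characteristic and transversality conditions. -/
theorem engelFrame (h : DerivedFrame X₁ X₂ α p) :
    EngelFrame (complementField X₁ X₂ α) (characteristicField X₁ X₂ α) α p := by
  have hspan : ∀ᶠ q in 𝓝 p, Submodule.span ℝ {complementField X₁ X₂ α q,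
      characteristicField X₁ X₂ α q,
      lieBracket ℝ (complementField X₁ X₂ α) (characteristicField X₁ X₂ α) q} =
      Submodule.span ℝ {X₁ q, X₂ q, lieBracket ℝ X₁ X₂ q} := by
    filter_upwards [h.span_pair_eq, h.lieBracket_fields, h.eventually_norm_ne_zero]
      with q h1 ⟨r, s, hrs⟩ hN
    have hsub : ∀ {a b c v : E}, v ∈ Submodule.span ℝ {a, b} → v ∈ Submodule.span ℝ {a, b, c} :=
      fun hv => Submodule.span_mono (by intro x; simp; tauto) hv
    have e1 : ∀ {c : E}, X₁ q ∈ Submodule.span ℝ {complementField X₁ X₂ α q,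
        characteristicField X₁ X₂ α q, c} :=
      hsub (by rw [h1]; exact Submodule.subset_span (by simp))
    have e2 : ∀ {c : E}, X₂ q ∈ Submodule.span ℝ {complementField X₁ X₂ α q,
        characteristicField X₁ X₂ α q, c} :=
      hsub (by rw [h1]; exact Submodule.subset_span (by simp))
    apply le_antisymm <;> rw [Submodule.span_le] <;> rintro v (rfl | rfl | rfl)
    · exact hsub (by rw [← h1]; exact Submodule.subset_span (by simp))
    · exact hsub (by rw [← h1]; exact Submodule.subset_span (by simp))
    · exact Submodule.mem_span_triple.2 ⟨r, s, -(_ + _), by rw [hrs, neg_smul, ← sub_eq_add_neg]⟩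
    · exact e1
    · exact e2
    · set N := framePairing X₁ X₂ α X₁ q * framePairing X₁ X₂ α X₁ q +
        framePairing X₁ X₂ α X₂ q * framePairing X₁ X₂ α X₂ q
      have : lieBracket ℝ X₁ X₂ q = N⁻¹ • (r • X₁ q + s • X₂ q -
          lieBracket ℝ (complementField X₁ X₂ α) (characteristicField X₁ X₂ α) q) := by
        rw [hrs, sub_sub_cancel, smul_smul, inv_mul_cancel₀ hN, one_smul]
      rw [this]
      exact Submodule.smul_mem _ _ (Submodule.sub_mem _ (Submodule.add_mem _
        (Submodule.smul_mem _ _ e1) (Submodule.smul_mem _ _ e2)) (Submodule.subset_span (by simp)))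
  have hker : ∀ᶠ q in 𝓝 p, ∀ v, α q v = 0 ↔ v ∈ Submodule.span ℝ {complementField X₁ X₂ α q,
      characteristicField X₁ X₂ α q,
      lieBracket ℝ (complementField X₁ X₂ α) (characteristicField X₁ X₂ α) q} := by
    filter_upwards [hspan, h.ker_form] with q h1 h2 v
    rw [h1, h2]
  have hzero : ∀ᶠ q in 𝓝 p, α q (complementField X₁ X₂ α q) = 0 ∧
      α q (characteristicField X₁ X₂ α q) = 0 ∧
      α q (lieBracket ℝ (complementField X₁ X₂ α) (characteristicField X₁ X₂ α) q) = 0 := by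
    filter_upwards [hker] with q hq
    exact ⟨(hq _).2 (Submodule.subset_span (by simp)), (hq _).2 (Submodule.subset_span (by simp)),
      (hq _).2 (Submodule.subset_span (by simp))⟩
  have sX := h.smooth_complementField
  have sY := h.smooth_characteristicField
  have sZ := sX.lieBracket sY
  refine ⟨sX, sY, h.smooth_form, ?_, hker, ?_, ?_⟩
  · have h3 := linearIndependent_iff_card_eq_finrank_span.1 h.linearIndependent
    rw [linearIndependent_iff_card_eq_finrank_span]
    have hr : ∀ a b c : E, range ![a, b, c] = {a, b, c} := by
      intro a b c
      ext v
      simp [eq_comm]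
      tauto
    rw [Set.finrank, hr] at h3 ⊢
    rw [h3, hspan.self_of_nhds]
  · filter_upwards [hzero.eventually_nhds, sY.eventually, sZ.eventually,
      h.smooth_form.eventually, h.lieBracket_fields, h.eventually_pairing_eq_zero]
      with q h1 h2 h3 h4 ⟨r, s, hrs⟩ h12
    rw [apply_lieBracket h4.differentiableAt h2.differentiableAt h3.differentiableAt
      (h1.mono fun x hx => hx.2.1) (h1.mono fun x hx => hx.2.2), hrs, characteristicField]
    simp only [map_add, map_sub, map_smul, sub_apply, smul_apply, pairing_self,
      pairing_swap α q (X₂ q) (X₁ q), h12, smul_eq_mul]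
    rw [show pairing α q (X₁ q) (lieBracket ℝ X₁ X₂ q) = framePairing X₁ X₂ α X₁ q from rfl,
      show pairing α q (X₂ q) (lieBracket ℝ X₁ X₂ q) = framePairing X₁ X₂ α X₂ q from rfl]
    ring
  · obtain ⟨r, s, hrs⟩ := h.lieBracket_fields.self_of_nhds
    have h12 := h.eventually_pairing_eq_zero.self_of_nhds
    rw [apply_lieBracket h.smooth_form.differentiableAt sX.differentiableAt sZ.differentiableAt
      (hzero.mono fun x hx => hx.1) (hzero.mono fun x hx => hx.2.2), hrs, complementField]
    simp only [map_add, map_sub, map_smul, add_apply, smul_apply, pairing_self,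
      pairing_swap α p (X₂ p) (X₁ p), h12, smul_eq_mul]
    rw [show pairing α p (X₁ p) (lieBracket ℝ X₁ X₂ p) = framePairing X₁ X₂ α X₁ p from rfl,
      show pairing α p (X₂ p) (lieBracket ℝ X₁ X₂ p) = framePairing X₁ X₂ α X₂ p from rfl]
    have hN := h.eventually_norm_ne_zero.self_of_nhds
    intro h0
    apply mul_ne_zero hN hN
    linear_combination -h0

end DerivedFrame

end

/-! ### Vector fields and their brackets read in a chart. -/

section

variable {M : Type*} [TopologicalSpace M] [ChartedSpace E4 M] [IsManifold (𝓡 4) ∞ M]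

/-- The derivative of the preferred chart at `p`. -/
def chartDeriv (p x : M) : TangentSpace (𝓡 4) x →L[ℝ] E4 :=
  mfderiv (𝓡 4) (𝓡 4) (chartAt E4 p) x

/-- A vector field read in the preferred chart at `p`. -/
def chartField (p : M) (V : ∀ x : M, TangentSpace (𝓡 4) x) (u : E4) : E4 :=
  mpullback 𝓘(ℝ, E4) (𝓡 4) (chartAt E4 p).symm V u

lemma mdifferentiable_chartAt (p : M) : (chartAt E4 p).MDifferentiable (𝓡 4) (𝓡 4) :=
  have : IsManifold (𝓡 4) 1 M := IsManifold.of_le (n := ∞) (by simp)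
  mdifferentiable_chart p

lemma chartDeriv_injective {p x : M} (hx : x ∈ (chartAt E4 p).source) :
    Function.Injective (chartDeriv p x) := (mdifferentiable_chartAt p).mfderiv_injective hx

/-- The pullback inverts the derivative of the inverse chart, and that inverse is the derivative of
the chart. -/
lemma chartField_of_mem_target {p : M} (V : ∀ x : M, TangentSpace (𝓡 4) x) {u : E4}
    (hu : u ∈ (chartAt E4 p).target) :
    chartField p V u = chartDeriv p ((chartAt E4 p).symm u) (V ((chartAt E4 p).symm u)) := by
  have he := mdifferentiable_chartAt p
  have h1 := he.comp_symm_deriv hu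
  have h2 := he.symm_comp_deriv ((chartAt E4 p).map_target hu)
  rw [(chartAt E4 p).right_inv hu] at h2
  rw [chartField, mpullback_apply]
  exact congrArg (fun A : TangentSpace (𝓡 4) ((chartAt E4 p).symm u) →L[ℝ] E4 =>
    A (V ((chartAt E4 p).symm u))) (ContinuousLinearMap.inverse_eq h2 h1)

lemma chartField_apply {p x : M} (V : ∀ x : M, TangentSpace (𝓡 4) x)
    (hx : x ∈ (chartAt E4 p).source) :
    chartField p V (chartAt E4 p x) = chartDeriv p x (V x) := by
  rw [chartField_of_mem_target V ((chartAt E4 p).map_source hx), (chartAt E4 p).left_inv hx]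

/-- Smoothness of a vector field near a point. -/
abbrev FieldSmoothAt (V : ∀ x : M, TangentSpace (𝓡 4) x) (x : M) : Prop :=
  ContMDiffAt (𝓡 4) (𝓡 4).tangent ∞ (fun y => (⟨y, V y⟩ : TangentBundle (𝓡 4) M)) x

lemma contDiffAt_chartField {p x : M} {V : ∀ x : M, TangentSpace (𝓡 4) x}
    (hx : x ∈ (chartAt E4 p).source) (hV : FieldSmoothAt V x) :
    ContDiffAt ℝ ∞ (chartField p V) (chartAt E4 p x) := by
  have he := mdifferentiable_chartAt p
  have hm := (chartAt E4 p).map_source hx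
  have hs : ContMDiffAt (𝓡 4) (𝓡 4) ∞ (chartAt E4 p).symm (chartAt E4 p x) :=
    (contMDiffOn_chart_symm (n := ∞)).contMDiffAt ((chartAt E4 p).open_target.mem_nhds hm)
  have := ContMDiffAt.mpullback_vectorField_preimage (m := ∞) (n := ∞)
    (V := V) (f := (chartAt E4 p).symm) (x₀ := chartAt E4 p x) (I := 𝓘(ℝ, E4))
    (by rw [(chartAt E4 p).left_inv hx]; exact hV) hs
    ⟨he.symm.mfderiv hm, rfl⟩ (by simp)
  exact contMDiffAt_vectorSpace_iff_contDiffAt.1 this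

lemma smoothNear_chartField {p x : M} {V : ∀ x : M, TangentSpace (𝓡 4) x}
    (hx : x ∈ (chartAt E4 p).source) {U : Set M} (hxU : x ∈ U) (hV : IsSmoothVectorFieldOn U V) :
    SmoothNear (chartField p V) (chartAt E4 p x) := by
  have h1 : ∀ᶠ y in 𝓝 x, ContDiffAt ℝ ∞ (chartField p V) (chartAt E4 p y) := by
    filter_upwards [hV.isOpen.mem_nhds hxU, (chartAt E4 p).open_source.mem_nhds hx] with y hy hy'
    exact contDiffAt_chartField hy' (hV.smooth.contMDiffAt (hV.isOpen.mem_nhds hy))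
  have hm := (chartAt E4 p).map_source hx
  have h2 := (chartAt E4 p).continuousAt_symm hm
  rw [ContinuousAt, (chartAt E4 p).left_inv hx] at h2
  filter_upwards [h2.eventually h1, (chartAt E4 p).open_target.mem_nhds hm] with u hu hu'
  rwa [(chartAt E4 p).right_inv hu'] at hu

lemma chartField_mlieBracket {p x : M} {V W : ∀ x : M, TangentSpace (𝓡 4) x}
    (hx : x ∈ (chartAt E4 p).source) (hV : FieldSmoothAt V x) (hW : FieldSmoothAt W x) :
    chartField p (mlieBracket (𝓡 4) V W) (chartAt E4 p x) =
      lieBracket ℝ (chartField p V) (chartField p W) (chartAt E4 p x) := by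
  have hm := (chartAt E4 p).map_source hx
  have hs : ContMDiffAt (𝓡 4) (𝓡 4) ∞ (chartAt E4 p).symm (chartAt E4 p x) :=
    (contMDiffOn_chart_symm (n := ∞)).contMDiffAt ((chartAt E4 p).open_target.mem_nhds hm)
  have : IsManifold (𝓡 4) (minSmoothness ℝ 3) M := IsManifold.of_le (n := ∞) (by
    simpa using ENat.LEInfty.out)
  have := mpullback_mlieBracket (n := ∞) (V := V) (W := W) (f := (chartAt E4 p).symm)
    (x₀ := chartAt E4 p x) (I := 𝓘(ℝ, E4))
    (by rw [(chartAt E4 p).left_inv hx]; exact hV.mdifferentiableAt (by simp))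
    (by rw [(chartAt E4 p).left_inv hx]; exact hW.mdifferentiableAt (by simp)) hs
    (by simpa using ENat.LEInfty.out)
  refine this.trans ?_
  rw [← mlieBracketWithin_univ, mlieBracketWithin_eq_lieBracketWithin]
  exact congrFun (lieBracketWithin_univ (𝕜 := ℝ) (V := chartField p V) (W := chartField p W)) _

end

/-! ### Derived distribution and annihilator in terms of frames and forms. -/

section

variable {M : Type*} [TopologicalSpace M] [ChartedSpace E4 M]

instance (x : M) : FiniteDimensional ℝ (TangentSpace (𝓡 4) x) :=
  inferInstanceAs (FiniteDimensional ℝ E4)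

lemma finrank_tangentSpace (x : M) : Module.finrank ℝ (TangentSpace (𝓡 4) x) = 4 :=
  finrank_euclideanSpace_fin (𝕜 := ℝ) (n := 4)

lemma eventually_chartAt_symm {p x : M} (hx : x ∈ (chartAt E4 p).source) {P : M → Prop}
    (h : ∀ᶠ y in 𝓝 x, P y) : ∀ᶠ u in 𝓝 (chartAt E4 p x), P ((chartAt E4 p).symm u) := by
  have h2 := (chartAt E4 p).continuousAt_symm ((chartAt E4 p).map_source hx)
  rw [ContinuousAt, (chartAt E4 p).left_inv hx] at h2
  exact h2.eventually h

variable [IsManifold (𝓡 4) ∞ M]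

lemma chartDeriv_surjective {p x : M} (hx : x ∈ (chartAt E4 p).source) :
    Function.Surjective (chartDeriv p x) := (mdifferentiable_chartAt p).mfderiv_surjective hx

lemma chartDeriv_mem_span_iff {p x : M} (hx : x ∈ (chartAt E4 p).source)
    {s : Set (TangentSpace (𝓡 4) x)} {v : TangentSpace (𝓡 4) x} :
    chartDeriv p x v ∈ Submodule.span ℝ (chartDeriv p x '' s) ↔ v ∈ Submodule.span ℝ s := by
  have h := Submodule.map_span (chartDeriv p x).toLinearMap s
  have h' : Submodule.span ℝ (chartDeriv p x '' s) =
    Submodule.map (chartDeriv p x).toLinearMap (Submodule.span ℝ s) := h.symm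
  rw [h']
  exact (chartDeriv_injective hx).mem_set_image (s := (Submodule.span ℝ s : Set _))

lemma IsSmoothVectorFieldOn.fieldSmoothAt {U : Set M} {V : ∀ x : M, TangentSpace (𝓡 4) x}
    (h : IsSmoothVectorFieldOn U V) {x : M} (hx : x ∈ U) : FieldSmoothAt V x :=
  h.smooth.contMDiffAt (h.isOpen.mem_nhds hx)

lemma IsSmoothVectorFieldOn.mlieBracket {U : Set M} {V W : ∀ x : M, TangentSpace (𝓡 4) x}
    (hV : IsSmoothVectorFieldOn U V) (hW : IsSmoothVectorFieldOn U W) :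
    IsSmoothVectorFieldOn U (mlieBracket (𝓡 4) V W) := by
  refine ⟨hV.isOpen, fun x hx => ContMDiffAt.contMDiffWithinAt ?_⟩
  have : IsManifold (𝓡 4) ((∞ : WithTop ℕ∞) + 1) M := by simpa using ‹IsManifold (𝓡 4) ∞ M›
  have : IsManifold (𝓡 4) (minSmoothness ℝ 2) M := IsManifold.of_le (n := ∞) (by
    simpa using ENat.LEInfty.out)
  exact ContMDiffAt.mlieBracket_vectorField (n := ⊤) (m := ⊤) (hV.fieldSmoothAt hx)
    (hW.fieldSmoothAt hx) (by simp)

lemma IsSmoothVectorFieldOn.add {U : Set M} {V W : ∀ x : M, TangentSpace (𝓡 4) x}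
    (hV : IsSmoothVectorFieldOn U V) (hW : IsSmoothVectorFieldOn U W) :
    IsSmoothVectorFieldOn U (V + W) := ⟨hV.isOpen, hV.smooth.add_section hW.smooth⟩

lemma IsSmoothVectorFieldOn.const_smul {U : Set M} {V : ∀ x : M, TangentSpace (𝓡 4) x}
    (hV : IsSmoothVectorFieldOn U V) (c : ℝ) :
    IsSmoothVectorFieldOn U (c • V) := ⟨hV.isOpen, hV.smooth.const_smul_section⟩

/-- A form annihilating a distribution evaluates tensorially on brackets of its sections. -/
lemma form_mlieBracket {A : Distribution M} {p x : M} (hx : x ∈ (chartAt E4 p).source)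
    {α : E4 → E4 →L[ℝ] ℝ} (hα : DifferentiableAt ℝ α (chartAt E4 p x))
    (hA : ∀ᶠ y in 𝓝 x, ∀ v ∈ A y, α (chartAt E4 p y) (chartDeriv p y v) = 0)
    {U V : Set M} {S T : ∀ x : M, TangentSpace (𝓡 4) x} (hxU : x ∈ U) (hxV : x ∈ V)
    (hS : IsSection A U S) (hT : IsSection A V T) :
    α (chartAt E4 p x) (chartDeriv p x (mlieBracket (𝓡 4) S T x)) =
      pairing α (chartAt E4 p x) (chartDeriv p x (S x)) (chartDeriv p x (T x)) := by
  have hz : ∀ {U : Set M} {S : ∀ x : M, TangentSpace (𝓡 4) x}, x ∈ U → IsSection A U S →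
      ∀ᶠ u in 𝓝 (chartAt E4 p x), α u (chartField p S u) = 0 := by
    intro U S hxU hS
    filter_upwards [eventually_chartAt_symm hx hA,
      eventually_chartAt_symm hx (hS.isOpen.mem_nhds hxU),
      (chartAt E4 p).open_target.mem_nhds ((chartAt E4 p).map_source hx)] with u h1 h2 h3
    have := h1 _ (hS.mem _ h2)
    rwa [(chartAt E4 p).right_inv h3, ← chartField_of_mem_target S h3] at this
  have sS := hS.fieldSmoothAt hxU
  have sT := hT.fieldSmoothAt hxV
  rw [← chartField_apply _ hx, chartField_mlieBracket hx sS sT, ← chartField_apply _ hx,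
    ← chartField_apply _ hx]
  exact apply_lieBracket hα ((contDiffAt_chartField hx sS).differentiableAt (by simp))
    ((contDiffAt_chartField hx sT).differentiableAt (by simp)) (hz hxU hS) (hz hxV hT)

/-- The annihilator of the bracket pairing of the kernel of a form is the radical of the
exterior derivative of the form restricted to the kernel. -/
lemma mem_annihilator_iff {A : Distribution M} {p x : M} (hx : x ∈ (chartAt E4 p).source)
    {α : E4 → E4 →L[ℝ] ℝ} (hα : DifferentiableAt ℝ α (chartAt E4 p x))
    (hA : ∀ᶠ y in 𝓝 x, ∀ v, v ∈ A y ↔ α (chartAt E4 p y) (chartDeriv p y v) = 0)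
    (hext : ∀ v ∈ A x, ∃ (U : Set M) (S : ∀ x : M, TangentSpace (𝓡 4) x),
      x ∈ U ∧ IsSection A U S ∧ S x = v) (v : TangentSpace (𝓡 4) x) :
    v ∈ annihilator A x ↔ α (chartAt E4 p x) (chartDeriv p x v) = 0 ∧
      ∀ w, α (chartAt E4 p x) w = 0 →
        pairing α (chartAt E4 p x) (chartDeriv p x v) w = 0 := by
  have hA' : ∀ᶠ y in 𝓝 x, ∀ v ∈ A y, α (chartAt E4 p y) (chartDeriv p y v) = 0 :=
    hA.mono fun y hy v hv => (hy v).1 hv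
  have hAx := hA.self_of_nhds
  constructor
  · rintro ⟨U, S, hxU, hS, rfl, hbr⟩
    refine ⟨(hAx _).1 (hS.mem x hxU), fun w hw => ?_⟩
    -- The annihilator only tests against sections; `hext` turns every vector of the kernel into the
    -- value of one.
    obtain ⟨w, rfl⟩ := chartDeriv_surjective hx w
    obtain ⟨V, T, hxV, hT, rfl⟩ := hext w ((hAx w).2 hw)
    rw [← form_mlieBracket hx hα hA' hxU hxV hS hT]
    exact (hAx _).1 (hbr V T hxV hT)
  · rintro ⟨hv, hw⟩
    obtain ⟨U, S, hxU, hS, rfl⟩ := hext v ((hAx v).2 hv)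
    refine ⟨U, S, hxU, hS, rfl, fun V T hxV hT => (hAx _).2 ?_⟩
    rw [form_mlieBracket hx hα hA' hxU hxV hS hT]
    exact hw _ ((hAx _).1 (hT.mem x hxV))

lemma range_fin_two {R : Type*} (f : Fin 2 → R) : range f = {f 0, f 1} := by
  ext v
  simp [Fin.exists_fin_two, eq_comm]

lemma range_fin_three {R : Type*} (f : Fin 3 → R) : range f = {f 0, f 1, f 2} := by
  ext v
  simp [Fin.exists_fin_succ, eq_comm]

/-- The derived distribution of a rank two distribution is spanned, if it has rank three, by a
frame and its bracket. -/
lemma derived_eq_span {D : Distribution M} {U : Set M} {X₁ X₂ : ∀ x : M, TangentSpace (𝓡 4) x}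
    (h₁ : IsSmoothVectorFieldOn U X₁) (h₂ : IsSmoothVectorFieldOn U X₂)
    (hli : ∀ x ∈ U, LinearIndependent ℝ ![X₁ x, X₂ x])
    (hD : ∀ x ∈ U, Submodule.span ℝ {X₁ x, X₂ x} = D x) {x : M} (hx : x ∈ U)
    (hr : Module.finrank ℝ (derived D x) = 3) :
    Submodule.span ℝ {X₁ x, X₂ x, mlieBracket (𝓡 4) X₁ X₂ x} = derived D x := by
  have hc := mem_chart_source E4 x
  have himg : ∀ {y : M} (v w : TangentSpace (𝓡 4) y),
      chartDeriv x y '' {v, w} = {chartDeriv x y v, chartDeriv x y w} := fun v w => image_pair _ _ _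
  have hsec : ∀ {V : Set M} {S : ∀ x : M, TangentSpace (𝓡 4) x}, x ∈ V → IsSection D V S →
      ∀ᶠ u in 𝓝 (chartAt E4 x x), chartField x S u ∈
        Submodule.span ℝ {chartField x X₁ u, chartField x X₂ u} := by
    intro V S hxV hS
    filter_upwards [eventually_chartAt_symm hc (hS.isOpen.mem_nhds hxV),
      eventually_chartAt_symm hc (h₁.isOpen.mem_nhds hx),
      (chartAt E4 x).open_target.mem_nhds ((chartAt E4 x).map_source hc)] with u h1 h2 h3
    rw [chartField_of_mem_target _ h3, chartField_of_mem_target _ h3,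
      chartField_of_mem_target _ h3, ← himg,
      chartDeriv_mem_span_iff ((chartAt E4 x).map_target h3), hD _ h2]
    exact hS.mem _ h1
  symm
  -- Brackets of arbitrary sections stay in the span of the three fields; that span has dimension at
  -- most three, the rank of the derived distribution, so the inclusion is an equality.
  apply Submodule.eq_of_le_of_finrank_le
  · refine Submodule.span_le.2 ?_
    rintro v ⟨V, S, T, hxV, hS, hT, rfl⟩
    have hL : LinearIndependent ℝ ![chartField x X₁ (chartAt E4 x x),
        chartField x X₂ (chartAt E4 x x)] := by
      have := (hli x hx).map' (chartDeriv x x).toLinearMap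
        (LinearMap.ker_eq_bot.2 (chartDeriv_injective hc))
      have he : ![chartField x X₁ (chartAt E4 x x), chartField x X₂ (chartAt E4 x x)] =
          chartDeriv x x ∘ ![X₁ x, X₂ x] := by
        ext i : 1
        fin_cases i
        exacts [chartField_apply _ hc, chartField_apply _ hc]
      rw [he]
      exact this
    have sS := hS.fieldSmoothAt hxV
    have sT := hT.fieldSmoothAt hxV
    have := lieBracket_mem_span (smoothNear_chartField hc hx h₁) (smoothNear_chartField hc hx h₂)
      hL ((contDiffAt_chartField hc sS).differentiableAt (by simp))
      ((contDiffAt_chartField hc sT).differentiableAt (by simp)) (hsec hxV hS) (hsec hxV hT)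
    rw [← chartField_mlieBracket hc sS sT,
      ← chartField_mlieBracket hc (h₁.fieldSmoothAt hx) (h₂.fieldSmoothAt hx),
      chartField_apply _ hc, chartField_apply _ hc, chartField_apply _ hc,
      chartField_apply _ hc] at this
    rw [SetLike.mem_coe, ← chartDeriv_mem_span_iff hc, image_insert_eq, himg]
    exact this
  · have := finrank_range_le_card (R := ℝ) ![X₁ x, X₂ x, mlieBracket (𝓡 4) X₁ X₂ x]
    rw [Set.finrank, range_fin_three] at this
    rw [hr]
    exact this

end

/-! ### Engel charts on the manifold. -/

section

variable {M : Type*} [TopologicalSpace M] [ChartedSpace E4 M] [IsManifold (𝓡 4) ∞ M]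

/-- An Engel structure, its even contact structure and its Cauchy characteristic read in a
chart. -/
theorem IsEngelStructure.exists_derivedFrame {D : Distribution M} (hD : IsEngelStructure D)
    (p : M) : ∃ (Y₁ Y₂ : E4 → E4) (α : E4 → E4 →L[ℝ] ℝ), DerivedFrame Y₁ Y₂ α (chartAt E4 p p) ∧
      ∀ᶠ x in 𝓝 p, ∀ v : TangentSpace (𝓡 4) x,
        (v ∈ D x ↔ chartDeriv p x v ∈
          Submodule.span ℝ {Y₁ (chartAt E4 p x), Y₂ (chartAt E4 p x)}) ∧
        (v ∈ evenContact D x ↔ α (chartAt E4 p x) (chartDeriv p x v) = 0) ∧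
        (v ∈ cauchyCharacteristic D x ↔ chartDeriv p x v ∈
          Submodule.span ℝ {characteristicField Y₁ Y₂ α (chartAt E4 p x)}) := by
  obtain ⟨U, hpU, X, hX, hfr⟩ := hD.smooth p
  have hc := mem_chart_source E4 p
  have hli : ∀ x ∈ U, LinearIndependent ℝ ![X 0 x, X 1 x] := by
    intro x hx
    convert (hfr x hx).1 using 1
    ext i : 1
    fin_cases i <;> rfl
  have hDs : ∀ x ∈ U, Submodule.span ℝ {X 0 x, X 1 x} = D x := by
    intro x hx
    rw [← (hfr x hx).2, range_fin_two]
  have hX3 := (hX 0).mlieBracket (hX 1)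
  set X₃ := mlieBracket (𝓡 4) (X 0) (X 1)
  have hEs : ∀ x ∈ U, Submodule.span ℝ {X 0 x, X 1 x, X₃ x} = derived D x := fun x hx =>
    derived_eq_span (hX 0) (hX 1) hli hDs hx (hD.rank_derived x)
  set Y₁ := chartField p (X 0)
  set Y₂ := chartField p (X 1)
  have hY1 : ∀ x ∈ (chartAt E4 p).source, chartDeriv p x (X 0 x) = Y₁ (chartAt E4 p x) :=
    fun x hx => (chartField_apply _ hx).symm
  have hY2 : ∀ x ∈ (chartAt E4 p).source, chartDeriv p x (X 1 x) = Y₂ (chartAt E4 p x) :=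
    fun x hx => (chartField_apply _ hx).symm
  have hY3 : ∀ x ∈ (chartAt E4 p).source, x ∈ U →
      chartDeriv p x (X₃ x) = lieBracket ℝ Y₁ Y₂ (chartAt E4 p x) := by
    intro x hx hxU
    rw [← chartField_apply _ hx]
    exact chartField_mlieBracket hx ((hX 0).fieldSmoothAt hxU) ((hX 1).fieldSmoothAt hxU)
  have himg : ∀ x ∈ (chartAt E4 p).source, x ∈ U → chartDeriv p x '' {X 0 x, X 1 x, X₃ x} =
      {Y₁ (chartAt E4 p x), Y₂ (chartAt E4 p x), lieBracket ℝ Y₁ Y₂ (chartAt E4 p x)} := by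
    intro x hx hxU
    rw [image_insert_eq, image_pair, hY1 x hx, hY2 x hx, hY3 x hx hxU]
  have hmem : ∀ᶠ x in 𝓝 p, x ∈ (chartAt E4 p).source ∧ x ∈ U :=
    ((chartAt E4 p).open_source.eventually_mem hc).and ((hX 0).isOpen.eventually_mem hpU)
  have s1 := smoothNear_chartField hc hpU (hX 0)
  have s2 := smoothNear_chartField hc hpU (hX 1)
  have hLI : LinearIndependent ℝ ![Y₁ (chartAt E4 p p), Y₂ (chartAt E4 p p),
      lieBracket ℝ Y₁ Y₂ (chartAt E4 p p)] := by
    have h3 : LinearIndependent ℝ ![X 0 p, X 1 p, X₃ p] := by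
      rw [linearIndependent_iff_card_eq_finrank_span, Set.finrank, range_fin_three]
      change 3 = Module.finrank ℝ (Submodule.span ℝ {X 0 p, X 1 p, X₃ p})
      rw [hEs p hpU, hD.rank_derived]
    have h4 := h3.map' (chartDeriv p p).toLinearMap
      (LinearMap.ker_eq_bot.2 (chartDeriv_injective hc))
    have he : ![Y₁ (chartAt E4 p p), Y₂ (chartAt E4 p p), lieBracket ℝ Y₁ Y₂ (chartAt E4 p p)] =
        chartDeriv p p ∘ ![X 0 p, X 1 p, X₃ p] := by
      ext i : 1
      fin_cases i
      exacts [(hY1 p hc).symm, (hY2 p hc).symm, (hY3 p hc hpU).symm]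
    rw [he]
    exact h4
  have hfun : (fun i => (![Y₁, Y₂, lieBracket ℝ Y₁ Y₂] : Fin 3 → E4 → E4) i (chartAt E4 p p)) =
      ![Y₁ (chartAt E4 p p), Y₂ (chartAt E4 p p), lieBracket ℝ Y₁ Y₂ (chartAt E4 p p)] := by
    ext i : 1
    fin_cases i <;> rfl
  obtain ⟨α, sα, hker⟩ := exists_scalar_form (k := 3) (X := ![Y₁, Y₂, lieBracket ℝ Y₁ Y₂])
    (p := chartAt E4 p p) (by
      intro i
      fin_cases i
      exacts [s1, s2, s1.lieBracket s2]) (by rw [hfun]; exact hLI) (by simp)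
  have hker' : ∀ᶠ q in 𝓝 (chartAt E4 p p), ∀ v, α q v = 0 ↔
      v ∈ Submodule.span ℝ {Y₁ q, Y₂ q, lieBracket ℝ Y₁ Y₂ q} := by
    filter_upwards [hker] with q hq v
    rw [hq, range_fin_three]
    rfl
  have hcont := (chartAt E4 p).continuousAt hc
  have hE : ∀ᶠ x in 𝓝 p, ∀ v : TangentSpace (𝓡 4) x, v ∈ derived D x ↔
      α (chartAt E4 p x) (chartDeriv p x v) = 0 := by
    filter_upwards [hmem, hcont.eventually hker'] with x ⟨hx, hxU⟩ h v
    rw [h, ← himg x hx hxU, chartDeriv_mem_span_iff hx, hEs x hxU]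
  have hframe : DerivedFrame Y₁ Y₂ α (chartAt E4 p p) := by
    refine ⟨s1, s2, sα, hLI, hker', ?_⟩
    -- Were the pairing zero on `ker α` at `p`, brackets of sections of `E` would stay in `E` there,
    -- against `[E, E] = TM`.
    by_contra! hcon
    have hle : derived (derived D) p ≤ derived D p := by
      refine Submodule.span_le.2 ?_
      rintro v ⟨V, S, T, hV, hS, hT, rfl⟩
      refine (hE.self_of_nhds _).2 ?_
      rw [form_mlieBracket hc sα.differentiableAt (hE.mono fun y hy v hv => (hy v).1 hv) hV hV
        hS hT]
      exact hcon _ _ ((hE.self_of_nhds _).1 (hS.mem p hV)) ((hE.self_of_nhds _).1 (hT.mem p hV))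
    have h1 := Submodule.finrank_mono hle
    rw [hD.derived_derived, hD.rank_derived, finrank_top, finrank_tangentSpace] at h1
    omega
  refine ⟨Y₁, Y₂, α, hframe, ?_⟩
  filter_upwards [hmem, hE.eventually_nhds, hcont.eventually sα.eventually,
    hcont.eventually hframe.mem_span_characteristicField_iff] with x ⟨hx, hxU⟩ hEx hα hchar v
  refine ⟨?_, hEx.self_of_nhds v, ?_⟩
  · rw [← hY1 x hx, ← hY2 x hx, ← image_pair, chartDeriv_mem_span_iff hx, hDs x hxU]
  · rw [hchar]
    refine mem_annihilator_iff hx hα.differentiableAt hEx (fun v hv => ?_) v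
    replace hv : v ∈ derived D x := hv
    rw [← hEs x hxU] at hv
    -- A vector of `E` extends to the section with the same, constant, coefficients in the frame.
    obtain ⟨a, b, c, rfl⟩ := Submodule.mem_span_triple.1 hv
    refine ⟨U, a • X 0 + b • X 1 + c • X₃, hxU, ⟨(((hX 0).const_smul a).add
      ((hX 1).const_smul b)).add (hX3.const_smul c), fun y hy => ?_⟩, rfl⟩
    rw [← hEs y hy]
    exact Submodule.mem_span_triple.2 ⟨a, b, c, rfl⟩

/-- A chart in which the distribution `D` is the Engel distribution `dy = z dx`, `dz = w dx` of
`ℝ⁴`. -/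
structure IsEngelChart (D : Distribution M) (e : OpenPartialHomeomorph M E4) : Prop where
  smooth : ContMDiffOn (𝓡 4) (𝓡 4) ∞ e e.source
  smooth_symm : ContMDiffOn (𝓡 4) (𝓡 4) ∞ e.symm e.target
  mem_evenContact_iff : ∀ x ∈ e.source, ∀ v : TangentSpace (𝓡 4) x, ∀ u : E4,
    mfderiv (𝓡 4) (𝓡 4) e x v = u → (v ∈ evenContact D x ↔ u 1 = e x 2 * u 0)
  mem_iff : ∀ x ∈ e.source, ∀ v : TangentSpace (𝓡 4) x, ∀ u : E4,
    mfderiv (𝓡 4) (𝓡 4) e x v = u → (v ∈ D x ↔ u 1 = e x 2 * u 0 ∧ u 2 = e x 3 * u 0)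
  mem_cauchyCharacteristic_iff : ∀ x ∈ e.source, ∀ v : TangentSpace (𝓡 4) x, ∀ u : E4,
    mfderiv (𝓡 4) (𝓡 4) e x v = u →
      (v ∈ cauchyCharacteristic D x ↔ u 0 = 0 ∧ u 1 = 0 ∧ u 2 = 0)

/-- The preferred chart is followed by the Engel coordinates of the adapted frame. All pointwise
identifications hold near `p`, and `hs` shrinks the domain so that they hold throughout it. -/
theorem IsEngelStructure.exists_engelChart {D : Distribution M} (hD : IsEngelStructure D)
    (p : M) : ∃ e, IsEngelChart D e ∧ p ∈ e.source := by
  obtain ⟨Y₁, Y₂, α, hfr, hev⟩ := hD.exists_derivedFrame p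
  have hc := mem_chart_source E4 p
  have hs : ∀ᶠ u in 𝓝 (chartAt E4 p p), u ∈ (chartAt E4 p).target ∧
      (∀ v : TangentSpace (𝓡 4) ((chartAt E4 p).symm u),
        (v ∈ D _ ↔ chartDeriv p _ v ∈ Submodule.span ℝ {Y₁ u, Y₂ u}) ∧
        (v ∈ evenContact D _ ↔ α u (chartDeriv p _ v) = 0) ∧
        (v ∈ cauchyCharacteristic D _ ↔ chartDeriv p _ v ∈
          Submodule.span ℝ {characteristicField Y₁ Y₂ α u})) ∧
      Submodule.span ℝ {complementField Y₁ Y₂ α u, characteristicField Y₁ Y₂ α u} =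
        Submodule.span ℝ {Y₁ u, Y₂ u} := by
    filter_upwards [eventually_chartAt_symm hc hev, hfr.span_pair_eq,
      (chartAt E4 p).open_target.mem_nhds ((chartAt E4 p).map_source hc)] with u h1 h2 h3
    refine ⟨h3, fun v => ?_, h2⟩
    have := h1 v
    rwa [(chartAt E4 p).right_inv h3] at this
  obtain ⟨e, hpe, hes, he, he', hd⟩ := hfr.engelFrame.exists_engel_coordinates hs
  have hsrc : ∀ x ∈ ((chartAt E4 p).trans e).source, x ∈ (chartAt E4 p).source ∧
      chartAt E4 p x ∈ e.source := fun x hx => by simpa using hx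
  have hderiv : ∀ x ∈ ((chartAt E4 p).trans e).source, ∀ v : TangentSpace (𝓡 4) x,
      mfderiv (𝓡 4) (𝓡 4) ((chartAt E4 p).trans e) x v =
        fderiv ℝ e (chartAt E4 p x) (chartDeriv p x v) := by
    intro x hx v
    obtain ⟨h1, h2⟩ := hsrc x hx
    have hde : MDifferentiableAt (𝓡 4) (𝓡 4) e (chartAt E4 p x) :=
      ((he.contDiffAt (e.open_source.mem_nhds h2)).differentiableAt (by simp)).mdifferentiableAt
    have := mfderiv_comp x hde ((mdifferentiable_chartAt p).mdifferentiableAt h1)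
    rw [mfderiv_eq_fderiv] at this
    exact congrArg (fun A : TangentSpace (𝓡 4) x →L[ℝ] E4 => A v) this
  have hprop : ∀ x ∈ ((chartAt E4 p).trans e).source, ∀ v : TangentSpace (𝓡 4) x,
        (v ∈ D x ↔ chartDeriv p x v ∈
          Submodule.span ℝ {Y₁ (chartAt E4 p x), Y₂ (chartAt E4 p x)}) ∧
        (v ∈ evenContact D x ↔ α (chartAt E4 p x) (chartDeriv p x v) = 0) ∧
        (v ∈ cauchyCharacteristic D x ↔ chartDeriv p x v ∈
          Submodule.span ℝ {characteristicField Y₁ Y₂ α (chartAt E4 p x)}) := by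
    intro x hx
    obtain ⟨h1, h2⟩ := hsrc x hx
    have := (hes h2).2.1
    rwa [(chartAt E4 p).left_inv h1] at this
  refine ⟨(chartAt E4 p).trans e, ⟨?_, ?_, ?_, ?_, ?_⟩, by simpa using hpe⟩
  · rw [OpenPartialHomeomorph.coe_trans]
    exact he.contMDiffOn.comp ((contMDiffOn_chart (n := ∞)).mono fun x hx => (hsrc x hx).1)
      fun x hx => (hsrc x hx).2
  · rw [OpenPartialHomeomorph.coe_trans_symm]
    refine (contMDiffOn_chart_symm (n := ∞)).comp (he'.contMDiffOn.mono fun u hu => ?_)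
      fun u hu => ?_ 
    · simpa using hu.1
    · exact hu.2
  · rintro x hx v u rfl
    rw [(hprop x hx v).2.1, hderiv x hx]
    exact (hd _ (hsrc x hx).2 _).1
  · rintro x hx v u rfl
    rw [(hprop x hx v).1, hderiv x hx, ← (hes (hsrc x hx).2).2.2,
      (hd _ (hsrc x hx).2 _).2.1]
    rfl
  · rintro x hx v u rfl
    rw [(hprop x hx v).2.2, hderiv x hx]
    exact (hd _ (hsrc x hx).2 _).2.2

end

/-! ### Flexibility: deformations by jets of a function of the first coordinate. -/

section

variable {M : Type*} [TopologicalSpace M] [ChartedSpace E4 M]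

/-- The velocity of a curve depends only on its germ. -/
lemma velocity_congr (A : Distribution M) {a b t : ℝ} {γ δ : ℝ → M} (ht : t ∈ Icc a b)
    (h : δ =ᶠ[𝓝[Icc a b] t] γ) :
    (velocity a b δ t ≠ 0 ∧ velocity a b δ t ∈ A (δ t)) ↔
      (velocity a b γ t ≠ 0 ∧ velocity a b γ t ∈ A (γ t)) := by
  -- The two velocities lie in tangent spaces at points that are equal only propositionally; reading
  -- them in the common model `E4` avoids a transport.
  let Q : M → E4 → Prop := fun x v => v ≠ 0 ∧ (show TangentSpace (𝓡 4) x from v) ∈ A x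
  have h1 : δ t = γ t := h.eq_of_nhdsWithin ht
  have h2 : (velocity a b δ t : E4) = (velocity a b γ t : E4) :=
    congrArg (fun B : ℝ →L[ℝ] E4 => B 1) (h.mfderivWithin_eq h1)
  exact (congrArg₂ Q h1 h2).to_iff

variable [IsManifold (𝓡 4) ∞ M] {D : Distribution M} {e : OpenPartialHomeomorph M E4}

lemma IsEngelChart.contMDiffAt (he : IsEngelChart D e) {x : M} (hx : x ∈ e.source) :
    ContMDiffAt (𝓡 4) (𝓡 4) ∞ e x := he.smooth.contMDiffAt (e.open_source.mem_nhds hx)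

lemma IsEngelChart.contMDiffAt_symm (he : IsEngelChart D e) {u : E4} (hu : u ∈ e.target) :
    ContMDiffAt (𝓡 4) (𝓡 4) ∞ e.symm u := he.smooth_symm.contMDiffAt (e.open_target.mem_nhds hu)

lemma IsEngelChart.mfderiv_injective (he : IsEngelChart D e) {x : M} (hx : x ∈ e.source) :
    Function.Injective (mfderiv (𝓡 4) (𝓡 4) e x) :=
  OpenPartialHomeomorph.MDifferentiable.mfderiv_injective
    ⟨he.smooth.mdifferentiableOn (by simp), he.smooth_symm.mdifferentiableOn (by simp)⟩ hx

/-- The velocity of a curve read in a chart. -/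
lemma IsEngelChart.mfderiv_velocity (he : IsEngelChart D e) {δ : ℝ → M} {s : Set ℝ} {t : ℝ}
    {u : E4} (hs : UniqueDiffWithinAt ℝ s t)
    (hδ : MDifferentiableWithinAt 𝓘(ℝ, ℝ) (𝓡 4) δ s t) (hmem : δ t ∈ e.source)
    (hu : HasDerivWithinAt (e ∘ δ) u s t) :
    mfderiv (𝓡 4) (𝓡 4) e (δ t) (mfderivWithin 𝓘(ℝ, ℝ) (𝓡 4) δ s t (1 : ℝ)) = u := by
  have h1 := ((he.contMDiffAt hmem).mdifferentiableAt
    (by simp)).hasMFDerivAt.comp_hasMFDerivWithinAt t hδ.hasMFDerivWithinAt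
  let A : ℝ →L[ℝ] E4 := (mfderiv (𝓡 4) (𝓡 4) e (δ t)).comp
    (mfderivWithin 𝓘(ℝ, ℝ) (𝓡 4) δ s t)
  have h2 : HasFDerivWithinAt (e ∘ δ) A s t := hasMFDerivWithinAt_iff_hasFDerivWithinAt.1 h1
  have h3 : HasDerivWithinAt (e ∘ δ) (A 1) s t := h2.hasDerivWithinAt
  have h4 : A 1 = u := hs.eq_deriv s h3 hu
  exact h4

lemma IsEngelChart.contDiffWithinAt_comp (he : IsEngelChart D e) {δ : ℝ → M} {s : Set ℝ} {t : ℝ}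
    (hδ : ContMDiffWithinAt 𝓘(ℝ, ℝ) (𝓡 4) ∞ δ s t) (hmem : δ t ∈ e.source) :
    ContDiffWithinAt ℝ ∞ (e ∘ δ) s t :=
  contMDiffWithinAt_iff_contDiffWithinAt.1 ((he.contMDiffAt hmem).comp_contMDiffWithinAt t hδ)

lemma hasDerivWithinAt_coord {G : ℝ → E4} {u : E4} {s : Set ℝ} {t : ℝ}
    (h : HasDerivWithinAt G u s t) (i : Fin 4) : HasDerivWithinAt (fun t => G t i) (u i) s t :=
  (EuclideanSpace.proj i : E4 →L[ℝ] ℝ).hasFDerivAt.comp_hasDerivWithinAt t h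

/-- A curve tangent to an Engel structure which is not a characteristic curve has, in an Engel
chart, an interior point where the first coordinate has nonzero derivative. -/
lemma exists_interior_transverse (hD : IsEngelStructure D) {a b : ℝ} (hab : a < b) {γ : ℝ → M}
    (hγ : IsNonsingularCurve D a b γ) (hW : ¬ IsCauchyCharacteristicCurve D a b γ) :
    ∃ e, IsEngelChart D e ∧ ∃ t ∈ Ioo a b, γ t ∈ e.source ∧
      deriv (fun t => e (γ t) 0) t ≠ 0 := by
  obtain ⟨t₀, ht₀, hv⟩ : ∃ t ∈ Icc a b, velocity a b γ t ∉ cauchyCharacteristic D (γ t) := by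
    by_contra! hcon
    exact hW ⟨hγ.smooth, hγ.velocity_ne_zero, hcon⟩
  obtain ⟨e, he, hmem⟩ := hD.exists_engelChart (γ t₀)
  refine ⟨e, he, ?_⟩
  have hun := uniqueDiffOn_Icc hab
  have hsm : ∀ t ∈ Icc a b, γ t ∈ e.source → ContDiffWithinAt ℝ ∞ (e ∘ γ) (Icc a b) t :=
    fun t ht hm => he.contDiffWithinAt_comp (hγ.smooth t ht) hm
  have hx : ContDiffWithinAt ℝ ∞ (fun t => e (γ t) 0) (Icc a b) t₀ :=
    (EuclideanSpace.proj 0 : E4 →L[ℝ] ℝ).contDiff.contDiffAt.comp_contDiffWithinAt t₀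
      (hsm t₀ ht₀ hmem)
  -- In an Engel chart a vector of `D` with vanishing first coordinate satisfies `dy = dz = 0` too,
  -- so it is characteristic.
  have hne : derivWithin (fun t => e (γ t) 0) (Icc a b) t₀ ≠ 0 := by
    intro h0
    have hd := ((hsm t₀ ht₀ hmem).differentiableWithinAt (by simp)).hasDerivWithinAt
    have h1 := he.mfderiv_velocity (hun t₀ ht₀) ((hγ.smooth t₀ ht₀).mdifferentiableWithinAt
      (by simp)) hmem hd
    set u := derivWithin (e ∘ γ) (Icc a b) t₀
    have hu0 : u 0 = 0 := by
      rw [← h0]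
      exact ((hasDerivWithinAt_coord hd 0).derivWithin (hun t₀ ht₀)).symm
    have h2 := (he.mem_iff _ hmem _ u h1).1 (hγ.tangent t₀ ht₀)
    rw [hu0, mul_zero, mul_zero] at h2
    exact hv ((he.mem_cauchyCharacteristic_iff _ hmem _ u h1).2 ⟨hu0, h2⟩)
  have hcont : ContinuousWithinAt (derivWithin (fun t => e (γ t) 0) (Icc a b)) (Icc a b) t₀ := by
    have := (hx.derivWithin (m := 0) hun (by simp) ht₀).continuousWithinAt
    exact this
  have hev : ∀ᶠ t in 𝓝[Icc a b] t₀, γ t ∈ e.source ∧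
      derivWithin (fun t => e (γ t) 0) (Icc a b) t ≠ 0 :=
    ((hγ.smooth t₀ ht₀).continuousWithinAt.eventually (e.open_source.eventually_mem hmem)).and
      (hcont.eventually_ne hne)
  -- `t₀` may be an end point; as the conditions persist nearby, it can be replaced by an interior
  -- time.
  have hnb : (𝓝[Ioo a b] t₀).NeBot :=
    mem_closure_iff_nhdsWithin_neBot.1 (by rwa [closure_Ioo hab.ne])
  obtain ⟨t, ⟨h1, h2⟩, ht⟩ := ((hev.filter_mono (nhdsWithin_mono _ Ioo_subset_Icc_self)).and
    self_mem_nhdsWithin).exists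
  refine ⟨t, ht, h1, ?_⟩
  rwa [← derivWithin_of_mem_nhds (Icc_mem_nhds ht.1 ht.2)]

/-- The variation field in `ℝ⁴` associated with a function of one variable: it preserves the
Engel structure `dy = z dx`, `dz = w dx`. -/
def jetField (φ : ℝ → ℝ) (x : ℝ) : E4 :=
  φ x • EuclideanSpace.single 1 1 + deriv φ x • EuclideanSpace.single 2 1 +
    deriv (deriv φ) x • EuclideanSpace.single 3 1

lemma contDiff_jetField {φ : ℝ → ℝ} (hφ : ContDiff ℝ ∞ φ) : ContDiff ℝ ∞ (jetField φ) := by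
  have h1 : ContDiff ℝ ∞ (deriv φ) := (contDiff_infty_iff_deriv.1 hφ).2
  have h2 : ContDiff ℝ ∞ (deriv (deriv φ)) := (contDiff_infty_iff_deriv.1 h1).2
  exact ((hφ.smul contDiff_const).add (h1.smul contDiff_const)).add (h2.smul contDiff_const)

lemma deriv_jetField {φ : ℝ → ℝ} (hφ : ContDiff ℝ ∞ φ) (x : ℝ) :
    HasDerivAt (jetField φ) (jetField (deriv φ) x) x := by
  have h1 : ContDiff ℝ ∞ (deriv φ) := (contDiff_infty_iff_deriv.1 hφ).2
  have h2 : ContDiff ℝ ∞ (deriv (deriv φ)) := (contDiff_infty_iff_deriv.1 h1).2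
  exact (((hφ.differentiable (by simp) x).hasDerivAt.smul_const _).add
    ((h1.differentiable (by simp) x).hasDerivAt.smul_const _)).add
    ((h2.differentiable (by simp) x).hasDerivAt.smul_const _)

lemma jetField_eq_zero {φ : ℝ → ℝ} {x : ℝ} (hx : x ∉ tsupport φ) : jetField φ x = 0 := by
  have h := notMem_tsupport_iff_eventuallyEq.1 hx
  have h1 : deriv φ =ᶠ[𝓝 x] 0 := h.deriv.trans (by simp [Pi.zero_def])
  have h2 : deriv (deriv φ) =ᶠ[𝓝 x] 0 := h1.deriv.trans (by simp [Pi.zero_def])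
  simp [jetField, h.eq_of_nhds, h1.eq_of_nhds, h2.eq_of_nhds]

lemma jetField_apply_zero (φ : ℝ → ℝ) (x : ℝ) : jetField φ x 0 = 0 := by
  simp [jetField]

lemma jetField_apply_one (φ : ℝ → ℝ) (x : ℝ) : jetField φ x 1 = φ x := by
  simp [jetField]

lemma jetField_apply_two (φ : ℝ → ℝ) (x : ℝ) : jetField φ x 2 = deriv φ x := by
  simp [jetField]

lemma jetField_apply_three (φ : ℝ → ℝ) (x : ℝ) : jetField φ x 3 = deriv (deriv φ) x := by
  simp [jetField]

end

/-- Since `x' ≠ 0`, the value `x t₀` is isolated near `t₀`. A bump in the variable `x` around that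
value then yields a deformation that vanishes near both ends of `[c, d]`. -/
lemma exists_interval_around {M : Type*} [TopologicalSpace M] {s : Set M} (hs : IsOpen s)
    {a b t₀ : ℝ} {γ : ℝ → M} (ht₀ : t₀ ∈ Ioo a b) (hγ : ContinuousAt γ t₀) (hmem : γ t₀ ∈ s)
    {x : ℝ → ℝ} (hx : deriv x t₀ ≠ 0) :
    ∃ c d, t₀ ∈ Ioo c d ∧ Icc c d ⊆ Ioo a b ∧ (∀ t ∈ Icc c d, γ t ∈ s) ∧
      x c ≠ x t₀ ∧ x d ≠ x t₀ := by
  have h1 : ∀ᶠ t in 𝓝 t₀, t ≠ t₀ → x t ≠ x t₀ :=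
    eventually_nhdsWithin_iff.1 ((differentiableAt_of_deriv_ne_zero hx).hasDerivAt.eventually_ne hx)
  have h2 := h1.and ((isOpen_Ioo.eventually_mem ht₀).and
    (hγ.eventually (hs.eventually_mem hmem)))
  obtain ⟨ρ, hρ, hball⟩ := Metric.eventually_nhds_iff.1 h2
  have hI : ∀ t ∈ Icc (t₀ - ρ / 2) (t₀ + ρ / 2), dist t t₀ < ρ := by
    intro t ht
    rw [Real.dist_eq, abs_lt]
    constructor <;> linarith [ht.1, ht.2]
  refine ⟨t₀ - ρ / 2, t₀ + ρ / 2, ⟨by linarith, by linarith⟩, fun t ht => (hball (hI t ht)).2.1,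
    fun t ht => (hball (hI t ht)).2.2, (hball (hI _ ?_)).1 ?_, (hball (hI _ ?_)).1 ?_⟩
  · exact ⟨le_rfl, by linarith⟩
  · linarith
  · exact ⟨by linarith, le_rfl⟩
  · linarith

section

variable {M : Type*} [TopologicalSpace M] [ChartedSpace E4 M] [IsManifold (𝓡 4) ∞ M]
  {D : Distribution M} {e : OpenPartialHomeomorph M E4}

/-- In an Engel chart, moving a curve tangent to `D` along the jet of a function of the first
coordinate produces curves tangent to `D`. -/
lemma IsEngelChart.velocity_deform (he : IsEngelChart D e) {a b t : ℝ} (ht : t ∈ Ioo a b)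
    {γ δ : ℝ → M} (hγ : MDifferentiableWithinAt 𝓘(ℝ, ℝ) (𝓡 4) γ (Icc a b) t)
    (hδ : MDifferentiableWithinAt 𝓘(ℝ, ℝ) (𝓡 4) δ (Icc a b) t)
    (hγt : γ t ∈ e.source) (hδt : δ t ∈ e.source) {φ : ℝ → ℝ} (hφ : ContDiff ℝ ∞ φ) (s : ℝ)
    (heq : e ∘ δ =ᶠ[𝓝 t] fun t => e (γ t) + s • jetField φ (e (γ t) 0))
    (hv : velocity a b γ t ≠ 0) (hD : velocity a b γ t ∈ D (γ t)) :
    velocity a b δ t ≠ 0 ∧ velocity a b δ t ∈ D (δ t) := by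
  have hun := uniqueDiffOn_Icc (ht.1.trans ht.2) t (Ioo_subset_Icc_self ht)
  have hg : HasDerivWithinAt (e ∘ γ) (derivWithin (e ∘ γ) (Icc a b) t) (Icc a b) t := by
    refine DifferentiableWithinAt.hasDerivWithinAt ?_
    exact (((he.contMDiffAt hγt).mdifferentiableAt (by simp)).comp_mdifferentiableWithinAt t
      hγ).differentiableWithinAt
  set u := derivWithin (e ∘ γ) (Icc a b) t
  have hu := he.mfderiv_velocity hun hγ hγt hg
  have hη : HasDerivWithinAt (fun t => e (γ t) + s • jetField φ (e (γ t) 0))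
      (u + s • u 0 • jetField (deriv φ) (e (γ t) 0)) (Icc a b) t := by
    refine hg.add (HasDerivWithinAt.const_smul s ?_)
    exact (deriv_jetField hφ (e (γ t) 0)).scomp_hasDerivWithinAt t (hasDerivWithinAt_coord hg 0)
  have hd := hη.congr_of_eventuallyEq (heq.filter_mono nhdsWithin_le_nhds) heq.eq_of_nhds
  have hw := he.mfderiv_velocity hun hδ hδt hd
  have hu' := (he.mem_iff _ hγt _ u hu).1 hD
  have het : e (δ t) = _ := heq.eq_of_nhds
  constructor
  -- The first coordinate is not perturbed: if the new velocity vanishes then `u 0 = 0`, the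
  -- correction term disappears, and the old velocity vanishes.
  · intro h0
    change mfderiv (𝓡 4) (𝓡 4) e (δ t) (velocity a b δ t) = _ at hw
    rw [h0, map_zero] at hw
    have hz : u + s • u 0 • jetField (deriv φ) (e (γ t) 0) = 0 := hw.symm
    have hz0 : u 0 = 0 := by
      have := congrArg (fun v : E4 => v 0) hz
      simpa [jetField_apply_zero] using this
    rw [hz0, zero_smul, smul_zero, add_zero] at hz
    refine hv ((he.mfderiv_injective hγt) ?_)
    rw [map_zero]
    exact hu.trans hz
  -- This is the chain rule: `(y + sφ(x))' = (z + sφ'(x)) x'` and `(z + sφ'(x))' = (w + sφ''(x))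
  -- x'`.
  · refine (he.mem_iff _ hδt _ _ hw).2 ?_
    rw [het]
    simp only [PiLp.add_apply, PiLp.smul_apply, smul_eq_mul, jetField_apply_zero,
      jetField_apply_one, jetField_apply_two, jetField_apply_three, hu'.1, hu'.2]
    constructor <;> ring

/-- A nonsingular `D`-curve which is not a characteristic curve is linearly strongly flexible. -/
theorem isLSF_of_not_isCauchyCharacteristicCurve (hD : IsEngelStructure D) {a b : ℝ}
    (hab : a < b) {γ : ℝ → M} (hγ : IsNonsingularCurve D a b γ)
    (hW : ¬ IsCauchyCharacteristicCurve D a b γ) : IsLSF D a b γ := by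
  refine ⟨hγ, ?_⟩
  obtain ⟨e, he, t₀, ht₀, hmem, hne⟩ := exists_interior_transverse hD hab hγ hW
  have hsm : ∀ t ∈ Ioo a b, ContMDiffAt 𝓘(ℝ, ℝ) (𝓡 4) ∞ γ t := fun t ht =>
    hγ.smooth.contMDiffAt (Icc_mem_nhds ht.1 ht.2)
  obtain ⟨c, d, hcd, hsub, hsrc, hxc, hxd⟩ :=
    exists_interval_around e.open_source ht₀ (hsm t₀ ht₀).continuousAt hmem hne
  have hgs : ∀ t ∈ Icc c d, ContDiffAt ℝ ∞ (e ∘ γ) t := fun t ht =>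
    he.contDiffWithinAt_comp (s := univ) (hsm t (hsub ht)) (hsrc t ht)
  have hxs : ∀ t ∈ Icc c d, ContDiffAt ℝ ∞ (fun t => e (γ t) 0) t := fun t ht =>
    (EuclideanSpace.proj 0 : E4 →L[ℝ] ℝ).contDiff.contDiffAt.comp t (hgs t ht)
  set x : ℝ → ℝ := fun t => e (γ t) 0 with hx
  have hxcont : ContinuousOn x (Icc c d) := fun t ht => (hxs t ht).continuousAt.continuousWithinAt
  obtain ⟨φ, hφs, -, hφ, -, hφ1⟩ := exists_contDiff_tsupport_subset (n := ⊤) (x := x t₀)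
    (s := {x c, x d}ᶜ) (by
      refine (Set.toFinite _).isClosed.isOpen_compl.mem_nhds ?_
      simpa using And.intro hxc.symm hxd.symm)
  have hη := contDiff_jetField hφ
  have hηs : ∀ t ∈ Icc c d, ContDiffAt ℝ ∞ (fun t => jetField φ (x t)) t := fun t ht =>
    hη.contDiffAt.comp t (hxs t ht)
  -- All times at which the curve moves lie in `K`. It is closed and contained in the open interval
  -- `(c, d)`, so the formula in the chart and the unchanged curve agree on an overlap and glue
  -- smoothly.
  set K : Set ℝ := Icc c d ∩ x ⁻¹' tsupport φ with hK
  have hKc : IsClosed K :=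
    hxcont.preimage_isClosed_of_isClosed isClosed_Icc (isClosed_tsupport φ)
  have hKsub : K ⊆ Ioo c d := by
    rintro t ⟨ht, htφ⟩
    have := hφs htφ
    refine ⟨lt_of_le_of_ne ht.1 ?_, lt_of_le_of_ne ht.2 ?_⟩
    · rintro rfl
      exact this (by simp)
    · rintro rfl
      exact this (by simp)
  have hIcc : Ioo c d ⊆ Icc c d := Ioo_subset_Icc_self
  obtain ⟨C, hC⟩ := isCompact_Icc.exists_bound_of_continuousOn (s := Icc c d)
    (f := fun t => jetField φ (x t)) fun t ht => (hηs t ht).continuousAt.continuousWithinAt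
  have hcomp : IsCompact ((e ∘ γ) '' Icc c d) := isCompact_Icc.image_of_continuousOn
    fun t ht => (hgs t ht).continuousAt.continuousWithinAt
  -- For `|s| < ρ / (|C| + 1)` the displacement is less than `ρ`, so the deformed curve stays in the
  -- chart; adding `1` avoids a zero denominator.
  obtain ⟨ρ, hρ, hthick⟩ := hcomp.exists_thickening_subset_open e.open_target (by
    rintro _ ⟨t, ht, rfl⟩
    exact e.map_source (hsrc t ht))
  have hC1 : 0 < |C| + 1 := by positivity
  have hε : 0 < ρ / (|C| + 1) := by positivity
  set ε := ρ / (|C| + 1) with hεdef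
  have htarget : ∀ s ∈ Ioo (-ε) ε, ∀ t ∈ Icc c d,
      e (γ t) + s • jetField φ (x t) ∈ e.target := by
    intro s hs t ht
    refine hthick (Metric.mem_thickening_iff.2 ⟨e (γ t), mem_image_of_mem _ ht, ?_⟩)
    rw [dist_self_add_left, norm_smul, Real.norm_eq_abs]
    have h1 : |s| < ε := abs_lt.2 hs
    have h2 : ‖jetField φ (x t)‖ < |C| + 1 := by linarith [hC t ht, le_abs_self C]
    calc |s| * ‖jetField φ (x t)‖ ≤ |s| * (|C| + 1) := by gcongr
      _ < ε * (|C| + 1) := by gcongr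
      _ = ρ := div_mul_cancel₀ _ hC1.ne'
  set Γ : ℝ → ℝ → M := fun s t =>
    if t ∈ Ioo c d then e.symm (e (γ t) + s • jetField φ (x t)) else γ t
  have hon : ∀ s, ∀ t ∈ Ioo c d, Γ s t = e.symm (e (γ t) + s • jetField φ (x t)) :=
    fun s t ht => if_pos ht
  have hoff : ∀ s, ∀ t ∉ K, Γ s t = γ t := by
    intro s t ht
    by_cases h : t ∈ Ioo c d
    · rw [hon s t h, jetField_eq_zero fun h' => ht ⟨hIcc h, h'⟩, smul_zero, add_zero,
        e.left_inv (hsrc t (hIcc h))]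
    · exact if_neg h
  have hzero : ∀ t, Γ 0 t = γ t := by
    intro t
    by_cases h : t ∈ Ioo c d
    · rw [hon 0 t h, zero_smul, add_zero, e.left_inv (hsrc t (hIcc h))]
    · exact if_neg h
  have hsrcΓ : ∀ s ∈ Ioo (-ε) ε, ∀ t ∈ Ioo c d, Γ s t ∈ e.source := fun s hs t ht => by
    rw [hon s t ht]
    exact e.map_target (htarget s hs t (hIcc ht))
  have heΓ : ∀ s ∈ Ioo (-ε) ε, ∀ t ∈ Ioo c d,
      e (Γ s t) = e (γ t) + s • jetField φ (x t) := fun s hs t ht => by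
    rw [hon s t ht, e.right_inv (htarget s hs t (hIcc ht))]
  clear_value Γ
  have hsmooth : ContMDiffOn 𝓘(ℝ, ℝ × ℝ) (𝓡 4) ∞ (fun p : ℝ × ℝ => Γ p.1 p.2)
      (Ioo (-ε) ε ×ˢ Icc a b) := by
    rintro ⟨s, t⟩ ⟨hs, ht⟩
    by_cases htc : t ∈ Ioo c d
    · have h1 : ContDiffAt ℝ ∞ (fun p : ℝ × ℝ => e (γ p.2) + p.1 • jetField φ (x p.2)) (s, t) :=
        ((hgs t (hIcc htc)).comp (s, t) contDiffAt_snd).add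
          (contDiffAt_fst.smul ((hηs t (hIcc htc)).comp (s, t) contDiffAt_snd))
      have h2 : ContMDiffAt 𝓘(ℝ, ℝ × ℝ) (𝓡 4) ∞
          (fun p : ℝ × ℝ => e.symm (e (γ p.2) + p.1 • jetField φ (x p.2))) (s, t) :=
        (he.contMDiffAt_symm (htarget s hs t (hIcc htc))).comp (s, t) h1.contMDiffAt
      refine (h2.congr_of_eventuallyEq ?_).contMDiffWithinAt
      filter_upwards [continuousAt_snd.eventually (isOpen_Ioo.eventually_mem htc)] with p hp
      exact hon _ _ hp
    · have h1 : ContMDiffWithinAt 𝓘(ℝ, ℝ × ℝ) (𝓡 4) ∞ (fun p : ℝ × ℝ => γ p.2)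
          (Ioo (-ε) ε ×ˢ Icc a b) (s, t) :=
        (hγ.smooth t ht).comp (s, t) contDiffWithinAt_snd.contMDiffWithinAt fun p hp => hp.2
      have htK : t ∉ K := fun h => htc (hKsub h)
      refine h1.congr_of_eventuallyEq ?_ (hoff s t htK)
      refine Eventually.filter_mono nhdsWithin_le_nhds ?_
      filter_upwards [continuousAt_snd.eventually (hKc.isOpen_compl.eventually_mem htK)] with p hp
      exact hoff _ _ hp
  have hcurve : ∀ s ∈ Ioo (-ε) ε, ContMDiffOn 𝓘(ℝ, ℝ) (𝓡 4) ∞ (Γ s) (Icc a b) := by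
    intro s hs
    have h1 : ContMDiff 𝓘(ℝ, ℝ) 𝓘(ℝ, ℝ × ℝ) ∞ fun t : ℝ => (s, t) :=
      (contDiff_const.prodMk contDiff_id).contMDiff
    exact hsmooth.comp h1.contMDiffOn fun t ht => ⟨hs, ht⟩
  have hvel : ∀ s ∈ Ioo (-ε) ε, ∀ t ∈ Icc a b,
      velocity a b (Γ s) t ≠ 0 ∧ velocity a b (Γ s) t ∈ D (Γ s t) := by
    intro s hs t ht
    by_cases htc : t ∈ Ioo c d
    · refine he.velocity_deform (hsub (hIcc htc)) ((hγ.smooth t ht).mdifferentiableWithinAt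
        (by simp)) ((hcurve s hs t ht).mdifferentiableWithinAt (by simp)) (hsrc t (hIcc htc))
        (hsrcΓ s hs t htc) hφ s ?_ (hγ.velocity_ne_zero t ht) (hγ.tangent t ht)
      filter_upwards [isOpen_Ioo.eventually_mem htc] with t' ht'
      exact heΓ s hs t' ht'
    · refine (velocity_congr D ht ?_).2 ⟨hγ.velocity_ne_zero t ht, hγ.tangent t ht⟩
      have htK : t ∉ K := fun h => htc (hKsub h)
      refine Eventually.filter_mono nhdsWithin_le_nhds ?_
      filter_upwards [hKc.isOpen_compl.eventually_mem htK] with t' ht'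
      exact hoff s t' ht'
  refine ⟨ε, hε, Γ, hsmooth, fun t _ => hzero t, fun s hs => ⟨hcurve s hs,
    fun t ht => (hvel s hs t ht).1, fun t ht => (hvel s hs t ht).2⟩,
    ⟨univ ×ˢ Kᶜ, isOpen_univ.prod hKc.isOpen_compl, ?_, fun s _ t _ h => hoff s t h.2⟩,
    t₀, ht₀, fun hE => ?_⟩
  · rintro ⟨s, t⟩ ⟨-, rfl | rfl⟩
    · exact ⟨mem_univ _, fun h => lt_irrefl _ (hsub (hIcc (hKsub h))).1⟩
    · exact ⟨mem_univ _, fun h => lt_irrefl _ (hsub (hIcc (hKsub h))).2⟩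
  · have h0 : (0 : ℝ) ∈ Ioo (-ε) ε := ⟨by linarith, hε⟩
    have hd : HasDerivWithinAt (e ∘ fun s => Γ s t₀) (jetField φ (x t₀)) univ 0 := by
      rw [hasDerivWithinAt_univ]
      have h1 : HasDerivAt (fun s : ℝ => e (γ t₀) + s • jetField φ (x t₀))
          (jetField φ (x t₀)) 0 := by
        simpa using ((hasDerivAt_id (0 : ℝ)).smul_const (jetField φ (x t₀))).const_add (e (γ t₀))
      refine h1.congr_of_eventuallyEq ?_
      filter_upwards [isOpen_Ioo.eventually_mem h0] with s hs
      exact heΓ s hs t₀ hcd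
    have hmd : MDifferentiableWithinAt 𝓘(ℝ, ℝ) (𝓡 4) (fun s => Γ s t₀) univ 0 := by
      have h1 : ContMDiff 𝓘(ℝ, ℝ) 𝓘(ℝ, ℝ × ℝ) ∞ fun s : ℝ => (s, t₀) :=
        (contDiff_id.prodMk contDiff_const).contMDiff
      have h2 := (hsmooth (0, t₀) ⟨h0, Ioo_subset_Icc_self ht₀⟩).contMDiffAt
        (prod_mem_nhds (Ioo_mem_nhds h0.1 h0.2) (Icc_mem_nhds ht₀.1 ht₀.2))
      have h3 : ContMDiffAt 𝓘(ℝ, ℝ) (𝓡 4) ∞ (fun s => Γ s t₀) 0 :=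
        ContMDiffAt.comp (0 : ℝ) (g := fun p : ℝ × ℝ => Γ p.1 p.2) h2 h1.contMDiffAt
      exact (h3.mdifferentiableAt (by simp)).mdifferentiableWithinAt
    have h1 := he.mfderiv_velocity uniqueDiffWithinAt_univ hmd (hsrcΓ 0 h0 t₀ hcd) hd
    rw [mfderivWithin_univ] at h1
    -- On the variation vector `dx = 0` while `dy = φ (x t₀) = 1`, which violates `dy = z dx`.
    have h2 := (he.mem_evenContact_iff _ (hsrcΓ 0 h0 t₀ hcd) _ _ h1).1 hE
    rw [jetField_apply_zero, jetField_apply_one, hφ1, mul_zero] at h2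
    exact one_ne_zero h2

end

/-! ### Rigidity: the variation of a characteristic curve stays in, or out of, `E`. -/

section

/-- Infinitesimal form of the fact that the contact form `dy - z dx` is constant along its
characteristics. -/
lemma hasFDerivAt_contact_variation {E : Type*} [NormedAddCommGroup E] [NormedSpace ℝ E]
    {x y z : E → ℝ} {q v w : E} (hx : ContDiffAt ℝ ∞ x q) (hy : ContDiffAt ℝ ∞ y q)
    (hz : ContDiffAt ℝ ∞ z q) (h : ∀ᶠ p in 𝓝 q, fderiv ℝ y p w = z p * fderiv ℝ x p w)
    (hx0 : fderiv ℝ x q w = 0) (hz0 : fderiv ℝ z q w = 0) :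
    ∃ A : E →L[ℝ] ℝ, HasFDerivAt (fun p => fderiv ℝ y p v - z p * fderiv ℝ x p v) A q ∧
      A w = 0 := by
  have hd : ∀ {f : E → ℝ}, ContDiffAt ℝ ∞ f q → HasFDerivAt (fderiv ℝ f)
      (fderiv ℝ (fderiv ℝ f) q) q := fun hf =>
    ((hf.fderiv_right (m := ∞) (by simp)).differentiableAt (by simp)).hasFDerivAt
  have hev : ∀ {f : E → ℝ}, ContDiffAt ℝ ∞ f q → ∀ v, HasFDerivAt (fun p => fderiv ℝ f p v)
      ((fderiv ℝ (fderiv ℝ f) q).flip v) q := fun hf v => by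
    simpa using (hd hf).clm_apply (hasFDerivAt_const v q)
  have hzd := (hz.differentiableAt (by simp)).hasFDerivAt
  refine ⟨_, (hev hy v).sub (hzd.mul (hev hx v)), ?_⟩
  have hsy : fderiv ℝ (fderiv ℝ y) q w v = fderiv ℝ (fderiv ℝ y) q v w :=
    hy.isSymmSndFDerivAt (by simpa using ENat.LEInfty.out) w v
  have hsx : fderiv ℝ (fderiv ℝ x) q w v = fderiv ℝ (fderiv ℝ x) q v w :=
    hx.isSymmSndFDerivAt (by simpa using ENat.LEInfty.out) w v
  -- Differentiating `y_w = z x_w` in the direction `v`, where `x_w = 0`, gives `y_vw = z x_vw`.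
  -- With `z_w = 0` and symmetry of second derivatives, this cancels the derivative of `y_v - z x_v`
  -- along `w`.
  have h1 := (hev hy w).unique ((hzd.mul (hev hx w)).congr_of_eventuallyEq h)
  have h2 := congrArg (fun A : E →L[ℝ] ℝ => A v) h1
  simp only [ContinuousLinearMap.flip_apply, add_apply, smul_apply, sub_apply, smul_eq_mul,
    hx0, hz0, zero_mul, add_zero, mul_zero] at h2 ⊢
  rw [hsy, hsx, h2]
  ring

lemma hasDerivAt_fst {F : Type*} [NormedAddCommGroup F] [NormedSpace ℝ F] {G : ℝ × ℝ → F}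
    {s t : ℝ} {A : ℝ × ℝ →L[ℝ] F} (h : HasFDerivAt G A (s, t)) :
    HasDerivAt (fun s => G (s, t)) (A (1, 0)) s :=
  h.comp_hasDerivAt s ((hasDerivAt_id s).prodMk (hasDerivAt_const s t))

lemma hasDerivAt_snd {F : Type*} [NormedAddCommGroup F] [NormedSpace ℝ F] {G : ℝ × ℝ → F}
    {s t : ℝ} {A : ℝ × ℝ →L[ℝ] F} (h : HasFDerivAt G A (s, t)) :
    HasDerivAt (fun t => G (s, t)) (A (0, 1)) t :=
  h.comp_hasDerivAt t ((hasDerivAt_const t s).prodMk (hasDerivAt_id t))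

variable {M : Type*} [TopologicalSpace M] [ChartedSpace E4 M] [IsManifold (𝓡 4) ∞ M]
  {D : Distribution M}

/-- The variation field of a deformation, through `D`-curves, of a characteristic curve is
tangent to the even contact structure along an open and closed set of times. -/
lemma eventually_variation_mem_iff (hD : IsEngelStructure D) {a b : ℝ} {Γ : ℝ → ℝ → M} {ε : ℝ}
    (hε : 0 < ε) (hΓ : ContMDiffOn 𝓘(ℝ, ℝ × ℝ) (𝓡 4) ∞ (fun p : ℝ × ℝ => Γ p.1 p.2)
      (Ioo (-ε) ε ×ˢ Icc a b))
    (hcurve : ∀ s ∈ Ioo (-ε) ε, IsNonsingularCurve D a b (Γ s))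
    (hW : ∀ t ∈ Icc a b, velocity a b (Γ 0) t ∈ cauchyCharacteristic D (Γ 0 t))
    {t₀ : ℝ} (ht₀ : t₀ ∈ Ioo a b) :
    ∀ᶠ t in 𝓝 t₀,
      (mfderiv 𝓘(ℝ, ℝ) (𝓡 4) (fun s : ℝ => Γ s t₀) 0 (1 : ℝ) ∈ evenContact D (Γ 0 t₀) ↔
        mfderiv 𝓘(ℝ, ℝ) (𝓡 4) (fun s : ℝ => Γ s t) 0 (1 : ℝ) ∈ evenContact D (Γ 0 t)) := by
  obtain ⟨e, he, hmem⟩ := hD.exists_engelChart (Γ 0 t₀)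
  have h0 : (0 : ℝ) ∈ Ioo (-ε) ε := ⟨by linarith, hε⟩
  have hΓat : ∀ s ∈ Ioo (-ε) ε, ∀ t ∈ Ioo a b,
      ContMDiffAt 𝓘(ℝ, ℝ × ℝ) (𝓡 4) ∞ (fun p : ℝ × ℝ => Γ p.1 p.2) (s, t) := fun s hs t ht =>
    (hΓ (s, t) ⟨hs, Ioo_subset_Icc_self ht⟩).contMDiffAt
      (prod_mem_nhds (Ioo_mem_nhds hs.1 hs.2) (Icc_mem_nhds ht.1 ht.2))
  have hgood : ∀ᶠ p : ℝ × ℝ in 𝓝 (0, t₀), p.1 ∈ Ioo (-ε) ε ∧ p.2 ∈ Ioo a b ∧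
      Γ p.1 p.2 ∈ e.source :=
    (continuousAt_fst.eventually (isOpen_Ioo.eventually_mem h0)).and
      ((continuousAt_snd.eventually (isOpen_Ioo.eventually_mem ht₀)).and
        ((hΓat 0 h0 t₀ ht₀).continuousAt.eventually (e.open_source.eventually_mem hmem)))
  set G : ℝ × ℝ → E4 := fun p => e (Γ p.1 p.2) with hG
  have hGs : ∀ p : ℝ × ℝ, p.1 ∈ Ioo (-ε) ε ∧ p.2 ∈ Ioo a b ∧ Γ p.1 p.2 ∈ e.source →
      ContDiffAt ℝ ∞ G p := fun p hp =>
    contMDiffAt_iff_contDiffAt.1 (ContMDiffAt.comp p (g := e) (f := fun p : ℝ × ℝ => Γ p.1 p.2)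
      (he.contMDiffAt hp.2.2) (hΓat p.1 hp.1 p.2 hp.2.1))
  have hcoord : ∀ i : Fin 4, ∀ p : ℝ × ℝ, p.1 ∈ Ioo (-ε) ε ∧ p.2 ∈ Ioo a b ∧
      Γ p.1 p.2 ∈ e.source → ContDiffAt ℝ ∞ (fun p => G p i) p := fun i p hp =>
    (EuclideanSpace.proj i : E4 →L[ℝ] ℝ).contDiff.contDiffAt.comp p (hGs p hp)
  have hcoord' : ∀ i : Fin 4, ∀ p : ℝ × ℝ, p.1 ∈ Ioo (-ε) ε ∧ p.2 ∈ Ioo a b ∧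
      Γ p.1 p.2 ∈ e.source → ∀ v, fderiv ℝ G p v i = fderiv ℝ (fun p => G p i) p v :=
      fun i p hp v => by
    have := (EuclideanSpace.proj i : E4 →L[ℝ] ℝ).hasFDerivAt.comp p
      ((hGs p hp).differentiableAt (by simp)).hasFDerivAt
    exact (congrArg (fun A : ℝ × ℝ →L[ℝ] ℝ => A v) this.fderiv).symm
  have hvel : ∀ p : ℝ × ℝ, p.1 ∈ Ioo (-ε) ε ∧ p.2 ∈ Ioo a b ∧ Γ p.1 p.2 ∈ e.source →
      mfderiv (𝓡 4) (𝓡 4) e (Γ p.1 p.2) (velocity a b (Γ p.1) p.2) = fderiv ℝ G p (0, 1) := by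
    rintro ⟨s, t⟩ hp
    have ht := Ioo_subset_Icc_self hp.2.1
    exact he.mfderiv_velocity (uniqueDiffOn_Icc (hp.2.1.1.trans hp.2.1.2) t ht)
      (((hcurve s hp.1).smooth t ht).mdifferentiableWithinAt (by simp)) hp.2.2
      (hasDerivAt_snd ((hGs _ hp).differentiableAt (by simp)).hasFDerivAt).hasDerivWithinAt
  -- Membership of the variation in `E` becomes the vanishing of the scalar `∂_s y - z ∂_s x` at `s
  -- = 0`.
  have hvar : ∀ t, t ∈ Ioo a b ∧ Γ 0 t ∈ e.source →
      (mfderiv 𝓘(ℝ, ℝ) (𝓡 4) (fun s : ℝ => Γ s t) 0 (1 : ℝ) ∈ evenContact D (Γ 0 t) ↔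
        fderiv ℝ (fun p => G p 1) (0, t) (1, 0) -
          G (0, t) 2 * fderiv ℝ (fun p => G p 0) (0, t) (1, 0) = 0) := by
    intro t ht
    have hmd : MDifferentiableWithinAt 𝓘(ℝ, ℝ) (𝓡 4) (fun s => Γ s t) univ 0 := by
      have h1 : ContMDiff 𝓘(ℝ, ℝ) 𝓘(ℝ, ℝ × ℝ) ∞ fun s : ℝ => (s, t) :=
        (contDiff_id.prodMk contDiff_const).contMDiff
      have h3 : ContMDiffAt 𝓘(ℝ, ℝ) (𝓡 4) ∞ (fun s => Γ s t) 0 :=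
        ContMDiffAt.comp (0 : ℝ) (g := fun p : ℝ × ℝ => Γ p.1 p.2) (hΓat 0 h0 t ht.1)
          h1.contMDiffAt
      exact (h3.mdifferentiableAt (by simp)).mdifferentiableWithinAt
    have h1 := he.mfderiv_velocity (δ := fun s => Γ s t) uniqueDiffWithinAt_univ hmd ht.2
      (hasDerivAt_fst ((hGs (0, t) ⟨h0, ht⟩).differentiableAt
        (by simp)).hasFDerivAt).hasDerivWithinAt
    rw [mfderivWithin_univ] at h1
    rw [he.mem_evenContact_iff _ ht.2 _ _ h1, hcoord' 1 (0, t) ⟨h0, ht⟩,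
      hcoord' 0 (0, t) ⟨h0, ht⟩, sub_eq_zero]
  have hslice : ∀ᶠ t in 𝓝 t₀, t ∈ Ioo a b ∧ Γ 0 t ∈ e.source :=
    ((continuousAt_const.prodMk continuousAt_id).eventually hgood).mono fun t ht => ht.2
  obtain ⟨ρ, hρ, hball⟩ := Metric.eventually_nhds_iff_ball.1 hslice
  have hderiv : ∀ t ∈ Metric.ball t₀ ρ, HasDerivAt (fun t =>
      fderiv ℝ (fun p => G p 1) (0, t) (1, 0) -
          G (0, t) 2 * fderiv ℝ (fun p => G p 0) (0, t) (1, 0)) 0 t := by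
    intro t ht
    have htg := hball t ht
    have hq : ((0, t) : ℝ × ℝ).1 ∈ Ioo (-ε) ε ∧ ((0, t) : ℝ × ℝ).2 ∈ Ioo a b ∧
      Γ ((0, t) : ℝ × ℝ).1 ((0, t) : ℝ × ℝ).2 ∈ e.source := ⟨h0, htg⟩
    have hev : ∀ᶠ p : ℝ × ℝ in 𝓝 (0, t), p.1 ∈ Ioo (-ε) ε ∧ p.2 ∈ Ioo a b ∧
        Γ p.1 p.2 ∈ e.source :=
      (continuousAt_fst.eventually (isOpen_Ioo.eventually_mem h0)).and
        ((continuousAt_snd.eventually (isOpen_Ioo.eventually_mem htg.1)).and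
          ((hΓat 0 h0 t htg.1).continuousAt.eventually (e.open_source.eventually_mem htg.2)))
    -- The curve at `s = 0` is characteristic, so `∂_t x = ∂_t z = 0` there; the other curves are
    -- used only through `∂_t y = z ∂_t x`.
    have hlin := (he.mem_cauchyCharacteristic_iff _ hq.2.2 _ _ (hvel _ hq)).1
      (hW t (Ioo_subset_Icc_self htg.1))
    rw [hcoord' 0 _ hq, hcoord' 1 _ hq, hcoord' 2 _ hq] at hlin
    obtain ⟨A, hA, hA0⟩ := hasFDerivAt_contact_variation (v := (1, 0)) (w := (0, 1))
      (hcoord 0 _ hq) (hcoord 1 _ hq) (hcoord 2 _ hq) (by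
        filter_upwards [hev] with p hp
        rw [← hcoord' 0 p hp, ← hcoord' 1 p hp]
        exact ((he.mem_iff _ hp.2.2 _ _ (hvel p hp)).1
          ((hcurve p.1 hp.1).tangent p.2 (Ioo_subset_Icc_self hp.2.1))).1) hlin.1 hlin.2.2
    have := hasDerivAt_snd hA
    rwa [hA0] at this
  filter_upwards [Metric.ball_mem_nhds t₀ hρ] with t ht
  rw [hvar t (hball t ht), hvar t₀ (hball t₀ (Metric.mem_ball_self hρ))]
  have := Metric.isOpen_ball.is_const_of_deriv_eq_zero
    (Metric.isPreconnected_ball (x := t₀) (r := ρ))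
    (fun t ht => (hderiv t ht).differentiableAt.differentiableWithinAt)
    (fun t ht => (hderiv t ht).deriv) ht (Metric.mem_ball_self hρ)
  rw [this]

/-- A nonsingular characteristic curve is not linearly strongly flexible. -/
theorem not_isLSF_of_isCauchyCharacteristicCurve (hD : IsEngelStructure D) {a b : ℝ}
    (hab : a < b) {γ : ℝ → M} (hγ : IsCauchyCharacteristicCurve D a b γ) :
    ¬ IsLSF D a b γ := by
  rintro ⟨-, ε, hε, Γ, hΓ, hΓ0, hcurve, ⟨N, hN, hNsub, hNΓ⟩, t₁, ht₁, hvar⟩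
  have h0 : (0 : ℝ) ∈ Ioo (-ε) ε := ⟨by linarith, hε⟩
  have hW : ∀ t ∈ Icc a b, velocity a b (Γ 0) t ∈ cauchyCharacteristic D (Γ 0 t) := fun t ht =>
    ((velocity_congr _ ht (eventually_mem_nhdsWithin.mono hΓ0)).2
      ⟨hγ.velocity_ne_zero t ht, hγ.tangent t ht⟩).2
  -- A product neighborhood of `(0, a)` inside `N` gives an interior time `t₂` at which the
  -- deformation does not move for small `s`, so its variation is zero there.
  have haN : N ∈ 𝓝 ((0, a) : ℝ × ℝ) := hN.mem_nhds (hNsub ⟨h0, by simp⟩)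
  obtain ⟨S, hS, T, hT, hST⟩ := mem_nhds_prod_iff.1 haN
  have hnb : (𝓝[Ioo a b] a).NeBot :=
    mem_closure_iff_nhdsWithin_neBot.1 (by rw [closure_Ioo hab.ne]; exact left_mem_Icc.2 hab.le)
  obtain ⟨t₂, ht₂, hT₂⟩ := hnb.nonempty_of_mem (inter_mem_nhdsWithin (Ioo a b) hT)
  have hconst : (fun s => Γ s t₂) =ᶠ[𝓝 0] fun _ => γ t₂ := by
    filter_upwards [hS, isOpen_Ioo.eventually_mem h0] with s hs hs'
    exact hNΓ s hs' t₂ (Ioo_subset_Icc_self ht₂) (hST ⟨hs, hT₂⟩)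
  have hmem₂ : mfderiv 𝓘(ℝ, ℝ) (𝓡 4) (fun s : ℝ => Γ s t₂) 0 (1 : ℝ) ∈
      evenContact D (Γ 0 t₂) := by
    have h1 := hconst.mfderiv_eq (I := 𝓘(ℝ, ℝ)) (I' := 𝓡 4)
    rw [mfderiv_const] at h1
    have h2 : mfderiv 𝓘(ℝ, ℝ) (𝓡 4) (fun s : ℝ => Γ s t₂) 0 (1 : ℝ) = 0 :=
      congrArg (fun A : ℝ →L[ℝ] E4 => A 1) h1
    rw [h2]
    exact Submodule.zero_mem _
  -- Membership in `E` is a locally constant property of the time; connectedness of `(a, b)` carries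
  -- it from `t₂` to `t₁`.
  refine hvar ((isPreconnected_Ioo.induction₂ (fun t t' =>
    (mfderiv 𝓘(ℝ, ℝ) (𝓡 4) (fun s : ℝ => Γ s t) 0 (1 : ℝ) ∈ evenContact D (Γ 0 t) ↔
      mfderiv 𝓘(ℝ, ℝ) (𝓡 4) (fun s : ℝ => Γ s t') 0 (1 : ℝ) ∈ evenContact D (Γ 0 t')))
    (fun t ht => ?_) ?_ ?_ ht₂ ht₁).1 hmem₂)
  · exact Eventually.filter_mono nhdsWithin_le_nhds
      (eventually_variation_mem_iff hD hε hΓ hcurve hW ht)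
  · exact fun _ _ _ _ _ _ h h' => h.trans h'
  · exact fun _ _ _ _ h => h.symm

end

end Engel

end

open scoped Manifold ContDiff in
theorem proposition3p5 {M : Type*} [TopologicalSpace M] [ChartedSpace Engel.E4 M]
    [IsManifold (𝓡 4) ∞ M] (D : Engel.Distribution M) (hD : Engel.IsEngelStructure D)
    (a b : ℝ) (hab : a < b) (γ : ℝ → M) (hγ : Engel.IsNonsingularCurve D a b γ) :
    (¬ Engel.IsCauchyCharacteristicCurve D a b γ → Engel.IsLSF D a b γ) ∧
    (Engel.IsIWR D a b γ ↔ Engel.IsCauchyCharacteristicCurve D a b γ) := by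
  have h1 := Engel.isLSF_of_not_isCauchyCharacteristicCurve hD hab hγ
  exact ⟨h1, fun h => not_imp_comm.1 h1 h.2, fun h =>
    ⟨hγ, Engel.not_isLSF_of_isCauchyCharacteristicCurve hD hab h⟩⟩
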